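/- **Conventions.** Let $M$ be a smooth manifold of dimension $n\ge 3$, $f:M\to\mathbb R^{n+1}$ a smooth immersion and $\xi:M\to\mathbb R^{n+1}$ a smooth transversal field. The flat connection of $\mathbb R^{n+1}$ decomposes as $\bar\nabla_XY=\nabla_XY+G(X,Y)\xi$ and $\bar\nabla_X\xi=-\hat A(X)+\Theta(X)\xi$. The pair $(f,\xi)$ is *relative* if $\Theta=0$, and an *improper relative sphere* if it is relative and $\xi$ is a nonzero constant vector (so $\hat A=0$). If $G$ is non-degenerate, it is a pseudo-Riemannian metric with Levi-Civita connection $\nabla^G$; put $\hat C(X,Y)=\nabla_XY-\nabla^G_XY$, $C(X,Y,Z)=G(\hat C(X,Y),Z)$, $(n+2)u(X)=\operatorname{tr}(Y\mapsto\hat C(X,Y))$ and $U(X,Y,Z)=C(X,Y,Z)-u(X)G(Y,Z)-u(Y)G(X,Z)-u(Z)G(X,Y)$. For a metric $g$ let $\mathsf P^g=\frac1{n-2}\big(\mathrm{Ric}^g-\frac{\mathrm{Scal}^g}{2(n-1)}g\big)$. For a symmetric $(0,3)$-tensor $T$ let $T_XY$ be the vector with $g(T_XY,\cdot)=T(X,Y,\cdot)$,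 let $\mathscr T(X,Y)=\operatorname{tr}(T_XT_Y)$, and let $[\cdot]_\circ$ denote the trace-free part. A non-degenerate relative normalisation $(f,\xi)$ is an *abundant hypersurface normalisation* if the Weyl tensor of $G$ vanishes and $$\Pi_{\mathrm{Sym}^4_0}(\nabla^GU)=\Pi_{\mathrm{Sym}^4_0}\big[\mathfrak U+4\,U\otimes u\big],\qquad \mathfrak U(X,Y,Z,W)=G(U_XU_YW,Z),$$ $$\nabla^Gu=\mathsf P^G+u\otimes u-\tfrac{|u|^2}2G+\tfrac1{n-2}\Big(\mathscr U+\tfrac{n-6}{2(n+2)(n-1)}|U|^2G\Big),$$ where $\Pi_{\mathrm{Sym}^4_0}$ is the projection onto totally symmetric trace-free tensors. An *abundant manifold* $(M,g,S,t)$ is a conformally flat pseudo-Riemannian manifold of dimension $n\ge3$ (i.e. the Weyl tensor vanishes and, if $n=3$, the Cotton tensor vanishes) with a totally symmetric trace-free $(0,3)$-tensor field $S$ and a smooth function $t$ such that (i) $(\nabla^g)^2t=3\mathsf P^g+\frac13\big(dt^2-\frac12|\mathrm{grad}\,t|^2g\big)+\frac1{3(n-2)}\Big(\mathscr S+\frac{(n-6)|S|^2g}{2(n-1)(n+2)}\Big)$;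 (ii) $(\nabla^g_WS)(X,Y,Z)=\frac13(\Pi S_1)(X,Y,Z,W)$, where $$S_1(X,Y,Z,W)=g(S_XS_YZ,W)+3S(X,Y,W)\,dt(Z)+S(X,Y,Z)\,dt(W)+\Big(\tfrac4{n-2}\mathscr S(Y,Z)-3S(Y,Z,\mathrm{grad}\,t)\Big)g(X,W)$$ and $\Pi$ is the projection onto the tensors that are symmetric and trace-free in the first three arguments; (iii) the totally trace-free (Weyl) part of $(X,Y,Z,W)\mapsto g(S_XY,S_ZW)$ vanishes, i.e. $\frac12\big(g(S_XZ,S_YW)-g(S_XW,S_YZ)\big)$ is a Kulkarni–Nomizu product of a symmetric $(0,2)$-tensor with $g$. Put $\tau=\frac2{3(n-2)}[\mathscr S]_\circ-\frac23\big[S(\cdot,\cdot,\mathrm{grad}\,t)+dt\otimes dt\big]_\circ+2[\mathsf P^g]_\circ$. An abundant manifold is *proper* if $\tau=0$. **Proposition.** Let $n\ge 3$ and let $(f,\xi)$ be an improper relative sphere that is an abundant hypersurface normalisation and whose metric $G$ has constant curvature, i.e. $R^G(X,Y)Z=\kappa\,(G(Y,Z)X-G(X,Z)Y)$ for some $\kappa\in\mathbb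 R$. Then $(f,\xi)$ corresponds to a proper abundant manifold: there is a smooth function $t$ on $M$ with $dt=3u$, and for every such $t$ the data $(M,G,3U,t)$ are an abundant manifold with $\tau=0$. -/

import Mathlib

open scoped Manifold ContDiff

noncomputable section

namespace AbundantGeometry

/-! ### Tensor algebra at a point, in components

`g` is the matrix of a scalar product in a basis, `g⁻¹` raises indices. -/

section Algebra

variable {n : ℕ}

/-- Trace of a `(0,2)`-tensor with respect to `g`. -/
def tr2 (g : Matrix (Fin n) (Fin n) ℝ) (B : Fin n → Fin n → ℝ) : ℝ :=
  ∑ i, ∑ j, g⁻¹ i j * B i j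

/-- Trace-free part of a `(0,2)`-tensor. -/
def tracefree2 (g : Matrix (Fin n) (Fin n) ℝ) (B : Fin n → Fin n → ℝ) (i j : Fin n) : ℝ :=
  B i j - (1 / (n : ℝ)) * tr2 g B * g i j

/-- Contravariant components `v^a = g^{ab} v_b` of a covector. -/
def raise (g : Matrix (Fin n) (Fin n) ℝ) (v : Fin n → ℝ) (a : Fin n) : ℝ :=
  ∑ b, g⁻¹ a b * v b

/-- `|v|²_g` of a covector. -/
def normSq1 (g : Matrix (Fin n) (Fin n) ℝ) (v : Fin n → ℝ) : ℝ :=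
  ∑ a, raise g v a * v a

/-- Matrix entries of the endomorphism `T_X = T̂(X, ·)` for `X = e_i`:
`T_{e_i} e_a = ∑ b, endo g T i b a • e_b`. -/
def endo (g : Matrix (Fin n) (Fin n) ℝ) (T : Fin n → Fin n → Fin n → ℝ)
    (i b a : Fin n) : ℝ :=
  ∑ c, g⁻¹ b c * T i a c

/-- The symmetric form `(X, Y) ↦ tr (T_X T_Y)`. -/
def traceSq (g : Matrix (Fin n) (Fin n) ℝ) (T : Fin n → Fin n → Fin n → ℝ)
    (i j : Fin n) : ℝ :=
  ∑ a, ∑ b, endo g T i b a * endo g T j a b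

/-- `|T|²_g` for a `(0,3)`-tensor. -/
def normSq3 (g : Matrix (Fin n) (Fin n) ℝ) (T : Fin n → Fin n → Fin n → ℝ) : ℝ :=
  ∑ i, ∑ j, ∑ k, ∑ a, ∑ b, ∑ c, g⁻¹ i a * g⁻¹ j b * g⁻¹ k c * T i j k * T a b c

/-- `T(e_i, e_j, v^♯)` for a covector `v`. -/
def contract (g : Matrix (Fin n) (Fin n) ℝ) (T : Fin n → Fin n → Fin n → ℝ)
    (v : Fin n → ℝ) (i j : Fin n) : ℝ :=
  ∑ a, T i j a * raise g v a

/-- `g(T_{e_i} T_{e_j} e_k, e_l)`. -/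
def compTwo (g : Matrix (Fin n) (Fin n) ℝ) (T : Fin n → Fin n → Fin n → ℝ)
    (i j k l : Fin n) : ℝ :=
  ∑ a, ∑ b, endo g T j a k * endo g T i b a * g b l

/-- `g(T_{e_i} e_j, T_{e_k} e_l)`. -/
def pairTwo (g : Matrix (Fin n) (Fin n) ℝ) (T : Fin n → Fin n → Fin n → ℝ)
    (i j k l : Fin n) : ℝ :=
  ∑ a, ∑ b, g a b * endo g T i a j * endo g T k b l

/-- Kulkarni–Nomizu product. -/
def kulkarniNomizu (B D : Fin n → Fin n → ℝ) (i j k l : Fin n) : ℝ :=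
  B i k * D j l + B j l * D i k - B i l * D j k - B j k * D i l

/-- Symmetrisation of a `(0,4)`-tensor in its first three arguments. -/
def symFirstThree (B : Fin n → Fin n → Fin n → Fin n → ℝ) (i j k l : Fin n) : ℝ :=
  (1 / 6 : ℝ) * (B i j k l + B j k i l + B k i j l + B j i k l + B i k j l + B k j i l)

/-- Projection of a `(0,4)`-tensor onto its part that is symmetric and trace-free in the
first three arguments. -/
def projSymZeroThree (g : Matrix (Fin n) (Fin n) ℝ)
    (B : Fin n → Fin n → Fin n → Fin n → ℝ) (i j k l : Fin n) : ℝ :=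
  symFirstThree B i j k l - 3 / ((n : ℝ) + 2) *
    symFirstThree
      (fun p q r s => g p q * tr2 g (fun a b => symFirstThree B a b r s)) i j k l

/-- Total symmetrisation of a `(0,4)`-tensor. -/
def symFour (B : Fin n → Fin n → Fin n → Fin n → ℝ) (i j k l : Fin n) : ℝ :=
  (1 / 24 : ℝ) * ∑ σ : Equiv.Perm (Fin 4),
    B (![i, j, k, l] (σ 0)) (![i, j, k, l] (σ 1)) (![i, j, k, l] (σ 2)) (![i, j, k, l] (σ 3))

/-- Trace of the total symmetrisation of a `(0,4)`-tensor. -/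
def trSymFour (g : Matrix (Fin n) (Fin n) ℝ) (B : Fin n → Fin n → Fin n → Fin n → ℝ)
    (i j : Fin n) : ℝ :=
  tr2 g (fun a b => symFour B a b i j)

/-- Projection of a `(0,4)`-tensor onto its totally symmetric, trace-free part. -/
def projSymZeroFour (g : Matrix (Fin n) (Fin n) ℝ)
    (B : Fin n → Fin n → Fin n → Fin n → ℝ) : Fin n → Fin n → Fin n → Fin n → ℝ :=
  symFour fun i j k l =>
    B i j k l - 6 / ((n : ℝ) + 4) *
      ((trSymFour g B i j - tr2 g (trSymFour g B) / (2 * ((n : ℝ) + 2)) * g i j) * g k l)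

/-- The curvature-type symmetrisation of a `(0,4)`-tensor. -/
def riemannPart (B : Fin n → Fin n → Fin n → Fin n → ℝ) (i j k l : Fin n) : ℝ :=
  (1 / 4 : ℝ) * (B i k j l - B i l j k - B j k i l + B j l i k)

/-- `1 / (n - 2)` times the trace of the curvature-type part, in arguments one and three. -/
def riemannPartTrace (g : Matrix (Fin n) (Fin n) ℝ)
    (B : Fin n → Fin n → Fin n → Fin n → ℝ) (i j : Fin n) : ℝ :=
  1 / ((n : ℝ) - 2) * tr2 g (fun a b => riemannPart B a i b j)

/-- Projection onto totally trace-free algebraic curvature (Weyl) tensors. -/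
def projWeyl (g : Matrix (Fin n) (Fin n) ℝ)
    (B : Fin n → Fin n → Fin n → Fin n → ℝ) (i j k l : Fin n) : ℝ :=
  riemannPart B i j k l -
    kulkarniNomizu
      (fun p q => riemannPartTrace g B p q -
        tr2 g (riemannPartTrace g B) / (2 * ((n : ℝ) - 1)) * g p q) g i j k l

end Algebra

/-! ### Tensor calculus in coordinates on open subsets of `ℝⁿ` -/

section Local

variable {n : ℕ}

/-- Partial derivative `∂_i`. -/
def pd {V : Type*} [NormedAddCommGroup V] [NormedSpace ℝ V] (i : Fin n)
    (F : EuclideanSpace ℝ (Fin n) → V) (x : EuclideanSpace ℝ (Fin n)) : V :=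
  fderiv ℝ F x (EuclideanSpace.single i (1 : ℝ))

variable (g : EuclideanSpace ℝ (Fin n) → Matrix (Fin n) (Fin n) ℝ)

/-- Christoffel symbols `Γ^k_{ij}` of the Levi-Civita connection of `g`. -/
def christoffel (k i j : Fin n) (x : EuclideanSpace ℝ (Fin n)) : ℝ :=
  (1 / 2 : ℝ) * ∑ l, (g x)⁻¹ k l *
    (pd i (fun y => g y j l) x + pd j (fun y => g y i l) x - pd l (fun y => g y i j) x)

/-- `(∇_{∂_i} v)(∂_j)` for a 1-form `v`. -/
def cov1 (v : EuclideanSpace ℝ (Fin n) → Fin n → ℝ) (i j : Fin n)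
    (x : EuclideanSpace ℝ (Fin n)) : ℝ :=
  pd i (fun y => v y j) x - ∑ a, christoffel g a i j x * v x a

/-- `(∇_{∂_i} B)(∂_j, ∂_k)` for a `(0,2)`-tensor field `B`. -/
def cov2 (B : EuclideanSpace ℝ (Fin n) → Fin n → Fin n → ℝ) (i j k : Fin n)
    (x : EuclideanSpace ℝ (Fin n)) : ℝ :=
  pd i (fun y => B y j k) x -
    ∑ a, (christoffel g a i j x * B x a k + christoffel g a i k x * B x j a)

/-- `(∇_{∂_i} T)(∂_j, ∂_k, ∂_l)` for a `(0,3)`-tensor field `T`. -/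
def cov3 (T : EuclideanSpace ℝ (Fin n) → Fin n → Fin n → Fin n → ℝ) (i j k l : Fin n)
    (x : EuclideanSpace ℝ (Fin n)) : ℝ :=
  pd i (fun y => T y j k l) x -
    ∑ a, (christoffel g a i j x * T x a k l + christoffel g a i k x * T x j a l +
      christoffel g a i l x * T x j k a)

/-- Curvature: `R(∂_i, ∂_j) ∂_k = ∑ l, curvature g l i j k • ∂_l`, with
`R(X, Y) = [∇_X, ∇_Y] - ∇_{[X, Y]}`. -/
def curvature (l i j k : Fin n) (x : EuclideanSpace ℝ (Fin n)) : ℝ :=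
  pd i (christoffel g l j k) x - pd j (christoffel g l i k) x +
    ∑ m, (christoffel g l i m x * christoffel g m j k x -
      christoffel g l j m x * christoffel g m i k x)

/-- Ricci tensor `Ric(Y, Z) = tr (X ↦ R(X, Y) Z)`. -/
def ricci (j k : Fin n) (x : EuclideanSpace ℝ (Fin n)) : ℝ :=
  ∑ i, curvature g i i j k x

/-- Schouten tensor (for `n ≥ 3`). -/
def schouten (x : EuclideanSpace ℝ (Fin n)) (i j : Fin n) : ℝ :=
  1 / ((n : ℝ) - 2) * (ricci g i j x -
    tr2 (g x) (fun a b => ricci g a b x) / (2 * ((n : ℝ) - 1)) * g x i j)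

/-- Weyl tensor: `g(R(∂_i, ∂_j) ∂_l, ∂_k)` minus the Kulkarni–Nomizu product of the
Schouten tensor and the metric. -/
def weyl (i j k l : Fin n) (x : EuclideanSpace ℝ (Fin n)) : ℝ :=
  (∑ a, curvature g a i j l x * g x a k) - kulkarniNomizu (schouten g x) (g x) i j k l

/-- Cotton tensor `(∇_{∂_i} P)(∂_j, ∂_k) - (∇_{∂_j} P)(∂_i, ∂_k)`. -/
def cotton (i j k : Fin n) (x : EuclideanSpace ℝ (Fin n)) : ℝ :=
  cov2 g (schouten g) i j k x - cov2 g (schouten g) j i k x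

end Local

/-! ### Hypersurface data in coordinates

`F` and `X` are the coordinate expressions of the hypersurface and of the transversal field. -/

section LocalHypersurface

variable {n : ℕ} (F X : EuclideanSpace ℝ (Fin n) → (Fin (n + 1) → ℝ))

/-- The moving frame `(∂_1 F, …, ∂_n F, X)` of `ℝ^{n+1}`. -/
def frame (x : EuclideanSpace ℝ (Fin n)) : Fin (n + 1) → (Fin (n + 1) → ℝ) :=
  Fin.snoc (α := fun _ => Fin (n + 1) → ℝ) (fun i : Fin n => pd i F x) (X x)

/-- The coefficients `c` in `v = ∑ a, c a • frame a`. -/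
def frameCoeff (x : EuclideanSpace ℝ (Fin n)) (v : Fin (n + 1) → ℝ) : Fin (n + 1) → ℝ :=
  Matrix.vecMul v (Matrix.of (frame F X x))⁻¹

/-- Christoffel symbols of the induced connection `∇`: the tangential part in
`∂_i ∂_j F = ∑ k, Γ^k_{ij} ∂_k F + G_{ij} X`. -/
def inducedChristoffel (k i j : Fin n) (x : EuclideanSpace ℝ (Fin n)) : ℝ :=
  frameCoeff F X x (pd i (pd j F) x) k.castSucc

/-- The affine fundamental form: the transversal part `G_{ij}` in
`∂_i ∂_j F = ∑ k, Γ^k_{ij} ∂_k F + G_{ij} X`. -/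
def fundForm (x : EuclideanSpace ℝ (Fin n)) : Matrix (Fin n) (Fin n) ℝ :=
  Matrix.of fun i j => frameCoeff F X x (pd i (pd j F) x) (Fin.last n)

/-- The cubic `C(∂_i, ∂_j, ∂_k) = G(∇_{∂_i} ∂_j - ∇^G_{∂_i} ∂_j, ∂_k)`. -/
def localCubic (x : EuclideanSpace ℝ (Fin n)) (i j k : Fin n) : ℝ :=
  ∑ l, (inducedChristoffel F X l i j x - christoffel (fundForm F X) l i j x) *
    fundForm F X x l k

end LocalHypersurface

/-! ### Tensor fields on a manifold -/

section Manifold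

variable {n : ℕ} {M : Type*} [TopologicalSpace M] [ChartedSpace (EuclideanSpace ℝ (Fin n)) M]

variable (n M) in
/-- `(0,1)`-tensor fields (not necessarily smooth). -/
abbrev Tensor1 := ∀ p : M, TangentSpace (𝓡 n) p →ₗ[ℝ] ℝ

variable (n M) in
/-- `(0,2)`-tensor fields (not necessarily smooth). -/
abbrev Tensor2 := ∀ p : M, TangentSpace (𝓡 n) p →ₗ[ℝ] TangentSpace (𝓡 n) p →ₗ[ℝ] ℝ

variable (n M) in
/-- `(0,3)`-tensor fields (not necessarily smooth). -/
abbrev Tensor3 := ∀ p : M, TangentSpace (𝓡 n) p →ₗ[ℝ] TangentSpace (𝓡 n) p →ₗ[ℝ]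
  TangentSpace (𝓡 n) p →ₗ[ℝ] ℝ

/-- The coordinate vector field `∂_i` of the chart `φ`, at the point with coordinates `x`. -/
def coordVec (φ : OpenPartialHomeomorph M (EuclideanSpace ℝ (Fin n)))
    (x : EuclideanSpace ℝ (Fin n)) (i : Fin n) : TangentSpace (𝓡 n) (φ.symm x) :=
  mfderiv (𝓡 n) (𝓡 n) φ.symm x (EuclideanSpace.single i (1 : ℝ))

/-- Components of a `(0,1)`-tensor field in a chart. -/
def comp1 (v : Tensor1 n M) (φ : OpenPartialHomeomorph M (EuclideanSpace ℝ (Fin n)))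
    (x : EuclideanSpace ℝ (Fin n)) (i : Fin n) : ℝ :=
  v (φ.symm x) (coordVec φ x i)

/-- Components of a `(0,2)`-tensor field in a chart. -/
def comp2 (B : Tensor2 n M) (φ : OpenPartialHomeomorph M (EuclideanSpace ℝ (Fin n)))
    (x : EuclideanSpace ℝ (Fin n)) : Matrix (Fin n) (Fin n) ℝ :=
  Matrix.of fun i j => B (φ.symm x) (coordVec φ x i) (coordVec φ x j)

/-- Components of a `(0,3)`-tensor field in a chart. -/
def comp3 (T : Tensor3 n M) (φ : OpenPartialHomeomorph M (EuclideanSpace ℝ (Fin n)))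
    (x : EuclideanSpace ℝ (Fin n)) (i j k : Fin n) : ℝ :=
  T (φ.symm x) (coordVec φ x i) (coordVec φ x j) (coordVec φ x k)

/-- Pseudo-Riemannian metrics (of arbitrary signature). -/
structure IsPseudoMetric (g : Tensor2 n M) : Prop where
  symm : ∀ p X Y, g p X Y = g p Y X
  nondegenerate : ∀ p X, (∀ Y, g p X Y = 0) → X = 0
  smooth : ∀ φ ∈ atlas (EuclideanSpace ℝ (Fin n)) M, ∀ i j,
    ContDiffOn ℝ ∞ (fun x => comp2 g φ x i j) φ.target

/-- `R(X, Y) Z = κ (g(Y, Z) X - g(X, Z) Y)`. -/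
def HasConstantCurvature (g : Tensor2 n M) (κ : ℝ) : Prop :=
  ∀ φ ∈ atlas (EuclideanSpace ℝ (Fin n)) M, ∀ x ∈ φ.target, ∀ l i j k,
    curvature (comp2 g φ) l i j k x =
      κ * (comp2 g φ x j k * (if l = i then 1 else 0) -
        comp2 g φ x i k * (if l = j then 1 else 0))

/-- The Weyl tensor of `g` vanishes. -/
def IsWeylFlat (g : Tensor2 n M) : Prop :=
  ∀ φ ∈ atlas (EuclideanSpace ℝ (Fin n)) M, ∀ x ∈ φ.target, ∀ i j k l,
    weyl (comp2 g φ) i j k l x = 0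

/-- Conformal flatness in dimension `n ≥ 3`: the Weyl tensor vanishes and, in dimension three
(where the Weyl tensor is identically zero), the Cotton tensor vanishes. -/
def IsConformallyFlat (g : Tensor2 n M) : Prop :=
  IsWeylFlat g ∧ (n = 3 → ∀ φ ∈ atlas (EuclideanSpace ℝ (Fin n)) M, ∀ x ∈ φ.target, ∀ i j k,
    cotton (comp2 g φ) i j k x = 0)

/-! ### Abundant manifolds -/

/-- Components of `dt` in a chart. -/
def dComp (t : M → ℝ) (φ : OpenPartialHomeomorph M (EuclideanSpace ℝ (Fin n)))
    (x : EuclideanSpace ℝ (Fin n)) (i : Fin n) : ℝ :=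
  pd i (t ∘ φ.symm) x

/-- The tensor `S₁`, from the components of `g`, `S` and `dt` at a point:
`S₁(X,Y,Z,W) = g(S_X S_Y Z, W) + 3 S(X,Y,W) dt(Z) + S(X,Y,Z) dt(W)
  + (4/(n-2) tr(S_Y S_Z) - 3 S(Y,Z,grad t)) g(X,W)`. -/
def sOne (g : Matrix (Fin n) (Fin n) ℝ) (S : Fin n → Fin n → Fin n → ℝ) (dt : Fin n → ℝ)
    (i j k l : Fin n) : ℝ :=
  compTwo g S i j k l + 3 * S i j l * dt k + S i j k * dt l +
    (4 / ((n : ℝ) - 2) * traceSq g S j k - 3 * contract g S dt j k) * g i l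

/-- Abundant manifolds `(M, g, S, t)` of dimension `n ≥ 3`. -/
structure IsAbundantManifold (g : Tensor2 n M) (S : Tensor3 n M) (t : M → ℝ) : Prop where
  three_le : 3 ≤ n
  metric : IsPseudoMetric g
  conformallyFlat : IsConformallyFlat g
  smooth_t : ContMDiff (𝓡 n) 𝓘(ℝ, ℝ) ∞ t
  smooth_S : ∀ φ ∈ atlas (EuclideanSpace ℝ (Fin n)) M, ∀ i j k,
    ContDiffOn ℝ ∞ (fun x => comp3 S φ x i j k) φ.target
  symm_S : ∀ p X Y Z, S p X Y Z = S p Y X Z ∧ S p X Y Z = S p X Z Y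
  tracefree_S : ∀ φ ∈ atlas (EuclideanSpace ℝ (Fin n)) M, ∀ x ∈ φ.target, ∀ k,
    tr2 (comp2 g φ x) (fun i j => comp3 S φ x i j k) = 0
  /-- `∇² t = 3 P + (dt² - |grad t|² g / 2) / 3
    + (tr(S_X S_Y) + (n-6) |S|² g / (2 (n-1) (n+2))) / (3 (n-2))` -/
  hessian_t : ∀ φ ∈ atlas (EuclideanSpace ℝ (Fin n)) M, ∀ x ∈ φ.target, ∀ i j,
    cov1 (comp2 g φ) (dComp t φ) i j x =
      3 * schouten (comp2 g φ) x i j +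
      1 / 3 * (dComp t φ x i * dComp t φ x j -
        1 / 2 * normSq1 (comp2 g φ x) (dComp t φ x) * comp2 g φ x i j) +
      1 / (3 * ((n : ℝ) - 2)) * (traceSq (comp2 g φ x) (comp3 S φ x) i j +
        ((n : ℝ) - 6) * normSq3 (comp2 g φ x) (comp3 S φ x) * comp2 g φ x i j /
          (2 * ((n : ℝ) - 1) * ((n : ℝ) + 2)))
  /-- `∇S = Π S₁ / 3`, where the last argument is the direction of differentiation. -/
  deriv_S : ∀ φ ∈ atlas (EuclideanSpace ℝ (Fin n)) M, ∀ x ∈ φ.target, ∀ i j k l,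
    cov3 (comp2 g φ) (comp3 S φ) l i j k x =
      1 / 3 * projSymZeroThree (comp2 g φ x)
        (sOne (comp2 g φ x) (comp3 S φ x) (dComp t φ x)) i j k l
  /-- The Weyl part of `(X,Y,Z,W) ↦ g(S_X Y, S_Z W)` vanishes. -/
  weyl_S : ∀ φ ∈ atlas (EuclideanSpace ℝ (Fin n)) M, ∀ x ∈ φ.target, ∀ i j k l,
    projWeyl (comp2 g φ x) (pairTwo (comp2 g φ x) (comp3 S φ x)) i j k l = 0

/-- The components in a chart of the tensor
`τ = 2/(3(n-2)) [tr(S_X S_Y)]₀ - 2/3 [S(X,Y,grad t) + dt(X) dt(Y)]₀ + 2 [P]₀`,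
where `[·]₀` denotes the trace-free part. -/
def tau (g : Tensor2 n M) (S : Tensor3 n M) (t : M → ℝ)
    (φ : OpenPartialHomeomorph M (EuclideanSpace ℝ (Fin n)))
    (x : EuclideanSpace ℝ (Fin n)) (i j : Fin n) : ℝ :=
  2 / (3 * ((n : ℝ) - 2)) * tracefree2 (comp2 g φ x) (traceSq (comp2 g φ x) (comp3 S φ x)) i j -
  2 / 3 * tracefree2 (comp2 g φ x)
    (fun a b => contract (comp2 g φ x) (comp3 S φ x) (dComp t φ x) a b +
      dComp t φ x a * dComp t φ x b) i j +
  2 * tracefree2 (comp2 g φ x) (schouten (comp2 g φ) x) i j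

/-- `τ = 0`. -/
def IsProper (g : Tensor2 n M) (S : Tensor3 n M) (t : M → ℝ) : Prop :=
  ∀ φ ∈ atlas (EuclideanSpace ℝ (Fin n)) M, ∀ x ∈ φ.target, ∀ i j, tau g S t φ x i j = 0

/-! ### Affine hypersurface normalisations -/

/-- `(f, ξ)` is an affine hypersurface normalisation: `f` is an immersion and `ξ` is
transversal to it. -/
structure IsAffineNormalisation (f ξ : M → (Fin (n + 1) → ℝ)) : Prop where
  smooth_f : ContMDiff (𝓡 n) 𝓘(ℝ, Fin (n + 1) → ℝ) ∞ f
  smooth_ξ : ContMDiff (𝓡 n) 𝓘(ℝ, Fin (n + 1) → ℝ) ∞ ξ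
  immersion : ∀ p : M, Function.Injective (mfderiv (𝓡 n) 𝓘(ℝ, Fin (n + 1) → ℝ) f p)
  transversal : ∀ (p : M) (X : TangentSpace (𝓡 n) p),
    (mfderiv (𝓡 n) 𝓘(ℝ, Fin (n + 1) → ℝ) f p X : Fin (n + 1) → ℝ) ≠ ξ p

/-- The `i`-th coordinate differential at `p` of the preferred chart at `p`. -/
def coordForm (p : M) (i : Fin n) : TangentSpace (𝓡 n) p →ₗ[ℝ] ℝ :=
  (EuclideanSpace.proj i : EuclideanSpace ℝ (Fin n) →L[ℝ] ℝ).toLinearMap ∘ₗ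
    (mfderiv (𝓡 n) (𝓡 n) (chartAt (EuclideanSpace ℝ (Fin n)) p) p).toLinearMap

/-- The affine fundamental form `G` of `(f, ξ)`, as a tensor field on `M`. -/
def affineMetric (f ξ : M → (Fin (n + 1) → ℝ)) : Tensor2 n M := fun p =>
  ∑ i, ∑ j,
    fundForm (f ∘ (chartAt (EuclideanSpace ℝ (Fin n)) p).symm)
      (ξ ∘ (chartAt (EuclideanSpace ℝ (Fin n)) p).symm)
      (chartAt (EuclideanSpace ℝ (Fin n)) p p) i j •
      (coordForm p i).smulRight (coordForm p j)

/-- The cubic `C` of `(f, ξ)`, as a tensor field on `M`. -/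
def affineCubic (f ξ : M → (Fin (n + 1) → ℝ)) : Tensor3 n M := fun p =>
  ∑ i, ∑ j, ∑ k,
    localCubic (f ∘ (chartAt (EuclideanSpace ℝ (Fin n)) p).symm)
      (ξ ∘ (chartAt (EuclideanSpace ℝ (Fin n)) p).symm)
      (chartAt (EuclideanSpace ℝ (Fin n)) p p) i j k •
      (coordForm p i).smulRight ((coordForm p j).smulRight (coordForm p k))

/-- The `j`-th standard basis vector of `T_p M` (which is a copy of the model space `ℝⁿ`). -/
def tangentBasis (p : M) (j : Fin n) : TangentSpace (𝓡 n) p :=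
  (EuclideanSpace.single j (1 : ℝ) : EuclideanSpace ℝ (Fin n))

/-- The Gram matrix of `g` in the standard basis of `T_p M`. -/
def gram (g : Tensor2 n M) (p : M) : Matrix (Fin n) (Fin n) ℝ :=
  Matrix.of fun j k => g p (tangentBasis p j) (tangentBasis p k)

/-- The 1-form `u` with `(n + 2) u(X) = tr (Y ↦ Ĉ(X, Y))`. -/
def traceForm (g : Tensor2 n M) (C : Tensor3 n M) : Tensor1 n M := fun p =>
  (1 / ((n : ℝ) + 2)) • ∑ j, ∑ k,
    (gram g p)⁻¹ j k • ((C p).flip (tangentBasis p j)).flip (tangentBasis p k)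

/-- `U(X,Y,Z) = C(X,Y,Z) - u(X) g(Y,Z) - u(Y) g(X,Z) - u(Z) g(X,Y)`. -/
def tracefreePart (g : Tensor2 n M) (C : Tensor3 n M) : Tensor3 n M := fun p =>
  let u : TangentSpace (𝓡 n) p →ₗ[ℝ] ℝ := traceForm g C p
  let T : TangentSpace (𝓡 n) p →ₗ[ℝ] TangentSpace (𝓡 n) p →ₗ[ℝ] TangentSpace (𝓡 n) p →ₗ[ℝ] ℝ :=
    u.smulRight (g p)
  C p + (-1 : ℝ) • (T + T.flip +
    (g p).compr₂ (LinearMap.toSpanSingleton ℝ (TangentSpace (𝓡 n) p →ₗ[ℝ] ℝ) u))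

/-- The defining formula of `tracefreePart`. -/
theorem tracefreePart_apply (g : Tensor2 n M) (C : Tensor3 n M) (p : M)
    (X Y Z : TangentSpace (𝓡 n) p) :
    tracefreePart g C p X Y Z = C p X Y Z - traceForm g C p X * g p Y Z -
      traceForm g C p Y * g p X Z - traceForm g C p Z * g p X Y := by
  simp [tracefreePart]
  ring

theorem traceForm_apply (g : Tensor2 n M) (C : Tensor3 n M) (p : M)
    (X : TangentSpace (𝓡 n) p) :
    traceForm g C p X = 1 / ((n : ℝ) + 2) *
      ∑ j, ∑ k, (gram g p)⁻¹ j k * C p X (tangentBasis p j) (tangentBasis p k) := by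
  simp [traceForm]

theorem affineMetric_apply (f ξ : M → (Fin (n + 1) → ℝ)) (p : M)
    (X Y : TangentSpace (𝓡 n) p) :
    affineMetric f ξ p X Y = ∑ i, ∑ j,
      fundForm (f ∘ (chartAt (EuclideanSpace ℝ (Fin n)) p).symm)
        (ξ ∘ (chartAt (EuclideanSpace ℝ (Fin n)) p).symm)
        (chartAt (EuclideanSpace ℝ (Fin n)) p p) i j * (coordForm p i X * coordForm p j Y) := by
  simp [affineMetric]

theorem affineCubic_apply (f ξ : M → (Fin (n + 1) → ℝ)) (p : M)
    (X Y Z : TangentSpace (𝓡 n) p) :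
    affineCubic f ξ p X Y Z = ∑ i, ∑ j, ∑ k,
      localCubic (f ∘ (chartAt (EuclideanSpace ℝ (Fin n)) p).symm)
        (ξ ∘ (chartAt (EuclideanSpace ℝ (Fin n)) p).symm)
        (chartAt (EuclideanSpace ℝ (Fin n)) p p) i j k *
        (coordForm p i X * (coordForm p j Y * coordForm p k Z)) := by
  simp [affineCubic]

/-- The 1-form `u` of `(f, ξ)`. -/
def affineU1 (f ξ : M → (Fin (n + 1) → ℝ)) : Tensor1 n M :=
  traceForm (affineMetric f ξ) (affineCubic f ξ)

/-- The trace-free part `U` of the cubic of `(f, ξ)`. -/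
def affineU3 (f ξ : M → (Fin (n + 1) → ℝ)) : Tensor3 n M :=
  tracefreePart (affineMetric f ξ) (affineCubic f ξ)

/-- `(f, ξ)` is relative: the associated 1-form vanishes, that is, the derivatives of `ξ` are
tangent to the hypersurface. -/
def IsRelative (f ξ : M → (Fin (n + 1) → ℝ)) : Prop :=
  ∀ (p : M) (X : TangentSpace (𝓡 n) p), ∃ Y : TangentSpace (𝓡 n) p,
    (mfderiv (𝓡 n) 𝓘(ℝ, Fin (n + 1) → ℝ) ξ p X : Fin (n + 1) → ℝ) =
      mfderiv (𝓡 n) 𝓘(ℝ, Fin (n + 1) → ℝ) f p Y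

/-- Improper relative spheres: relative normalisations with constant transversal field. -/
structure IsImproperRelativeSphere (f ξ : M → (Fin (n + 1) → ℝ)) : Prop where
  normalisation : IsAffineNormalisation f ξ
  relative : IsRelative f ξ
  constant : ∃ c : Fin (n + 1) → ℝ, c ≠ 0 ∧ ∀ p, ξ p = c

/-- Abundant hypersurface normalisations of dimension `n ≥ 3`. -/
structure IsAbundantNormalisation (f ξ : M → (Fin (n + 1) → ℝ)) : Prop where
  three_le : 3 ≤ n
  normalisation : IsAffineNormalisation f ξ
  relative : IsRelative f ξ
  nondegenerate : ∀ p X, (∀ Y, affineMetric f ξ p X Y = 0) → X = 0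
  weylFlat : IsWeylFlat (affineMetric f ξ)
  /-- `Π (∇U) = Π (𝔘 + 4 U ⊗ u)` with `𝔘(X,Y,Z,W) = G(U_X U_Y W, Z)`, where `Π` is the
  projection onto totally symmetric trace-free tensors. -/
  deriv_U : ∀ φ ∈ atlas (EuclideanSpace ℝ (Fin n)) M, ∀ x ∈ φ.target, ∀ i j k l,
    projSymZeroFour (comp2 (affineMetric f ξ) φ x)
      (fun a b c d => cov3 (comp2 (affineMetric f ξ) φ) (comp3 (affineU3 f ξ) φ) a b c d x)
      i j k l =
    projSymZeroFour (comp2 (affineMetric f ξ) φ x)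
      (fun a b c d =>
        compTwo (comp2 (affineMetric f ξ) φ x) (comp3 (affineU3 f ξ) φ x) a b d c +
        4 * (comp3 (affineU3 f ξ) φ x a b c * comp1 (affineU1 f ξ) φ x d))
      i j k l
  /-- `∇u = P + u ⊗ u - |u|² G / 2
    + (tr(U_X U_Y) + (n-6) |U|² G / (2 (n+2) (n-1))) / (n-2)` -/
  deriv_u : ∀ φ ∈ atlas (EuclideanSpace ℝ (Fin n)) M, ∀ x ∈ φ.target, ∀ i j,
    cov1 (comp2 (affineMetric f ξ) φ) (comp1 (affineU1 f ξ) φ) i j x =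
      schouten (comp2 (affineMetric f ξ) φ) x i j +
      comp1 (affineU1 f ξ) φ x i * comp1 (affineU1 f ξ) φ x j -
      normSq1 (comp2 (affineMetric f ξ) φ x) (comp1 (affineU1 f ξ) φ x) / 2 *
        comp2 (affineMetric f ξ) φ x i j +
      1 / ((n : ℝ) - 2) *
        (traceSq (comp2 (affineMetric f ξ) φ x) (comp3 (affineU3 f ξ) φ x) i j +
          ((n : ℝ) - 6) / (2 * ((n : ℝ) + 2) * ((n : ℝ) - 1)) *
            normSq3 (comp2 (affineMetric f ξ) φ x) (comp3 (affineU3 f ξ) φ x) *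
            comp2 (affineMetric f ξ) φ x i j)

/-- The data `(g, S, t)` on `M` correspond to the hypersurface normalisation `(f, ξ)`:
`g = G`, `S = 3U` and `dt = 3u`. -/
structure CorrespondsTo (f ξ : M → (Fin (n + 1) → ℝ)) (g : Tensor2 n M) (S : Tensor3 n M)
    (t : M → ℝ) : Prop where
  metric : g = affineMetric f ξ
  cubic : ∀ p, S p = (3 : ℝ) • affineU3 f ξ p
  smooth_t : ContMDiff (𝓡 n) 𝓘(ℝ, ℝ) ∞ t
  potential : ∀ (p : M) (X : TangentSpace (𝓡 n) p),
    (mfderiv (𝓡 n) 𝓘(ℝ, ℝ) t p X : ℝ) = 3 * affineU1 f ξ p X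

end Manifold

end AbundantGeometry

end

open AbundantGeometry

open scoped Manifold ContDiff

noncomputable section

namespace AbundantGeometry

/-! ### Explicit total symmetrisation of four arguments -/

section SymFour
variable {n : ℕ}

/-! The transversal field is a constant vector, so third derivatives of the immersion contain no
Weingarten term. Commuting them gives two things: the induced connection ∇ is flat, and ∇G is
totally symmetric (`flatness_codazzi`). Consequently C = -½∇G is totally symmetric. Writing ∇ = ∇^G
+ Ĉ, flatness reads R^G + d^∇Ĉ + [Ĉ,Ĉ] = 0. Lower the last index: for constant curvature R^G is skew
in the last pair, the quadratic term is skew as well, while ∇^G C is symmetric there. The equation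
therefore splits (`gauss_codazzi_of_constantCurvature`) into a purely algebraic Gauss equation,
quadratic in C, and the total symmetry of ∇^G C.

Put C = U + u⊙G and W = U(·,·,u) + u⊗u. In the Gauss equation all terms other than ⟨U,U⟩ combine
into a Kulkarni–Nomizu product of W and G with G (`gauss_tracefree`), which is condition (iii).
Contracting it gives tr(U_X U_Y) = (n-2)W + (multiple of G) (`traceSq_eq`). With S = 3U and dt = 3u,
the trace-free parts of 𝒮/(n-2) and S(·,·,grad t) + dt⊗dt are then both 9W₀. They cancel in τ, and
the Schouten tensor κG/2 has no trace-free part.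

Condition (i) is the prescribed ∇u multiplied by 3. For (ii), the totally symmetric tensor ∇C is
determined by its Sym⁴₀ part and its trace. The former is prescribed by abundance, because ∇C and ∇U
differ only by multiples of G; the latter is (n+2)∇u, which is known modulo G to be u⊗u + W. Solving
for the trace part and comparing it with ΠS₁ is finite linear algebra
(`derivative_eq_projSymZeroThree`).

Finally, (n+2)u is the difference of the traces of two connection forms, hence the logarithmic
derivative of the ratio of the ∇-parallel volume det(∂F, ξ) to the volume |det G|^½. This ratio is
independent of the chart, so its logarithm is a global potential (`pd_localPotential`,
`localPotential_eq`). The rest of the work is the tensoriality of G and C under coordinate changes.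
-/

theorem sum_perm_fin_succ {m : ℕ} (f : Equiv.Perm (Fin (m + 1)) → ℝ) :
    ∑ σ, f σ = ∑ p, ∑ τ : Equiv.Perm (Fin m), f (Equiv.Perm.decomposeFin.symm (p, τ)) := by
  rw [← Equiv.sum_comp Equiv.Perm.decomposeFin.symm, Fintype.sum_prod_type]

/-- A permutation is split into the image of 0 and a permutation of the rest. The resulting 24
explicit terms allow `ring` to settle all later identities about symmetrisations. -/
theorem symFour_eq (B : Fin n → Fin n → Fin n → Fin n → ℝ) (i j k l : Fin n) :
    symFour B i j k l = (1 / 24 : ℝ) *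
      (B i j k l + B i j l k + B i k j l + B i k l j + B i l j k + B i l k j +
       B j i k l + B j i l k + B j k i l + B j k l i + B j l i k + B j l k i +
       B k i j l + B k i l j + B k j i l + B k j l i + B k l i j + B k l j i +
       B l i j k + B l i k j + B l j i k + B l j k i + B l k i j + B l k j i) := by
  have e2 : (2 : Fin 4) = Fin.succ (Fin.succ 0) := rfl
  have e3 : (3 : Fin 4) = Fin.succ (Fin.succ (Fin.succ 0)) := rfl
  have e1 : (1 : Fin 4) = Fin.succ 0 := rfl
  unfold symFour
  congr 1
  simp only [sum_perm_fin_succ, Fin.sum_univ_succ, Finset.univ_unique, Finset.sum_singleton]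
  simp only [e1, e2, e3, Equiv.Perm.decomposeFin_symm_apply_zero,
    Equiv.Perm.decomposeFin_symm_apply_succ]
  simp [Equiv.swap_apply_def, Fin.ext_iff]
  ring

end SymFour

/-! ### Pointwise tensor algebra through the scalar product of covectors -/

section DualInner
variable {n : ℕ}

/-- The scalar product of covectors induced by `g`. -/
def dualInner (g : Matrix (Fin n) (Fin n) ℝ) (v w : Fin n → ℝ) : ℝ :=
  ∑ a, ∑ b, g⁻¹ a b * v a * w b

variable {g : Matrix (Fin n) (Fin n) ℝ}

theorem dualInner_add_left (v v' w : Fin n → ℝ) :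
    dualInner g (v + v') w = dualInner g v w + dualInner g v' w := by
  simp only [dualInner, Pi.add_apply, ← Finset.sum_add_distrib]
  exact Finset.sum_congr rfl fun a _ => Finset.sum_congr rfl fun b _ => by ring

theorem dualInner_add_right (v w w' : Fin n → ℝ) :
    dualInner g v (w + w') = dualInner g v w + dualInner g v w' := by
  simp only [dualInner, Pi.add_apply, ← Finset.sum_add_distrib]
  exact Finset.sum_congr rfl fun a _ => Finset.sum_congr rfl fun b _ => by ring

theorem dualInner_smul_left (c : ℝ) (v w : Fin n → ℝ) :
    dualInner g (c • v) w = c * dualInner g v w := by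
  simp only [dualInner, Pi.smul_apply, smul_eq_mul, Finset.mul_sum]
  exact Finset.sum_congr rfl fun a _ => Finset.sum_congr rfl fun b _ => by ring

theorem dualInner_smul_right (c : ℝ) (v w : Fin n → ℝ) :
    dualInner g v (c • w) = c * dualInner g v w := by
  simp only [dualInner, Pi.smul_apply, smul_eq_mul, Finset.mul_sum]
  exact Finset.sum_congr rfl fun a _ => Finset.sum_congr rfl fun b _ => by ring

theorem inv_symm_of_symm (hs : ∀ i j, g i j = g j i) (i j : Fin n) : g⁻¹ i j = g⁻¹ j i := by
  have h : g.transpose = g := by ext i j; exact hs j i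
  have h2 : (g⁻¹).transpose = g⁻¹ := by rw [Matrix.transpose_nonsing_inv, h]
  exact congrFun (congrFun h2 j) i

theorem dualInner_comm (hs : ∀ i j, g i j = g j i) (v w : Fin n → ℝ) :
    dualInner g v w = dualInner g w v := by
  unfold dualInner
  rw [Finset.sum_comm]
  refine Finset.sum_congr rfl fun a _ => Finset.sum_congr rfl fun b _ => ?_
  rw [inv_symm_of_symm hs]; ring

theorem sum_inv_mul (hd : g.det ≠ 0) (i k : Fin n) :
    ∑ j, g⁻¹ i j * g j k = if i = k then 1 else 0 := by
  have h := Matrix.nonsing_inv_mul g (isUnit_iff_ne_zero.mpr hd)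
  have := congrFun (congrFun h i) k
  rwa [Matrix.mul_apply, Matrix.one_apply] at this

theorem sum_mul_inv (hd : g.det ≠ 0) (i k : Fin n) :
    ∑ j, g i j * g⁻¹ j k = if i = k then 1 else 0 := by
  have h := Matrix.mul_nonsing_inv g (isUnit_iff_ne_zero.mpr hd)
  have := congrFun (congrFun h i) k
  rwa [Matrix.mul_apply, Matrix.one_apply] at this

/-- The row `g k` is the covector dual to the k-th basis vector, so pairing with it evaluates. -/
theorem dualInner_metric_right (hs : ∀ i j, g i j = g j i) (hd : g.det ≠ 0)
    (v : Fin n → ℝ) (k : Fin n) : dualInner g v (g k) = v k := by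
  have h : ∀ a, ∑ b, g⁻¹ a b * v a * g k b = v a * if a = k then 1 else 0 := fun a => by
    rw [← sum_inv_mul hd, Finset.mul_sum]
    exact Finset.sum_congr rfl fun b _ => by rw [hs k b]; ring
  simp [dualInner, h]

theorem dualInner_metric_left (hs : ∀ i j, g i j = g j i) (hd : g.det ≠ 0)
    (v : Fin n → ℝ) (k : Fin n) : dualInner g (g k) v = v k := by
  rw [dualInner_comm hs, dualInner_metric_right hs hd]

theorem tr2_add (B D : Fin n → Fin n → ℝ) :
    tr2 g (fun i j => B i j + D i j) = tr2 g B + tr2 g D := by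
  simp only [tr2, mul_add, Finset.sum_add_distrib]

theorem tr2_sub (B D : Fin n → Fin n → ℝ) :
    tr2 g (fun i j => B i j - D i j) = tr2 g B - tr2 g D := by
  simp only [tr2, mul_sub, Finset.sum_sub_distrib]

theorem tr2_const_mul (c : ℝ) (B : Fin n → Fin n → ℝ) :
    tr2 g (fun i j => c * B i j) = c * tr2 g B := by
  simp only [tr2, Finset.mul_sum]
  exact Finset.sum_congr rfl fun a _ => Finset.sum_congr rfl fun b _ => by ring

theorem tr2_mul_const (c : ℝ) (B : Fin n → Fin n → ℝ) :
    tr2 g (fun i j => B i j * c) = tr2 g B * c := by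
  simp only [mul_comm _ c, tr2_const_mul]

theorem tr2_mul (v w : Fin n → ℝ) : tr2 g (fun i j => v i * w j) = dualInner g v w := by
  simp only [tr2, dualInner, mul_assoc]

theorem tr2_swap (hs : ∀ i j, g i j = g j i) (B : Fin n → Fin n → ℝ) :
    tr2 g (fun i j => B j i) = tr2 g B := by
  unfold tr2
  rw [Finset.sum_comm]
  exact Finset.sum_congr rfl fun a _ => Finset.sum_congr rfl fun b _ => by
    rw [inv_symm_of_symm hs]

theorem tr2_metric (hs : ∀ i j, g i j = g j i) (hd : g.det ≠ 0) :
    tr2 g (fun i j => g i j) = n := by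
  have h : ∀ a, ∑ b, g⁻¹ a b * g a b = 1 := fun a => by
    have := sum_inv_mul hd a a
    simp only [if_true] at this
    rw [← this]; exact Finset.sum_congr rfl fun b _ => by rw [hs]
  simp [tr2, h]

theorem tr2_const_mul_metric (hs : ∀ i j, g i j = g j i) (hd : g.det ≠ 0) (c : ℝ) :
    tr2 g (fun i j => c * g i j) = c * n := by
  rw [tr2_const_mul c (fun i j => g i j), tr2_metric hs hd]

theorem tr2_metric_mul_const (hs : ∀ i j, g i j = g j i) (hd : g.det ≠ 0) (c : ℝ) :
    tr2 g (fun i j => g i j * c) = n * c := by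
  rw [tr2_mul_const c (fun i j => g i j), tr2_metric hs hd]

theorem tr2_metric_mul (hs : ∀ i j, g i j = g j i) (hd : g.det ≠ 0) (k : Fin n)
    (w : Fin n → ℝ) : tr2 g (fun i j => g i k * w j) = w k := by
  rw [tr2_mul (fun i => g i k) w]
  simp only [fun i => hs i k]
  exact dualInner_metric_left hs hd w k

theorem sum_comm_four (f : Fin n → Fin n → Fin n → Fin n → ℝ) :
    ∑ i, ∑ j, ∑ a, ∑ b, f i j a b = ∑ a, ∑ b, ∑ i, ∑ j, f i j a b :=
  calc _ = ∑ i, ∑ a, ∑ j, ∑ b, f i j a b := Finset.sum_congr rfl fun _ _ => Finset.sum_comm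
    _ = ∑ a, ∑ i, ∑ j, ∑ b, f i j a b := Finset.sum_comm
    _ = ∑ a, ∑ i, ∑ b, ∑ j, f i j a b :=
      Finset.sum_congr rfl fun _ _ => Finset.sum_congr rfl fun _ _ => Finset.sum_comm
    _ = _ := Finset.sum_congr rfl fun _ _ => Finset.sum_comm

theorem tr2_dualInner_right (B : Fin n → Fin n → Fin n → ℝ) (v : Fin n → ℝ) :
    tr2 g (fun i j => dualInner g v (B i j)) =
      dualInner g v (fun a => tr2 g (fun i j => B i j a)) := by
  simp only [tr2, dualInner, Finset.mul_sum]
  rw [sum_comm_four]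
  exact Finset.sum_congr rfl fun a _ => Finset.sum_congr rfl fun b _ =>
    Finset.sum_congr rfl fun c _ => Finset.sum_congr rfl fun d _ => by ring

theorem sum_endo_mul_metric (hd : g.det ≠ 0) (hs : ∀ i j, g i j = g j i)
    (T : Fin n → Fin n → Fin n → ℝ) (i a l : Fin n) :
    ∑ b, endo g T i b a * g b l = T i a l := by
  have h : ∀ b, endo g T i b a * g b l = ∑ c, T i a c * (g l b * g⁻¹ b c) := fun b => by
    rw [endo, Finset.sum_mul]
    exact Finset.sum_congr rfl fun c _ => by rw [hs b l]; ring
  simp only [h]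
  rw [Finset.sum_comm]
  simp only [← Finset.mul_sum, sum_mul_inv hd]
  simp

theorem contract_eq_dualInner (T : Fin n → Fin n → Fin n → ℝ) (v : Fin n → ℝ)
    (i j : Fin n) : contract g T v i j = dualInner g (T i j) v := by
  simp only [contract, raise, dualInner, Finset.mul_sum]
  exact Finset.sum_congr rfl fun a _ => Finset.sum_congr rfl fun b _ => by ring

theorem normSq1_eq_dualInner (v : Fin n → ℝ) :
    normSq1 g v = dualInner g v v := by
  simp only [normSq1, raise, dualInner, Finset.sum_mul]
  exact Finset.sum_congr rfl fun a _ => Finset.sum_congr rfl fun b _ => by ring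

/-- Symmetry of T in its last two arguments makes T_X self-adjoint, so T_i can be moved to the other
side of the scalar product. -/
theorem compTwo_eq_dualInner (hd : g.det ≠ 0) (hs : ∀ i j, g i j = g j i)
    (T : Fin n → Fin n → Fin n → ℝ) (hT : ∀ i j k, T i j k = T i k j) (i j k l : Fin n) :
    compTwo g T i j k l = dualInner g (T i l) (T j k) := by
  simp only [compTwo, mul_assoc, ← Finset.mul_sum, sum_endo_mul_metric hd hs]
  simp only [endo, dualInner, Finset.sum_mul]
  exact Finset.sum_congr rfl fun a _ => Finset.sum_congr rfl fun b _ => by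
    rw [hT i a l]; ring

theorem pairTwo_eq_dualInner (hd : g.det ≠ 0) (hs : ∀ i j, g i j = g j i)
    (T : Fin n → Fin n → Fin n → ℝ) (i j k l : Fin n) :
    pairTwo g T i j k l = dualInner g (T i j) (T k l) := by
  have h : ∀ a b, g a b * endo g T i a j * endo g T k b l =
      endo g T k b l * (endo g T i a j * g a b) := fun a b => by ring
  simp only [pairTwo, h]
  rw [Finset.sum_comm]
  simp only [← Finset.mul_sum, sum_endo_mul_metric hd hs]
  simp only [endo, dualInner, Finset.sum_mul]
  exact Finset.sum_congr rfl fun a _ => Finset.sum_congr rfl fun b _ => by ring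

/-- Expresses 𝒯 as a contraction of the products occurring in the Gauss equation; this is what
allows tracing that equation. -/
theorem traceSq_eq_tr2 (hs : ∀ i j, g i j = g j i) (T : Fin n → Fin n → Fin n → ℝ)
    (hT : ∀ i j k, T i j k = T j i k) (hT' : ∀ i j k, T i j k = T i k j) (i j : Fin n) :
    traceSq g T i j = tr2 g (fun a b => dualInner g (T a i) (T b j)) := by
  have h : ∀ a b, T a i b = T i b a := fun a b => by rw [hT, hT']
  let f : Fin n → Fin n → Fin n → Fin n → ℝ := fun a b c d =>
    g⁻¹ b c * T i a c * (g⁻¹ a d * T j b d)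
  have h1 : traceSq g T i j = ∑ a, ∑ b, ∑ c, ∑ d, f a b c d := by
    simp only [traceSq, endo, Finset.sum_mul_sum, f]
  have h2 : tr2 g (fun a b => dualInner g (T a i) (T b j)) = ∑ c, ∑ b, ∑ a, ∑ d, f a b c d := by
    simp only [tr2, dualInner, Finset.mul_sum, f]
    exact Finset.sum_congr rfl fun c _ => Finset.sum_congr rfl fun b _ =>
      Finset.sum_congr rfl fun a _ => Finset.sum_congr rfl fun d _ => by
        rw [h c a, hT b j d, inv_symm_of_symm hs c b]; ring
  rw [h1, h2]
  calc _ = ∑ b, ∑ a, ∑ c, ∑ d, f a b c d := Finset.sum_comm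
    _ = ∑ b, ∑ c, ∑ a, ∑ d, f a b c d := Finset.sum_congr rfl fun _ _ => Finset.sum_comm
    _ = _ := Finset.sum_comm

end DualInner
end AbundantGeometry

namespace AbundantGeometry

/-! ### Algebraic consequences of the quadratic Gauss equation -/

section Gauss
variable {n : ℕ} {g : Matrix (Fin n) (Fin n) ℝ}

/-- The cubic with trace-free part `U` and trace form `u`. -/
def cubicOf (g : Matrix (Fin n) (Fin n) ℝ) (U : Fin n → Fin n → Fin n → ℝ) (u : Fin n → ℝ)
    (i j k : Fin n) : ℝ :=
  U i j k + u i * g j k + u j * g i k + u k * g i j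

/-- The form `(X, Y) ↦ U(X, Y, u^♯) + u(X) u(Y)`. -/
def contractAddSq (g : Matrix (Fin n) (Fin n) ℝ) (U : Fin n → Fin n → Fin n → ℝ) (u : Fin n → ℝ)
    (i j : Fin n) : ℝ :=
  dualInner g (U i j) u + u i * u j

variable {U : Fin n → Fin n → Fin n → ℝ} {u : Fin n → ℝ}

theorem dualInner_cubicOf (hs : ∀ i j, g i j = g j i) (hd : g.det ≠ 0)
    (i j k l : Fin n) :
    dualInner g (cubicOf g U u i j) (cubicOf g U u k l) = dualInner g (U i j) (U k l) +
      (u k * U i j l + u l * U i j k + g k l * dualInner g (U i j) u) +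
      (u i * U k l j + u j * U k l i + g i j * dualInner g (U k l) u) +
      (u i * u k * g j l + u i * u l * g j k + u j * u k * g i l + u j * u l * g i k +
        2 * (u i * u j * g k l) + 2 * (u k * u l * g i j) +
        g i j * g k l * dualInner g u u) := by
  have h : ∀ i j, cubicOf g U u i j = U i j + u i • g j + u j • g i + g i j • u := fun i j => by
    funext k
    simp only [cubicOf, Pi.add_apply, Pi.smul_apply, smul_eq_mul]
    ring
  rw [h, h]
  simp only [dualInner_add_left, dualInner_add_right, dualInner_smul_left, dualInner_smul_right,
    dualInner_metric_left hs hd, dualInner_metric_right hs hd, Pi.add_apply, Pi.smul_apply,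
    smul_eq_mul]
  rw [dualInner_comm hs u (U k l)]
  ring

/-- Under the antisymmetrisation in i, j all terms u·U cancel by the symmetry of U. The coefficients
2 and 1 of the u⊗u terms leave exactly one copy, so u enters only through `contractAddSq` and |u|².
-/
theorem gauss_tracefree (hs : ∀ i j, g i j = g j i) (hd : g.det ≠ 0)
    (hU : ∀ i j k, U i j k = U j i k) (hU' : ∀ i j k, U i j k = U i k j) {κ : ℝ}
    (hC : ∀ i j k p, κ * (g j k * g i p - g i k * g j p) +
      (dualInner g (cubicOf g U u j k) (cubicOf g U u i p) -
        dualInner g (cubicOf g U u i k) (cubicOf g U u j p)) = 0) (i j k p : Fin n) :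
    dualInner g (U i k) (U j p) - dualInner g (U j k) (U i p) =
      g i p * contractAddSq g U u j k + g j k * contractAddSq g U u i p -
      g j p * contractAddSq g U u i k - g i k * contractAddSq g U u j p +
      (κ + dualInner g u u) * (g j k * g i p - g i k * g j p) := by
  have h := hC i j k p
  rw [dualInner_cubicOf hs hd, dualInner_cubicOf hs hd] at h
  simp only [contractAddSq]
  simp only [hs, hU, hU'] at h ⊢
  linear_combination -h

theorem contractAddSq_symm (hU : ∀ i j k, U i j k = U j i k) (i j : Fin n) :
    contractAddSq g U u i j = contractAddSq g U u j i := by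
  have h : U i j = U j i := funext fun k => hU i j k
  rw [contractAddSq, contractAddSq, h, mul_comm (u i)]

theorem dualInner_trace_eq_zero (htr : ∀ k, tr2 g (fun i j => U i j k) = 0) (v : Fin n → ℝ) :
    tr2 g (fun i j => dualInner g v (U i j)) = 0 := by
  rw [tr2_dualInner_right]
  simp [htr, dualInner]

/-- The part linear in U has no trace, leaving only that of u⊗u. -/
theorem tr2_contractAddSq (hs : ∀ i j, g i j = g j i)
    (htr : ∀ k, tr2 g (fun i j => U i j k) = 0) :
    tr2 g (contractAddSq g U u) = dualInner g u u := by
  have h : contractAddSq g U u = fun i j => dualInner g u (U i j) + u i * u j := by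
    funext i j; rw [contractAddSq, dualInner_comm hs]
  rw [h, tr2_add, dualInner_trace_eq_zero htr, tr2_mul, zero_add]

/-- This is the Ricci-type contraction of `gauss_tracefree`: the Kulkarni–Nomizu product with g
contributes n-2 copies of W, and everything else is a multiple of g. Properness and the form of ∇u
both rest on it. -/
theorem traceSq_eq (hs : ∀ i j, g i j = g j i) (hd : g.det ≠ 0)
    (hU : ∀ i j k, U i j k = U j i k) (hU' : ∀ i j k, U i j k = U i k j)
    (htr : ∀ k, tr2 g (fun i j => U i j k) = 0) {κ : ℝ}
    (hC : ∀ i j k p, κ * (g j k * g i p - g i k * g j p) +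
      (dualInner g (cubicOf g U u j k) (cubicOf g U u i p) -
        dualInner g (cubicOf g U u i k) (cubicOf g U u j p)) = 0) (i j : Fin n) :
    traceSq g U i j = ((n : ℝ) - 2) * contractAddSq g U u i j +
      (dualInner g u u + (κ + dualInner g u u) * ((n : ℝ) - 1)) * g i j := by
  set W := contractAddSq g U u with hW
  set c := κ + dualInner g u u
  have h : ∀ a b, dualInner g (U a i) (U b j) = dualInner g (U i j) (U a b) +
      g a b * W i j + W a b * g i j - W a i * g j b - g a i * W j b +
      (c * g i j) * g a b - c * (g a i * g j b) := fun a b => by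
    have h1 := gauss_tracefree hs hd hU hU' hC a j i b
    have h2 : U j b = U b j := funext (hU j b)
    have h3 : U j i = U i j := funext (hU j i)
    rw [h2, h3, contractAddSq_symm hU j i, hs j i] at h1
    linear_combination h1
  rw [traceSq_eq_tr2 hs U hU hU']
  have e1 : tr2 g (fun a b => W a i * g j b) = W j i := by
    rw [tr2_mul, dualInner_metric_right hs hd]
  have e2 : tr2 g (fun a b => W a b) = dualInner g u u := tr2_contractAddSq hs htr
  simp only [h, tr2_sub, tr2_add, tr2_mul_const, tr2_const_mul_metric hs hd,
    tr2_metric_mul_const hs hd, tr2_const_mul,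
    tr2_metric_mul hs hd, dualInner_trace_eq_zero htr, e1, e2]
  rw [hs j i, hW, contractAddSq_symm hU j i]
  ring

theorem tracefree2_eq_zero_of_eq (hs : ∀ i j, g i j = g j i) (hd : g.det ≠ 0) (hn : n ≠ 0)
    {B : Fin n → Fin n → ℝ} {c : ℝ} (h : ∀ i j, B i j = c * g i j) (i j : Fin n) :
    tracefree2 g B i j = 0 := by
  have hB : B = fun i j => c * g i j := funext fun i => funext fun j => h i j
  have hn' : (n : ℝ) ≠ 0 := Nat.cast_ne_zero.mpr hn
  rw [tracefree2, hB, tr2_const_mul_metric hs hd]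
  field_simp
  ring

theorem tracefree2_add (B D : Fin n → Fin n → ℝ) (i j : Fin n) :
    tracefree2 g (fun a b => B a b + D a b) i j = tracefree2 g B i j + tracefree2 g D i j := by
  simp only [tracefree2, tr2_add]; ring

theorem tracefree2_const_mul (c : ℝ) (B : Fin n → Fin n → ℝ) (i j : Fin n) :
    tracefree2 g (fun a b => c * B a b) i j = c * tracefree2 g B i j := by
  simp only [tracefree2, tr2_const_mul]; ring

/-- A curvature-type part which is a Kulkarni–Nomizu product with `g` has no Weyl part. -/
theorem projWeyl_eq_zero (hn : 3 ≤ n) (hs : ∀ i j, g i j = g j i) (hd : g.det ≠ 0)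
    {B : Fin n → Fin n → Fin n → Fin n → ℝ} {H : Fin n → Fin n → ℝ}
    (hB : ∀ i j k l, riemannPart B i j k l = kulkarniNomizu H (fun a b => g a b) i j k l)
    (i j k l : Fin n) : projWeyl g B i j k l = 0 := by
  have hn' : (3 : ℝ) ≤ n := by exact_mod_cast hn
  have h2 : (n : ℝ) - 2 ≠ 0 := by linarith
  have h1 : (n : ℝ) - 1 ≠ 0 := by linarith
  -- The Ricci contraction of H ∧ g is (n-2)H + (tr H)g.
  have ht : ∀ i j, riemannPartTrace g B i j = H i j + tr2 g H / ((n : ℝ) - 2) * g i j := by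
    intro i j
    have e : ∀ a b, riemannPart B a i b j = H a b * g i j + H i j * g a b - H a j * g i b
        - g a j * H i b := fun a b => by
      rw [hB, kulkarniNomizu]; ring
    have e1 : tr2 g (fun a b => H a j * g i b) = H i j := by
      rw [tr2_mul, dualInner_metric_right hs hd]
    have e2 : tr2 g (fun a b => H a b) = tr2 g H := rfl
    rw [riemannPartTrace]
    simp only [e, tr2_sub, tr2_add, tr2_mul_const, tr2_const_mul_metric hs hd,
      tr2_metric_mul hs hd, e1]
    field_simp
    ring
  -- This trace equals 2(n-1)/(n-2) times tr H, so the correction in `projWeyl` returns exactly H.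
  have htt : tr2 g (riemannPartTrace g B) = tr2 g H + tr2 g H / ((n : ℝ) - 2) * n := by
    have : riemannPartTrace g B = fun i j => H i j + tr2 g H / ((n : ℝ) - 2) * g i j :=
      funext fun i => funext fun j => ht i j
    rw [this, tr2_add, tr2_const_mul_metric hs hd]
  rw [projWeyl, hB]
  simp only [kulkarniNomizu, ht, htt]
  field_simp
  ring

theorem pairTwo_scale (s : ℝ) (i j k l : Fin n) :
    pairTwo g (fun i j k => s * U i j k) i j k l = s ^ 2 * pairTwo g U i j k l := by
  have h : ∀ i a b, endo g (fun i j k => s * U i j k) i a b = s * endo g U i a b := by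
    intro i a b
    simp only [endo, Finset.mul_sum]
    exact Finset.sum_congr rfl fun _ _ => by ring
  simp only [pairTwo, h, Finset.mul_sum]
  exact Finset.sum_congr rfl fun _ _ => Finset.sum_congr rfl fun _ _ => by ring

theorem projWeyl_pairTwo_eq_zero (hn : 3 ≤ n) (hs : ∀ i j, g i j = g j i) (hd : g.det ≠ 0)
    (hU : ∀ i j k, U i j k = U j i k) (hU' : ∀ i j k, U i j k = U i k j) {κ : ℝ}
    (hC : ∀ i j k p, κ * (g j k * g i p - g i k * g j p) +
      (dualInner g (cubicOf g U u j k) (cubicOf g U u i p) -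
        dualInner g (cubicOf g U u i k) (cubicOf g U u j p)) = 0) (s : ℝ) (i j k l : Fin n) :
    projWeyl g (pairTwo g (fun i j k => s * U i j k)) i j k l = 0 := by
  -- The curvature-type part of ⟨U,U⟩ is half the left side of `gauss_tracefree`, whence -½W. Since
  -- g ∧ g counts each term twice, the constant part receives ¼ rather than ½.
  refine projWeyl_eq_zero hn hs hd (H := fun a b => s ^ 2 * ((-1 / 2 : ℝ) *
    contractAddSq g U u a b - (κ + dualInner g u u) / 4 * g a b)) (fun i j k l => ?_) i j k l
  simp only [riemannPart, pairTwo_scale, kulkarniNomizu]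
  simp only [pairTwo_eq_dualInner hd hs]
  have h := gauss_tracefree hs hd hU hU' hC i j k l
  rw [dualInner_comm hs (U j k), dualInner_comm hs (U i k)] at h
  rw [dualInner_comm hs (U i k), dualInner_comm hs (U j k)]
  linear_combination (1 / 2 : ℝ) * s ^ 2 * h

end Gauss
end AbundantGeometry

namespace AbundantGeometry

/-! ### Recovering ∇U from its trace-free symmetric part -/

section Projections
variable {n : ℕ} {g : Matrix (Fin n) (Fin n) ℝ}

/-- The sum of the six permutations of `y ⊗ g` for symmetric `y`. -/
def sixMetric (g : Matrix (Fin n) (Fin n) ℝ) (y : Fin n → Fin n → ℝ) (i j k l : Fin n) : ℝ :=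
  y i j * g k l + y i k * g j l + y i l * g j k + y j k * g i l + y j l * g i k + y k l * g i j

theorem trSymFour_symm (B : Fin n → Fin n → Fin n → Fin n → ℝ) (i j : Fin n) :
    trSymFour g B i j = trSymFour g B j i := by
  have h : (fun a b => symFour B a b i j) = fun a b => symFour B a b j i := by
    funext a b
    rw [symFour_eq, symFour_eq]; ring
  rw [trSymFour, h, trSymFour]

/-- Only the shape of the correction matters: the value of y is never needed, since a trace
condition determines the final trace part. -/
theorem exists_projSymZeroFour_eq (hs : ∀ i j, g i j = g j i)
    (B : Fin n → Fin n → Fin n → Fin n → ℝ) :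
    ∃ y : Fin n → Fin n → ℝ, (∀ i j, y i j = y j i) ∧
      ∀ i j k l, projSymZeroFour g B i j k l = symFour B i j k l - sixMetric g y i j k l := by
  refine ⟨fun i j => 1 / ((n : ℝ) + 4) *
    (trSymFour g B i j - tr2 g (trSymFour g B) / (2 * ((n : ℝ) + 2)) * g i j),
    fun i j => by simp only [trSymFour_symm B i j, hs i j], fun i j k l => ?_⟩
  have hz := trSymFour_symm (g := g) B
  rw [projSymZeroFour, symFour_eq, symFour_eq]
  generalize trSymFour g B = z at hz ⊢
  simp only [sixMetric, hs, hz]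
  ring

/-- Each of the three products v⊗g symmetrises to one sixth of `sixMetric`, which explains the
factor ½. -/
theorem symFour_derivative {A : Fin n → Fin n → Fin n → Fin n → ℝ} {v : Fin n → Fin n → ℝ}
    (hs : ∀ i j, g i j = g j i)
    (hA : ∀ i j k l, A i j k l = A j i k l) (hA' : ∀ i j k l, A i j k l = A i k j l)
    (hA'' : ∀ i j k l, A i j k l = A i j l k) (hv : ∀ i j, v i j = v j i) (i j k l : Fin n) :
    symFour (fun i j k l => A i j k l - v i j * g k l - v i k * g j l - v i l * g j k) i j k l =
      A i j k l - 1 / 2 * sixMetric g v i j k l := by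
  rw [symFour_eq]
  simp only [sixMetric, hs, hv, hA, hA', hA'']
  ring

/-- The total symmetrisation of `𝔘 + 4 U ⊗ u`. -/
def cubicQuartic (g : Matrix (Fin n) (Fin n) ℝ) (U : Fin n → Fin n → Fin n → ℝ) (u : Fin n → ℝ)
    (i j k l : Fin n) : ℝ :=
  1 / 3 * (dualInner g (U i j) (U k l) + dualInner g (U i k) (U j l) +
    dualInner g (U i l) (U j k)) +
  (U i j k * u l + U i j l * u k + U i k l * u j + U j k l * u i)

variable {U : Fin n → Fin n → Fin n → ℝ} {u : Fin n → ℝ}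

theorem symFour_compTwo (hs : ∀ i j, g i j = g j i) (hd : g.det ≠ 0)
    (hU : ∀ i j k, U i j k = U j i k) (hU' : ∀ i j k, U i j k = U i k j) (i j k l : Fin n) :
    symFour (fun a b c d => compTwo g U a b d c + 4 * (U a b c * u d)) i j k l =
      cubicQuartic g U u i j k l := by
  have hUf : ∀ i j, U i j = U j i := fun i j => funext fun k => hU i j k
  obtain ⟨P, hP⟩ : ∃ P : Fin n → Fin n → Fin n → Fin n → ℝ,
      ∀ i j k l, dualInner g (U i j) (U k l) = P i j k l := ⟨_, fun _ _ _ _ => rfl⟩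
  have h1 : ∀ i j k l, P i j k l = P j i k l := fun i j k l => by rw [← hP, hUf, hP]
  have h2 : ∀ i j k l, P i j k l = P i j l k := fun i j k l => by rw [← hP, hUf k, hP]
  have h3 : ∀ i j k l, P i j k l = P k l i j := fun i j k l => by
    rw [← hP, dualInner_comm hs, hP]
  rw [symFour_eq]
  simp only [compTwo_eq_dualInner hd hs U hU', cubicQuartic, hP]
  simp only [h1, h2, h3, hU, hU']
  ring

/-- Terms in which both traced slots fall on the same U vanish; two of the three products and two of
the four U⊗u terms survive. -/
theorem tr2_cubicQuartic (hs : ∀ i j, g i j = g j i)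
    (hU : ∀ i j k, U i j k = U j i k) (hU' : ∀ i j k, U i j k = U i k j)
    (htr : ∀ k, tr2 g (fun i j => U i j k) = 0) (k l : Fin n) :
    tr2 g (fun a b => cubicQuartic g U u a b k l) =
      2 / 3 * traceSq g U k l + 2 * dualInner g (U k l) u := by
  have hUf : ∀ i j, U i j = U j i := fun i j => funext fun k => hU i j k
  have e1 : tr2 g (fun a b => dualInner g (U a b) (U k l)) = 0 := by
    simp only [dualInner_comm hs _ (U k l)]
    exact dualInner_trace_eq_zero htr _
  have e2 : tr2 g (fun a b => dualInner g (U a k) (U b l)) = traceSq g U k l :=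
    (traceSq_eq_tr2 hs U hU hU' k l).symm
  have e3 : tr2 g (fun a b => dualInner g (U a l) (U b k)) = traceSq g U k l := by
    rw [← e2, ← tr2_swap hs]
    simp only [dualInner_comm hs (U _ l)]
  have e4 : tr2 g (fun a b => U a k l * u b) = dualInner g (U k l) u := by
    rw [tr2_mul (fun a => U a k l) u]
    congr 1; funext a; rw [hU, hU']
  have e5 : tr2 g (fun a b => U b k l * u a) = dualInner g (U k l) u := by
    rw [← e4, ← tr2_swap hs]
  simp only [cubicQuartic, tr2_add, tr2_const_mul, tr2_mul_const, e1, e2, e3, e4, e5, htr]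
  ring

theorem tr2_sixMetric (hs : ∀ i j, g i j = g j i) (hd : g.det ≠ 0) {y : Fin n → Fin n → ℝ}
    (hy : ∀ i j, y i j = y j i) (k l : Fin n) :
    tr2 g (fun a b => sixMetric g y a b k l) =
      ((n : ℝ) + 4) * y k l + tr2 g y * g k l := by
  have e1 : tr2 g (fun a b => y a k * g b l) = y k l := by
    simp only [hs _ l]
    rw [tr2_mul (fun a => y a k) (g l), dualInner_metric_right hs hd, hy]
  have e2 : tr2 g (fun a b => y a l * g b k) = y k l := by
    simp only [hs _ k]
    rw [tr2_mul (fun a => y a l) (g k), dualInner_metric_right hs hd]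
  have e3 : tr2 g (fun a b => y b k * g a l) = y k l := by
    rw [← e1, ← tr2_swap hs]
  have e4 : tr2 g (fun a b => y b l * g a k) = y k l := by
    rw [← e2, ← tr2_swap hs]
  simp only [sixMetric, tr2_add, tr2_mul_const, e1, e2, e3, e4, tr2_const_mul_metric hs hd]
  ring

/-- `projSymZeroThree` of a tensor whose symmetrisation is `q + B ⊙ g`. -/
theorem projSymZeroThree_eq (hs : ∀ i j, g i j = g j i) (hd : g.det ≠ 0)
    {S q : Fin n → Fin n → Fin n → Fin n → ℝ} {B : Fin n → Fin n → ℝ}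
    (hB : ∀ i j, B i j = B j i)
    (hS : ∀ i j k l, symFirstThree S i j k l = q i j k l +
      1 / 3 * (B j k * g i l + B i k * g j l + B i j * g k l)) (i j k l : Fin n) :
    projSymZeroThree g S i j k l = q i j k l +
      1 / 3 * (B j k * g i l + B i k * g j l + B i j * g k l) -
      1 / ((n : ℝ) + 2) * (g i j * (tr2 g (fun a b => q a b k l) + 2 / 3 * B k l +
          1 / 3 * tr2 g B * g k l) +
        g i k * (tr2 g (fun a b => q a b j l) + 2 / 3 * B j l + 1 / 3 * tr2 g B * g j l) +
        g j k * (tr2 g (fun a b => q a b i l) + 2 / 3 * B i l + 1 / 3 * tr2 g B * g i l)) := by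
  have ht : ∀ k l, tr2 g (fun a b => symFirstThree S a b k l) =
      tr2 g (fun a b => q a b k l) + 2 / 3 * B k l + 1 / 3 * tr2 g B * g k l := by
    intro k l
    have e1 : tr2 g (fun a b => B a k * g b l) = B k l := by
      simp only [hs _ l]
      rw [tr2_mul (fun a => B a k) (g l), dualInner_metric_right hs hd, hB]
    have e2 : tr2 g (fun a b => B b k * g a l) = B k l := by
      rw [← e1, ← tr2_swap hs]
    simp only [hS, tr2_add, tr2_const_mul, tr2_mul_const, e1, e2]
    ring
  rw [projSymZeroThree, hS]
  simp only [ht]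
  rw [symFirstThree, hs k j, hs j i, hs k i]
  ring

theorem dualInner_scale (c : ℝ) (v w : Fin n → ℝ) :
    dualInner g (fun a => c * v a) (fun a => c * w a) = c ^ 2 * dualInner g v w := by
  calc _ = dualInner g (c • v) (c • w) := rfl
    _ = _ := by rw [dualInner_smul_left, dualInner_smul_right]; ring

theorem contract_scale (c : ℝ) (i j : Fin n) :
    contract g (fun i j k => c * U i j k) (fun i => c * u i) i j =
      c ^ 2 * dualInner g (U i j) u := by
  rw [contract_eq_dualInner, dualInner_scale]

theorem traceSq_scale (c : ℝ) (i j : Fin n) :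
    traceSq g (fun i j k => c * U i j k) i j = c ^ 2 * traceSq g U i j := by
  have h : ∀ i a b, endo g (fun i j k => c * U i j k) i a b = c * endo g U i a b := by
    intro i a b
    simp only [endo, Finset.mul_sum]
    exact Finset.sum_congr rfl fun _ _ => by ring
  simp only [traceSq, h, Finset.mul_sum]
  exact Finset.sum_congr rfl fun _ _ => Finset.sum_congr rfl fun _ _ => by ring

theorem normSq1_scale (c : ℝ) : normSq1 g (fun i => c * u i) = c ^ 2 * normSq1 g u := by
  rw [normSq1_eq_dualInner, normSq1_eq_dualInner, dualInner_scale]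

theorem normSq3_scale (c : ℝ) :
    normSq3 g (fun i j k => c * U i j k) = c ^ 2 * normSq3 g U := by
  simp only [normSq3, Finset.mul_sum]
  refine Finset.sum_congr rfl fun _ _ => Finset.sum_congr rfl fun _ _ =>
    Finset.sum_congr rfl fun _ _ => Finset.sum_congr rfl fun _ _ =>
    Finset.sum_congr rfl fun _ _ => Finset.sum_congr rfl fun _ _ => by ring

/-- The factor 3 in front of S(X,Y,W)dt(Z) compensates the averaging over three slots. Apart from
multiples of g, the symmetrisation in three arguments is therefore already totally symmetric, and
equals nine times the tensor prescribed by abundance. -/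
theorem symFirstThree_sOne (hs : ∀ i j, g i j = g j i) (hd : g.det ≠ 0)
    (hU : ∀ i j k, U i j k = U j i k) (hU' : ∀ i j k, U i j k = U i k j) (i j k l : Fin n) :
    symFirstThree (sOne g (fun i j k => 3 * U i j k) (fun i => 3 * u i)) i j k l =
      9 * cubicQuartic g U u i j k l +
      1 / 3 * ((9 * (4 / ((n : ℝ) - 2) * traceSq g U j k - 3 * dualInner g (U j k) u)) * g i l +
        (9 * (4 / ((n : ℝ) - 2) * traceSq g U i k - 3 * dualInner g (U i k) u)) * g j l +
        (9 * (4 / ((n : ℝ) - 2) * traceSq g U i j - 3 * dualInner g (U i j) u)) * g k l) := by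
  have hUf : ∀ i j, U i j = U j i := fun i j => funext fun k => hU i j k
  have hc : ∀ i j k l, compTwo g (fun i j k => 3 * U i j k) i j k l =
      9 * dualInner g (U i l) (U j k) := fun i j k l => by
    rw [compTwo_eq_dualInner hd hs _ (fun i j k => by rw [hU']), dualInner_scale]
    norm_num
  have ht : ∀ i j, traceSq g U i j = traceSq g U j i := fun i j => by
    simp only [traceSq]
    rw [Finset.sum_comm]
    exact Finset.sum_congr rfl fun _ _ => Finset.sum_congr rfl fun _ _ => by ring
  simp only [symFirstThree, sOne, hc, contract_scale, traceSq_scale, cubicQuartic]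
  rw [hUf k j, hUf j i, hUf k i, ht k j, ht j i, ht k i,
    dualInner_comm hs (U j l), dualInner_comm hs (U k l)]
  simp only [hU, hU']
  ring

/-- Here A stands for ∇C and v for ∇u. A totally symmetric tensor with known Sym⁴₀ part is fixed by
its trace, given by `htrA`; hence ∇C, and with it ∇U, is an explicit expression in U, u, W and g.
The factor 1/9 combines ∇S = ⅓ΠS₁ with S = 3U. -/
theorem derivative_eq_projSymZeroThree (hn : 3 ≤ n)
    (hs : ∀ i j, g i j = g j i) (hd : g.det ≠ 0)
    (hU : ∀ i j k, U i j k = U j i k) (hU' : ∀ i j k, U i j k = U i k j)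
    (htr : ∀ k, tr2 g (fun i j => U i j k) = 0)
    {A : Fin n → Fin n → Fin n → Fin n → ℝ} {v : Fin n → Fin n → ℝ} {m c : ℝ}
    (hA : ∀ i j k l, A i j k l = A j i k l) (hA' : ∀ i j k l, A i j k l = A i k j l)
    (hA'' : ∀ i j k l, A i j k l = A i j l k) (hv : ∀ i j, v i j = v j i)
    (htrA : ∀ k l, tr2 g (fun a b => A a b k l) = ((n : ℝ) + 2) * v k l)
    (hproj : ∀ i j k l, projSymZeroFour g
      (fun i j k l => A i j k l - v i j * g k l - v i k * g j l - v i l * g j k) i j k l =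
      projSymZeroFour g (fun a b c d => compTwo g U a b d c + 4 * (U a b c * u d)) i j k l)
    (hv' : ∀ i j, v i j = u i * u j + contractAddSq g U u i j + m * g i j)
    (hT : ∀ i j, traceSq g U i j = ((n : ℝ) - 2) * contractAddSq g U u i j + c * g i j)
    (i j k l : Fin n) :
    A l i j k - v l i * g j k - v l j * g i k - v l k * g i j =
      1 / 9 * projSymZeroThree g (sOne g (fun i j k => 3 * U i j k) (fun i => 3 * u i))
        i j k l := by
  have hn' : (3 : ℝ) ≤ n := by exact_mod_cast hn
  have n2 : (n : ℝ) - 2 ≠ 0 := by linarith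
  have n4 : (n : ℝ) + 4 ≠ 0 := by linarith
  have n2' : (n : ℝ) + 2 ≠ 0 := by linarith
  obtain ⟨y1, hy1, hp1⟩ := exists_projSymZeroFour_eq hs
    (fun i j k l => A i j k l - v i j * g k l - v i k * g j l - v i l * g j k)
  obtain ⟨y2, hy2, hp2⟩ := exists_projSymZeroFour_eq hs
    (fun a b c d => compTwo g U a b d c + 4 * (U a b c * u d))
  -- Collects every metric multiple: the corrections y1, y2 of the two projections, and ½v from
  -- symmetrising v⊙g.
  set y : Fin n → Fin n → ℝ := fun i j => 1 / 2 * v i j + y1 i j - y2 i j with hy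
  have hys : ∀ i j, y i j = y j i := fun i j => by simp only [hy]; rw [hv, hy1, hy2]
  have hAq : ∀ i j k l, A i j k l = cubicQuartic g U u i j k l + sixMetric g y i j k l := by
    intro i j k l
    have h := hproj i j k l
    rw [hp1, hp2, symFour_derivative hs hA hA' hA'' hv, symFour_compTwo hs hd hU hU'] at h
    simp only [sixMetric, hy] at h ⊢
    linear_combination h
  set W := contractAddSq g U u with hW
  set N := dualInner g u u with hN
  have hdU : ∀ i j, dualInner g (U i j) u = W i j - u i * u j := fun i j => by
    rw [hW, contractAddSq]; ring
  have hWt : tr2 g (fun i j => W i j) = N := tr2_contractAddSq hs htr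
  have huu : tr2 g (fun i j => u i * u j) = N := tr2_mul u u
  set Y := tr2 g y with hY
  -- Taking the trace of the decomposition of A gives a linear equation for y.
  have htrace : ∀ k l, ((n : ℝ) + 2) * v k l = 2 / 3 * traceSq g U k l +
      2 * (W k l - u k * u l) + (((n : ℝ) + 4) * y k l + Y * g k l) := fun k l => by
    rw [← htrA, ← hdU]
    simp only [hAq]
    rw [tr2_add, tr2_cubicQuartic hs hU hU' htr, tr2_sixMetric hs hd hys]
  -- The coefficient of g in y; it still involves the unknown trace Y, which is eliminated below.
  obtain ⟨s, h4⟩ : ∃ s : ℝ, ((n : ℝ) + 4) * s = ((n : ℝ) + 2) * m - 2 / 3 * c - Y :=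
    ⟨(((n : ℝ) + 2) * m - 2 / 3 * c - Y) / ((n : ℝ) + 4), by field_simp⟩
  -- After inserting v and 𝒰, the coefficient of u⊗u in the trace equation is n+4 and that of W is
  -- (n+4)/3.
  have hyW : ∀ i j, y i j = u i * u j + 1 / 3 * W i j + s * g i j := fun i j => by
    have h := htrace i j
    rw [hv', hT] at h
    apply mul_left_cancel₀ n4
    linear_combination -h - g i j * h4
  -- The trace of y computed from its solved form closes the system for Y, s and m.
  have hYs : Y = 4 / 3 * N + s * n := by
    have : y = fun i j => u i * u j + 1 / 3 * W i j + s * g i j :=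
      funext fun i => funext fun j => hyW i j
    rw [hY, this, tr2_add, tr2_add, tr2_const_mul, tr2_const_mul_metric hs hd, huu, hWt]
    ring
  have hms : ((n : ℝ) + 2) * m = 2 / 3 * c + (2 * (n : ℝ) + 4) * s + 4 / 3 * N := by
    linear_combination -h4 + hYs
  set B : Fin n → Fin n → ℝ := fun j k =>
    9 * (4 / ((n : ℝ) - 2) * traceSq g U j k - 3 * dualInner g (U j k) u) with hB
  have hBW : ∀ i j, B i j = 9 * W i j + 27 * (u i * u j) + 36 * c / ((n : ℝ) - 2) * g i j :=
    fun i j => by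
      simp only [hB, hT, hdU]
      field_simp
      ring
  have hWs : ∀ i j, W i j = W j i := contractAddSq_symm hU
  have hBs : ∀ i j, B i j = B j i := fun i j => by
    rw [hBW, hBW, hs i j, hWs i j]; ring
  have hBt : tr2 g B = 36 * N + 36 * c / ((n : ℝ) - 2) * n := by
    have : B = fun i j => 9 * W i j + 27 * (u i * u j) + 36 * c / ((n : ℝ) - 2) * g i j :=
      funext fun i => funext fun j => hBW i j
    rw [this, tr2_add, tr2_add, tr2_const_mul, tr2_const_mul 27, tr2_const_mul_metric hs hd,
      huu, hWt]
    ring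
  rw [projSymZeroThree_eq hs hd (q := fun i j k l => 9 * cubicQuartic g U u i j k l) hBs
    (fun i j k l => symFirstThree_sOne hs hd hU hU' i j k l)]
  have hq : ∀ k l, tr2 g (fun a b => 9 * cubicQuartic g U u a b k l) =
      9 * (2 / 3 * traceSq g U k l + 2 * dualInner g (U k l) u) := fun k l => by
    rw [tr2_const_mul, tr2_cubicQuartic hs hU hU' htr]
  -- Total symmetry moves the direction of differentiation from the first to the last slot, the
  -- convention of S₁.
  have e : A l i j k = A i j k l := by rw [hA l i, hA' i l, hA'' i j l]
  rw [e, hAq]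
  simp only [hq, hBt, hBW, hT, hdU, sixMetric, hyW, hv']
  rw [hs l k, hs l j, hs l i, hWs l i, hWs l j, hWs l k]
  -- Expressing m through s makes the claim a rational identity in independent quantities.
  have hm : m = (2 / 3 * c + (2 * (n : ℝ) + 4) * s + 4 / 3 * N) / ((n : ℝ) + 2) := by
    rw [eq_div_iff n2']; linear_combination hms
  rw [hm]
  field_simp
  ring

end Projections
end AbundantGeometry

namespace AbundantGeometry

/-! ### Calculus of partial derivatives on open sets -/

section PartialDerivatives
open Topology
variable {n : ℕ} {V : Type*} [NormedAddCommGroup V] [NormedSpace ℝ V]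
  {Ω : Set (EuclideanSpace ℝ (Fin n))} {x : EuclideanSpace ℝ (Fin n)}

theorem pd_congr {F H : EuclideanSpace ℝ (Fin n) → V} (hΩ : IsOpen Ω) (hx : x ∈ Ω)
    (h : ∀ y ∈ Ω, F y = H y) (i : Fin n) : pd i F x = pd i H x := by
  have : F =ᶠ[𝓝 x] H := Filter.eventually_of_mem (hΩ.mem_nhds hx) h
  rw [pd, pd, this.fderiv_eq]

theorem contDiffOn_pd {F : EuclideanSpace ℝ (Fin n) → V} (hF : ContDiffOn ℝ ∞ F Ω)
    (hΩ : IsOpen Ω) (i : Fin n) : ContDiffOn ℝ ∞ (pd i F) Ω :=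
  (hF.fderiv_of_isOpen hΩ (by simp)).clm_apply contDiffOn_const

theorem differentiableAt_of_contDiffOn {F : EuclideanSpace ℝ (Fin n) → V}
    (hF : ContDiffOn ℝ ∞ F Ω) (hΩ : IsOpen Ω) (hx : x ∈ Ω) : DifferentiableAt ℝ F x :=
  (hF.contDiffAt (hΩ.mem_nhds hx)).differentiableAt (by simp)

theorem two_le_infty : (2 : WithTop ℕ∞) ≤ ∞ := by
  have : ((2 : ℕ∞) : WithTop ℕ∞) ≤ ((⊤ : ℕ∞) : WithTop ℕ∞) := WithTop.coe_le_coe.mpr le_top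
  exact this

theorem pd_comm {F : EuclideanSpace ℝ (Fin n) → V} (hF : ContDiffOn ℝ ∞ F Ω)
    (hΩ : IsOpen Ω) (hx : x ∈ Ω) (i j : Fin n) :
    pd i (pd j F) x =
      pd j (pd i F) x := by
  have hF' : DifferentiableAt ℝ (fderiv ℝ F) x :=
    differentiableAt_of_contDiffOn (hF.fderiv_of_isOpen (m := ∞) hΩ (by simp)) hΩ hx
  have h : ∀ i j : Fin n, pd i (pd j F) x =
      fderiv ℝ (fderiv ℝ F) x (EuclideanSpace.single i (1 : ℝ))
        (EuclideanSpace.single j (1 : ℝ)) := fun i j => by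
    have : pd j F =
        fun y => fderiv ℝ F y (EuclideanSpace.single j (1 : ℝ)) := rfl
    rw [pd, this, fderiv_clm_apply hF' (differentiableAt_const _)]
    simp
  rw [h, h]
  exact ((hF.contDiffAt (hΩ.mem_nhds hx)).isSymmSndFDerivAt (by simpa using two_le_infty)) _ _

theorem pd_add {F H : EuclideanSpace ℝ (Fin n) → V} (hF : DifferentiableAt ℝ F x)
    (hH : DifferentiableAt ℝ H x) (i : Fin n) :
    pd i (fun y => F y + H y) x = pd i F x + pd i H x := by
  simp [pd, fderiv_fun_add hF hH]

theorem pd_sub {F H : EuclideanSpace ℝ (Fin n) → V} (hF : DifferentiableAt ℝ F x)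
    (hH : DifferentiableAt ℝ H x) (i : Fin n) :
    pd i (fun y => F y - H y) x = pd i F x - pd i H x := by
  simp [pd, fderiv_fun_sub hF hH]

theorem pd_const (c : V) (i : Fin n) : pd i (fun _ => c) x = 0 := by
  simp [pd]

theorem pd_sum {ι : Type*} {s : Finset ι} {F : ι → EuclideanSpace ℝ (Fin n) → V}
    (hF : ∀ a ∈ s, DifferentiableAt ℝ (F a) x) (i : Fin n) :
    pd i (fun y => ∑ a ∈ s, F a y) x = ∑ a ∈ s, pd i (F a) x := by
  simp [pd, fderiv_fun_sum hF]

theorem pd_smul {a : EuclideanSpace ℝ (Fin n) → ℝ} {F : EuclideanSpace ℝ (Fin n) → V}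
    (ha : DifferentiableAt ℝ a x) (hF : DifferentiableAt ℝ F x) (i : Fin n) :
    pd i (fun y => a y • F y) x = a x • pd i F x + pd i a x • F x := by
  simp [pd, fderiv_fun_smul ha hF]

theorem pd_mul {a b : EuclideanSpace ℝ (Fin n) → ℝ}
    (ha : DifferentiableAt ℝ a x) (hb : DifferentiableAt ℝ b x) (i : Fin n) :
    pd i (fun y => a y * b y) x = a x * pd i b x + pd i a x * b x :=
  pd_smul ha hb i

theorem pd_const_mul (c : ℝ) {a : EuclideanSpace ℝ (Fin n) → ℝ}
    (ha : DifferentiableAt ℝ a x) (i : Fin n) :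
    pd i (fun y => c * a y) x = c * pd i a x := by
  rw [pd_mul (differentiableAt_const c) ha, pd_const, zero_mul, add_zero]

end PartialDerivatives

/-! ### Smoothness of determinants and inverse matrices -/

section MatrixSmooth
variable {n m : ℕ} {Ω : Set (EuclideanSpace ℝ (Fin n))}
  {M : EuclideanSpace ℝ (Fin n) → Matrix (Fin m) (Fin m) ℝ}

theorem contDiffOn_det (hM : ∀ i j, ContDiffOn ℝ ∞ (fun x => M x i j) Ω) :
    ContDiffOn ℝ ∞ (fun x => (M x).det) Ω := by
  simp only [Matrix.det_apply']
  exact ContDiffOn.sum fun σ _ => contDiffOn_const.mul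
    (contDiffOn_prod fun i _ => hM _ _)

theorem contDiffOn_inv_entry (hM : ∀ i j, ContDiffOn ℝ ∞ (fun x => M x i j) Ω)
    (hd : ∀ x ∈ Ω, (M x).det ≠ 0) (i j : Fin m) :
    ContDiffOn ℝ ∞ (fun x => (M x)⁻¹ i j) Ω := by
  -- Cramer's rule: both factors are built from determinants with smooth entries.
  have h : (fun x => (M x)⁻¹ i j) = fun x => ((M x).det)⁻¹ *
      ((M x).updateRow j (Pi.single i 1)).det := by
    funext x
    rw [Matrix.inv_def, Matrix.smul_apply, Ring.inverse_eq_inv', Matrix.adjugate_apply,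
      smul_eq_mul]
  rw [h]
  refine ((contDiffOn_det hM).inv hd).mul (contDiffOn_det fun a b => ?_)
  by_cases hab : a = j
  · subst hab
    simp only [Matrix.updateRow_self]
    exact contDiffOn_const
  · simp only [Matrix.updateRow_ne hab]
    exact hM a b

end MatrixSmooth

/-- A smooth pseudo-Riemannian metric on an open set, in components. -/
structure IsMetricOn {n : ℕ} (Ω : Set (EuclideanSpace ℝ (Fin n)))
    (g : EuclideanSpace ℝ (Fin n) → Matrix (Fin n) (Fin n) ℝ) : Prop where
  isOpen : IsOpen Ω
  symm : ∀ x ∈ Ω, ∀ i j, g x i j = g x j i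
  det_ne_zero : ∀ x ∈ Ω, (g x).det ≠ 0
  smooth : ∀ i j, ContDiffOn ℝ ∞ (fun x => g x i j) Ω

/-! ### The Levi-Civita connection in coordinates -/

namespace IsMetricOn
variable {n : ℕ} {Ω : Set (EuclideanSpace ℝ (Fin n))}
  {g : EuclideanSpace ℝ (Fin n) → Matrix (Fin n) (Fin n) ℝ} {x : EuclideanSpace ℝ (Fin n)}

theorem differentiableAt (hg : IsMetricOn Ω g) (hx : x ∈ Ω) (i j : Fin n) :
    DifferentiableAt ℝ (fun y => g y i j) x :=
  differentiableAt_of_contDiffOn (hg.smooth i j) hg.isOpen hx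

theorem smooth_inv (hg : IsMetricOn Ω g) (i j : Fin n) :
    ContDiffOn ℝ ∞ (fun x => (g x)⁻¹ i j) Ω :=
  contDiffOn_inv_entry hg.smooth hg.det_ne_zero i j

theorem pd_symm (hg : IsMetricOn Ω g) (hx : x ∈ Ω) (l i j : Fin n) :
    pd l (fun y => g y i j) x = pd l (fun y => g y j i) x :=
  pd_congr hg.isOpen hx (fun y hy => hg.symm y hy i j) l

theorem smooth_christoffel (hg : IsMetricOn Ω g) (k i j : Fin n) :
    ContDiffOn ℝ ∞ (christoffel g k i j) Ω := by
  unfold christoffel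
  refine contDiffOn_const.mul (ContDiffOn.sum fun l _ => (hg.smooth_inv k l).mul ?_)
  exact ((contDiffOn_pd (hg.smooth j l) hg.isOpen i).add
    (contDiffOn_pd (hg.smooth i l) hg.isOpen j)).sub (contDiffOn_pd (hg.smooth i j) hg.isOpen l)

theorem christoffel_symm (hg : IsMetricOn Ω g) (hx : x ∈ Ω) (k i j : Fin n) :
    christoffel g k i j x = christoffel g k j i x := by
  unfold christoffel
  congr 1
  refine Finset.sum_congr rfl fun l _ => ?_
  rw [hg.pd_symm hx l i j]; ring

/-- Lowering the upper index removes the inverse metric and leaves Christoffel symbols of the first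
kind. -/
theorem sum_christoffel_mul (hg : IsMetricOn Ω g) (hx : x ∈ Ω) (i j k : Fin n) :
    ∑ a, christoffel g a i j x * g x a k = 1 / 2 * (pd i (fun y => g y j k) x +
      pd j (fun y => g y i k) x - pd k (fun y => g y i j) x) := by
  have h : ∀ a, christoffel g a i j x * g x a k = ∑ l, 1 / 2 *
      (pd i (fun y => g y j l) x + pd j (fun y => g y i l) x - pd l (fun y => g y i j) x) *
      (g x k a * (g x)⁻¹ a l) := fun a => by
    rw [christoffel, Finset.mul_sum, Finset.sum_mul]
    exact Finset.sum_congr rfl fun l _ => by rw [hg.symm x hx a k]; ring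
  simp only [h]
  rw [Finset.sum_comm]
  simp only [← Finset.mul_sum, sum_mul_inv (hg.det_ne_zero x hx)]
  simp

/-- The Levi-Civita connection is metric. -/
theorem pd_metric (hg : IsMetricOn Ω g) (hx : x ∈ Ω) (i j k : Fin n) :
    pd i (fun y => g y j k) x =
      ∑ a, (christoffel g a i j x * g x a k + christoffel g a i k x * g x j a) := by
  have h := hg.sum_christoffel_mul hx i k j
  simp only [fun a => hg.symm x hx a j] at h
  rw [Finset.sum_add_distrib, hg.sum_christoffel_mul hx i j k, h, hg.pd_symm hx i k j]
  ring

/-- The inverse metric is parallel too: differentiate g⁻¹g = 1 and insert ∂g = Λg + gΛᵀ, where Λ is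
the matrix of the connection in direction l. -/
theorem pd_inv (hg : IsMetricOn Ω g) (hx : x ∈ Ω) (l a b : Fin n) :
    pd l (fun y => (g y)⁻¹ a b) x = -∑ c, ((g x)⁻¹ a c * christoffel g b l c x +
      (g x)⁻¹ c b * christoffel g a l c x) := by
  set Λ : Matrix (Fin n) (Fin n) ℝ := Matrix.of fun c e => christoffel g e l c x with hΛ
  set D : Matrix (Fin n) (Fin n) ℝ := Matrix.of fun c e => pd l (fun y => g y c e) x with hD
  set I : Matrix (Fin n) (Fin n) ℝ := Matrix.of fun c e => pd l (fun y => (g y)⁻¹ c e) x with hI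
  have hu : IsUnit (g x).det := isUnit_iff_ne_zero.mpr (hg.det_ne_zero x hx)
  have h1 : D = Λ * g x + g x * Λ.transpose := by
    ext c e
    simp only [hD, hΛ, Matrix.of_apply, Matrix.add_apply, Matrix.mul_apply,
      Matrix.transpose_apply, hg.pd_metric hx, Finset.sum_add_distrib]
    congr 1
    exact Finset.sum_congr rfl fun d _ => by ring
  have h2 : I * g x + (g x)⁻¹ * D = 0 := by
    ext c e
    have h : ∀ y ∈ Ω, ∑ d, (g y)⁻¹ c d * g y d e = if c = e then 1 else 0 :=
      fun y hy => sum_inv_mul (hg.det_ne_zero y hy) c e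
    have h' := pd_congr hg.isOpen hx h l
    rw [pd_const, pd_sum fun d _ => ((differentiableAt_of_contDiffOn (hg.smooth_inv c d)
      hg.isOpen hx).fun_mul (hg.differentiableAt hx d e))] at h'
    rw [Matrix.add_apply, Matrix.mul_apply, Matrix.mul_apply, Matrix.zero_apply, ← h',
      ← Finset.sum_add_distrib]
    refine Finset.sum_congr rfl fun d _ => ?_
    rw [pd_mul (differentiableAt_of_contDiffOn (hg.smooth_inv c d) hg.isOpen hx)
      (hg.differentiableAt hx d e)]
    simp only [hI, hD, Matrix.of_apply]
    ring
  have h3 : I = -((g x)⁻¹ * Λ + Λ.transpose * (g x)⁻¹) := by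
    have h4 : I * g x * (g x)⁻¹ = -((g x)⁻¹ * D) * (g x)⁻¹ := by
      rw [eq_neg_of_add_eq_zero_left h2]
    rw [Matrix.mul_nonsing_inv_cancel_right _ _ hu, h1] at h4
    rw [h4, Matrix.mul_add, ← Matrix.mul_assoc, ← Matrix.mul_assoc, Matrix.nonsing_inv_mul _ hu,
      Matrix.one_mul, Matrix.neg_mul, Matrix.add_mul, Matrix.mul_nonsing_inv_cancel_right _ _ hu]
  have h5 := congrFun (congrFun h3 a) b
  rw [Matrix.neg_apply, Matrix.add_apply, Matrix.mul_apply, Matrix.mul_apply,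
    ← Finset.sum_add_distrib] at h5
  refine h5.trans ?_
  congr 1
  exact Finset.sum_congr rfl fun c _ => by
    simp only [hΛ, Matrix.of_apply, Matrix.transpose_apply]; ring

/-- Covariant differentiation commutes with the metric trace. -/
theorem cov1_trace (hg : IsMetricOn Ω g) (hx : x ∈ Ω)
    {T : EuclideanSpace ℝ (Fin n) → Fin n → Fin n → Fin n → ℝ}
    (hT : ∀ i j k, ContDiffOn ℝ ∞ (fun y => T y i j k) Ω) (l i : Fin n) :
    cov1 g (fun y i => tr2 (g y) (T y i)) l i x =
      tr2 (g x) (fun a b => cov3 g T l i a b x) := by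
  have hI : ∀ a b, DifferentiableAt ℝ (fun y => (g y)⁻¹ a b) x := fun a b =>
    differentiableAt_of_contDiffOn (hg.smooth_inv a b) hg.isOpen hx
  have hTd : ∀ a b, DifferentiableAt ℝ (fun y => T y i a b) x := fun a b =>
    differentiableAt_of_contDiffOn (hT i a b) hg.isOpen hx
  have h1 : pd l (fun y => tr2 (g y) (T y i)) x = ∑ a, ∑ b,
      ((g x)⁻¹ a b * pd l (fun y => T y i a b) x +
        pd l (fun y => (g y)⁻¹ a b) x * T x i a b) := by
    unfold tr2
    rw [pd_sum fun a _ => DifferentiableAt.fun_sum fun b _ => (hI a b).fun_mul (hTd a b)]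
    refine Finset.sum_congr rfl fun a _ => ?_
    rw [pd_sum fun b _ => (hI a b).fun_mul (hTd a b)]
    exact Finset.sum_congr rfl fun b _ => pd_mul (hI a b) (hTd a b) l
  -- The derivative of g⁻¹ supplies exactly the connection terms for the two contracted slots, after
  -- renaming summation indices.
  have h2 : ∑ a, ∑ b, pd l (fun y => (g y)⁻¹ a b) x * T x i a b =
      -∑ a, ∑ b, ∑ c, (g x)⁻¹ a b * (christoffel g c l b x * T x i a c +
        christoffel g c l a x * T x i c b) := by
    have e1 : ∀ a b, pd l (fun y => (g y)⁻¹ a b) x * T x i a b =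
        -∑ c, (g x)⁻¹ a c * christoffel g b l c x * T x i a b -
          ∑ c, (g x)⁻¹ c b * christoffel g a l c x * T x i a b := fun a b => by
      rw [hg.pd_inv hx, neg_mul, Finset.sum_add_distrib, add_mul, Finset.sum_mul, Finset.sum_mul]
      ring
    simp only [e1, Finset.sum_sub_distrib, Finset.sum_neg_distrib, mul_add, Finset.sum_add_distrib]
    have e2 : ∑ a, ∑ b, ∑ c, (g x)⁻¹ a c * christoffel g b l c x * T x i a b =
        ∑ a, ∑ b, ∑ c, (g x)⁻¹ a b * (christoffel g c l b x * T x i a c) :=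
      Finset.sum_congr rfl fun a _ => by
        rw [Finset.sum_comm]
        exact Finset.sum_congr rfl fun b _ => Finset.sum_congr rfl fun c _ => by ring
    have e3 : ∑ a, ∑ b, ∑ c, (g x)⁻¹ c b * christoffel g a l c x * T x i a b =
        ∑ a, ∑ b, ∑ c, (g x)⁻¹ a b * (christoffel g c l a x * T x i c b) := by
      calc _ = ∑ b, ∑ a, ∑ c, (g x)⁻¹ c b * christoffel g a l c x * T x i a b :=
            Finset.sum_comm
        _ = ∑ b, ∑ c, ∑ a, (g x)⁻¹ c b * christoffel g a l c x * T x i a b :=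
            Finset.sum_congr rfl fun _ _ => Finset.sum_comm
        _ = ∑ c, ∑ b, ∑ a, (g x)⁻¹ c b * christoffel g a l c x * T x i a b :=
            Finset.sum_comm
        _ = _ := Finset.sum_congr rfl fun a _ => Finset.sum_congr rfl fun b _ =>
            Finset.sum_congr rfl fun c _ => by ring
    rw [e2, e3]; ring
  have h3 : ∑ d, christoffel g d l i x * tr2 (g x) (T x d) =
      ∑ a, ∑ b, ∑ d, (g x)⁻¹ a b * (christoffel g d l i x * T x d a b) := by
    simp only [tr2, Finset.mul_sum]
    rw [Finset.sum_comm]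
    refine Finset.sum_congr rfl fun a _ => ?_
    rw [Finset.sum_comm]
    exact Finset.sum_congr rfl fun b _ => Finset.sum_congr rfl fun c _ => by ring
  rw [cov1, h1]
  simp only [Finset.sum_add_distrib]
  rw [h2, h3]
  simp only [tr2, cov3, mul_sub, Finset.mul_sum, Finset.sum_sub_distrib, mul_add,
    Finset.sum_add_distrib]
  ring

theorem cov3_symm_left (hg : IsMetricOn Ω g) (hx : x ∈ Ω)
    {T : EuclideanSpace ℝ (Fin n) → Fin n → Fin n → Fin n → ℝ}
    (hT : ∀ y ∈ Ω, ∀ i j k, T y i j k = T y j i k) (l i j k : Fin n) :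
    cov3 g T l i j k x = cov3 g T l j i k x := by
  rw [cov3, cov3, pd_congr hg.isOpen hx fun y hy => hT y hy i j k]
  congr 1
  refine Finset.sum_congr rfl fun a _ => ?_
  rw [hT x hx a j k, hT x hx i a k, hT x hx i j a]; ring

theorem cov3_symm_right (hg : IsMetricOn Ω g) (hx : x ∈ Ω)
    {T : EuclideanSpace ℝ (Fin n) → Fin n → Fin n → Fin n → ℝ}
    (hT : ∀ y ∈ Ω, ∀ i j k, T y i j k = T y i k j) (l i j k : Fin n) :
    cov3 g T l i j k x = cov3 g T l i k j x := by
  rw [cov3, cov3, pd_congr hg.isOpen hx fun y hy => hT y hy i j k]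
  congr 1
  refine Finset.sum_congr rfl fun a _ => ?_
  rw [hT x hx a j k, hT x hx i a k, hT x hx i j a]; ring

theorem cov1_const_mul (hg : IsMetricOn Ω g) (hx : x ∈ Ω) (c : ℝ)
    {v : EuclideanSpace ℝ (Fin n) → Fin n → ℝ}
    (hv : ∀ i, ContDiffOn ℝ ∞ (fun y => v y i) Ω) (l i : Fin n) :
    cov1 g (fun y i => c * v y i) l i x = c * cov1 g v l i x := by
  rw [cov1, cov1, pd_const_mul c (differentiableAt_of_contDiffOn (hv i) hg.isOpen hx), mul_sub,
    Finset.mul_sum]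
  congr 1
  exact Finset.sum_congr rfl fun a _ => by ring

theorem cov3_const_mul (hg : IsMetricOn Ω g) (hx : x ∈ Ω) (c : ℝ)
    {T : EuclideanSpace ℝ (Fin n) → Fin n → Fin n → Fin n → ℝ}
    (hT : ∀ i j k, ContDiffOn ℝ ∞ (fun y => T y i j k) Ω) (l i j k : Fin n) :
    cov3 g (fun y i j k => c * T y i j k) l i j k x = c * cov3 g T l i j k x := by
  rw [cov3, cov3, pd_const_mul c (differentiableAt_of_contDiffOn (hT i j k) hg.isOpen hx), mul_sub,
    Finset.mul_sum]
  congr 1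
  exact Finset.sum_congr rfl fun a _ => by ring

/-- Since ∇g = 0, only u is differentiated in u⊙g. -/
theorem cov3_tracefree (hg : IsMetricOn Ω g) (hx : x ∈ Ω)
    {T : EuclideanSpace ℝ (Fin n) → Fin n → Fin n → Fin n → ℝ}
    {u : EuclideanSpace ℝ (Fin n) → Fin n → ℝ}
    (hT : ∀ i j k, ContDiffOn ℝ ∞ (fun y => T y i j k) Ω)
    (hu : ∀ i, ContDiffOn ℝ ∞ (fun y => u y i) Ω) (l i j k : Fin n) :
    cov3 g (fun y i j k => T y i j k - u y i * g y j k - u y j * g y i k - u y k * g y i j)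
      l i j k x = cov3 g T l i j k x - cov1 g u l i x * g x j k - cov1 g u l j x * g x i k -
      cov1 g u l k x * g x i j := by
  have hud : ∀ i, DifferentiableAt ℝ (fun y => u y i) x := fun i =>
    differentiableAt_of_contDiffOn (hu i) hg.isOpen hx
  have hTd := differentiableAt_of_contDiffOn (hT i j k) hg.isOpen hx
  have hgd := hg.differentiableAt hx
  have hp : ∀ i j k, pd l (fun y => u y i * g y j k) x = ∑ a, u x i *
      (christoffel g a l j x * g x a k + christoffel g a l k x * g x j a) +
      pd l (fun y => u y i) x * g x j k := fun i j k => by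
    rw [pd_mul (hud i) (hgd j k), hg.pd_metric hx, Finset.mul_sum]
  rw [cov3, cov3, pd_sub ((hTd.fun_sub ((hud i).fun_mul (hgd j k))).fun_sub
      ((hud j).fun_mul (hgd i k))) ((hud k).fun_mul (hgd i j)),
    pd_sub (hTd.fun_sub ((hud i).fun_mul (hgd j k))) ((hud j).fun_mul (hgd i k)),
    pd_sub hTd ((hud i).fun_mul (hgd j k)), hp, hp, hp]
  simp only [cov1, sub_mul, Finset.sum_mul]
  have hsum : ∑ a, (christoffel g a l i x * (T x a j k - u x a * g x j k - u x j * g x a k -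
        u x k * g x a j) + christoffel g a l j x * (T x i a k - u x i * g x a k -
        u x a * g x i k - u x k * g x i a) + christoffel g a l k x * (T x i j a -
        u x i * g x j a - u x j * g x i a - u x a * g x i j)) =
      ∑ a, (christoffel g a l i x * T x a j k + christoffel g a l j x * T x i a k +
        christoffel g a l k x * T x i j a) -
      ∑ a, u x i * (christoffel g a l j x * g x a k + christoffel g a l k x * g x j a) -
      ∑ a, u x j * (christoffel g a l i x * g x a k + christoffel g a l k x * g x i a) -
      ∑ a, u x k * (christoffel g a l i x * g x a j + christoffel g a l j x * g x i a) -
      ∑ a, christoffel g a l i x * u x a * g x j k -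
      ∑ a, christoffel g a l j x * u x a * g x i k -
      ∑ a, christoffel g a l k x * u x a * g x i j := by
    simp only [← Finset.sum_sub_distrib]
    exact Finset.sum_congr rfl fun a _ => by ring
  rw [hsum]
  ring

end IsMetricOn
end AbundantGeometry

namespace AbundantGeometry

/-! ### The moving frame and comparison of coefficients -/

section Frame
variable {n : ℕ} {F X : EuclideanSpace ℝ (Fin n) → (Fin (n + 1) → ℝ)}
  {x : EuclideanSpace ℝ (Fin n)}

theorem vecMul_frame (w : Fin (n + 1) → ℝ) :
    Matrix.vecMul w (Matrix.of (frame F X x)) =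
      ∑ k : Fin n, w k.castSucc • pd k F x + w (Fin.last n) • X x := by
  have h1 : ∀ i : Fin n, frame F X x i.castSucc = pd i F x := fun i => by simp [frame]
  have h2 : frame F X x (Fin.last n) = X x := by simp [frame]
  rw [Matrix.vecMul_eq_sum, Fin.sum_univ_castSucc, ← h2]
  simp only [← h1]
  rfl

theorem frameCoeff_spec (hd : (Matrix.of (frame F X x)).det ≠ 0) (v : Fin (n + 1) → ℝ) :
    v = ∑ k : Fin n, frameCoeff F X x v k.castSucc • pd k F x +
      frameCoeff F X x v (Fin.last n) • X x := by
  rw [← vecMul_frame, frameCoeff, Matrix.vecMul_vecMul,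
    Matrix.nonsing_inv_mul _ (isUnit_iff_ne_zero.mpr hd), Matrix.vecMul_one]

/-- Allows tangential and transversal parts of a vector identity to be read off separately. -/
theorem frame_unique (hd : (Matrix.of (frame F X x)).det ≠ 0) {a a' : Fin n → ℝ} {b b' : ℝ}
    (h : ∑ k, a k • pd k F x + b • X x = ∑ k, a' k • pd k F x + b' • X x) :
    (∀ k, a k = a' k) ∧ b = b' := by
  have e : ∀ (a : Fin n → ℝ) (b : ℝ), Matrix.vecMul (Fin.snoc (α := fun _ => ℝ) a b)
      (Matrix.of (frame F X x)) = ∑ k, a k • pd k F x + b • X x := fun a b => by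
    rw [vecMul_frame]; simp
  rw [← e, ← e] at h
  have h2 : Fin.snoc (α := fun _ => ℝ) a b = Fin.snoc (α := fun _ => ℝ) a' b' := by
    have := congrArg (fun w => Matrix.vecMul w (Matrix.of (frame F X x))⁻¹) h
    simpa [Matrix.vecMul_vecMul, Matrix.mul_nonsing_inv _ (isUnit_iff_ne_zero.mpr hd)] using this
  exact ⟨fun k => by simpa using congrFun h2 k.castSucc, by simpa using congrFun h2 (Fin.last n)⟩

end Frame

/-- Local coordinate expression of a non-degenerate hypersurface with constant transversal
field `c`. -/
structure IsLocalSphere {n : ℕ} (Ω : Set (EuclideanSpace ℝ (Fin n)))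
    (F : EuclideanSpace ℝ (Fin n) → (Fin (n + 1) → ℝ)) (c : Fin (n + 1) → ℝ) : Prop where
  isOpen : IsOpen Ω
  smooth : ContDiffOn ℝ ∞ F Ω
  det_frame : ∀ x ∈ Ω, (Matrix.of (frame F (fun _ => c) x)).det ≠ 0

/-! ### Structure equations for a constant transversal field -/

namespace IsLocalSphere
variable {n : ℕ} {Ω : Set (EuclideanSpace ℝ (Fin n))}
  {F : EuclideanSpace ℝ (Fin n) → (Fin (n + 1) → ℝ)} {c : Fin (n + 1) → ℝ}
  {x : EuclideanSpace ℝ (Fin n)}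

theorem smooth_pd (hF : IsLocalSphere Ω F c) (i : Fin n) : ContDiffOn ℝ ∞ (pd i F) Ω :=
  contDiffOn_pd hF.smooth hF.isOpen i

theorem smooth_frame (hF : IsLocalSphere Ω F c) (a b : Fin (n + 1)) :
    ContDiffOn ℝ ∞ (fun x => (Matrix.of (frame F (fun _ => c) x)) a b) Ω := by
  refine Fin.lastCases ?_ (fun k => ?_) a
  · simp only [Matrix.of_apply, frame, Fin.snoc_last]
    exact contDiffOn_const
  · simp only [Matrix.of_apply, frame, Fin.snoc_castSucc]
    exact contDiffOn_pi.mp (hF.smooth_pd k) b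

theorem smooth_frameCoeff (hF : IsLocalSphere Ω F c)
    {v : EuclideanSpace ℝ (Fin n) → Fin (n + 1) → ℝ} (hv : ContDiffOn ℝ ∞ v Ω)
    (a : Fin (n + 1)) : ContDiffOn ℝ ∞ (fun x => frameCoeff F (fun _ => c) x (v x) a) Ω := by
  simp only [frameCoeff, Matrix.vecMul, dotProduct]
  exact ContDiffOn.sum fun j _ => (contDiffOn_pi.mp hv j).mul
    (contDiffOn_inv_entry hF.smooth_frame hF.det_frame j a)

theorem smooth_inducedChristoffel (hF : IsLocalSphere Ω F c) (k i j : Fin n) :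
    ContDiffOn ℝ ∞ (inducedChristoffel F (fun _ => c) k i j) Ω :=
  hF.smooth_frameCoeff (contDiffOn_pd (hF.smooth_pd j) hF.isOpen i) _

theorem smooth_fundForm (hF : IsLocalSphere Ω F c) (i j : Fin n) :
    ContDiffOn ℝ ∞ (fun x => fundForm F (fun _ => c) x i j) Ω :=
  hF.smooth_frameCoeff (contDiffOn_pd (hF.smooth_pd j) hF.isOpen i) _

/-- The Gauss formula. -/
theorem gauss_formula (hF : IsLocalSphere Ω F c) (hx : x ∈ Ω) (i j : Fin n) :
    pd i (pd j F) x = ∑ k, inducedChristoffel F (fun _ => c) k i j x • pd k F x +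
      fundForm F (fun _ => c) x i j • c :=
  frameCoeff_spec (hF.det_frame x hx) _

theorem inducedChristoffel_symm (hF : IsLocalSphere Ω F c) (hx : x ∈ Ω) (k i j : Fin n) :
    inducedChristoffel F (fun _ => c) k i j x = inducedChristoffel F (fun _ => c) k j i x := by
  rw [inducedChristoffel, inducedChristoffel, pd_comm hF.smooth hF.isOpen hx]

theorem fundForm_symm (hF : IsLocalSphere Ω F c) (hx : x ∈ Ω) (i j : Fin n) :
    fundForm F (fun _ => c) x i j = fundForm F (fun _ => c) x j i := by
  simp only [fundForm, Matrix.of_apply]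
  rw [pd_comm hF.smooth hF.isOpen hx]

/-- As c is constant, differentiating G·c yields no shape-operator term, so the tangential part
involves the induced connection alone. -/
theorem pd_gauss_formula (hF : IsLocalSphere Ω F c) (hx : x ∈ Ω) (l i j : Fin n) :
    pd l (pd i (pd j F)) x =
      ∑ m, (pd l (inducedChristoffel F (fun _ => c) m i j) x +
        ∑ k, inducedChristoffel F (fun _ => c) k i j x *
          inducedChristoffel F (fun _ => c) m l k x) • pd m F x +
      (pd l (fun y => fundForm F (fun _ => c) y i j) x +
        ∑ k, inducedChristoffel F (fun _ => c) k i j x * fundForm F (fun _ => c) x l k) • c := by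
  have hK : ∀ k, DifferentiableAt ℝ (inducedChristoffel F (fun _ => c) k i j) x := fun k =>
    differentiableAt_of_contDiffOn (hF.smooth_inducedChristoffel k i j) hF.isOpen hx
  have hG : DifferentiableAt ℝ (fun y => fundForm F (fun _ => c) y i j) x :=
    differentiableAt_of_contDiffOn (hF.smooth_fundForm i j) hF.isOpen hx
  have hP : ∀ k, DifferentiableAt ℝ (pd k F) x := fun k =>
    differentiableAt_of_contDiffOn (hF.smooth_pd k) hF.isOpen hx
  rw [pd_congr hF.isOpen hx fun y hy => hF.gauss_formula hy i j,
    pd_add (DifferentiableAt.fun_sum fun k _ => (hK k).fun_smul (hP k))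
      (hG.fun_smul (differentiableAt_const c)),
    pd_sum fun k _ => (hK k).fun_smul (hP k), pd_smul hG (differentiableAt_const c), pd_const]
  simp only [pd_smul (hK _) (hP _), hF.gauss_formula hx l, add_smul, smul_add,
    Finset.sum_add_distrib, Finset.sum_smul, Finset.smul_sum, smul_smul, smul_zero, zero_add]
  rw [Finset.sum_comm]
  abel

/-- Both equations express that ∂_l and ∂_i commute on ∂_jF: the tangential part is the flatness of
∇, the transversal part the symmetry of ∇G. -/
theorem flatness_codazzi (hF : IsLocalSphere Ω F c) (hx : x ∈ Ω) (l i j : Fin n) :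
    (∀ m, pd l (inducedChristoffel F (fun _ => c) m i j) x +
        ∑ k, inducedChristoffel F (fun _ => c) k i j x *
          inducedChristoffel F (fun _ => c) m l k x =
      pd i (inducedChristoffel F (fun _ => c) m l j) x +
        ∑ k, inducedChristoffel F (fun _ => c) k l j x *
          inducedChristoffel F (fun _ => c) m i k x) ∧
    pd l (fun y => fundForm F (fun _ => c) y i j) x +
        ∑ k, inducedChristoffel F (fun _ => c) k i j x * fundForm F (fun _ => c) x l k =
      pd i (fun y => fundForm F (fun _ => c) y l j) x +
        ∑ k, inducedChristoffel F (fun _ => c) k l j x * fundForm F (fun _ => c) x i k := by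
  have h := pd_comm (hF.smooth_pd j) hF.isOpen hx l i
  rw [hF.pd_gauss_formula hx, hF.pd_gauss_formula hx] at h
  exact frame_unique (X := fun _ => c) (hF.det_frame x hx) h


/-- The affine fundamental form is a pseudo-Riemannian metric if it is non-degenerate. -/
theorem isMetricOn (hF : IsLocalSphere Ω F c)
    (hd : ∀ x ∈ Ω, (fundForm F (fun _ => c) x).det ≠ 0) :
    IsMetricOn Ω (fundForm F (fun _ => c)) where
  isOpen := hF.isOpen
  symm _ hx := hF.fundForm_symm hx
  det_ne_zero := hd
  smooth := hF.smooth_fundForm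

theorem smooth_localCubic (hF : IsLocalSphere Ω F c)
    (hg : IsMetricOn Ω (fundForm F (fun _ => c))) (i j k : Fin n) :
    ContDiffOn ℝ ∞ (fun x => localCubic F (fun _ => c) x i j k) Ω := by
  unfold localCubic
  exact ContDiffOn.sum fun l _ => ((hF.smooth_inducedChristoffel l i j).sub
    (hg.smooth_christoffel l i j)).mul (hF.smooth_fundForm l k)

/-- The cubic is minus one half of the covariant derivative of the affine fundamental form. -/
theorem two_mul_localCubic (hF : IsLocalSphere Ω F c)
    (hg : IsMetricOn Ω (fundForm F (fun _ => c))) (hx : x ∈ Ω) (i j k : Fin n) :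
    2 * localCubic F (fun _ => c) x i j k =
      ∑ l, inducedChristoffel F (fun _ => c) l i j x * fundForm F (fun _ => c) x l k +
      ∑ l, inducedChristoffel F (fun _ => c) l i k x * fundForm F (fun _ => c) x j l -
      pd i (fun y => fundForm F (fun _ => c) y j k) x := by
  -- The Codazzi equation for two index choices replaces ∂_jG_{ik} and ∂_kG_{ij} in the Levi-Civita
  -- formula; the common term contracted with G in slot i cancels.
  have h := (hF.flatness_codazzi hx j i k).2
  have h' := (hF.flatness_codazzi hx k i j).2
  simp only [hF.fundForm_symm hx i] at h h'
  have e : ∀ k j, ∑ l, inducedChristoffel F (fun _ => c) l k j x *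
      fundForm F (fun _ => c) x l i = ∑ l, inducedChristoffel F (fun _ => c) l j k x *
      fundForm F (fun _ => c) x l i := fun k j => by
    simp only [hF.inducedChristoffel_symm hx _ k j]
  rw [e k j, hg.pd_symm hx i k j] at h'
  have e' : ∑ l, inducedChristoffel F (fun _ => c) l i j x * fundForm F (fun _ => c) x k l =
      ∑ l, inducedChristoffel F (fun _ => c) l i j x * fundForm F (fun _ => c) x l k := by
    simp only [hF.fundForm_symm hx k]
  rw [localCubic]
  simp only [sub_mul, Finset.sum_sub_distrib]
  rw [hg.sum_christoffel_mul hx, ← e']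
  linear_combination h' - h

theorem localCubic_symm_left (hF : IsLocalSphere Ω F c)
    (hg : IsMetricOn Ω (fundForm F (fun _ => c))) (hx : x ∈ Ω) (i j k : Fin n) :
    localCubic F (fun _ => c) x i j k = localCubic F (fun _ => c) x j i k := by
  simp only [localCubic, hF.inducedChristoffel_symm hx _ i j, hg.christoffel_symm hx _ i j]

/-- Symmetry in the first pair only expresses that both connections are torsion-free; here the
description of C as -½∇G is needed, which is visibly symmetric in j and k. -/
theorem localCubic_symm_right (hF : IsLocalSphere Ω F c)
    (hg : IsMetricOn Ω (fundForm F (fun _ => c))) (hx : x ∈ Ω) (i j k : Fin n) :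
    localCubic F (fun _ => c) x i j k = localCubic F (fun _ => c) x i k j := by
  have h := hF.two_mul_localCubic hg hx i j k
  have h' := hF.two_mul_localCubic hg hx i k j
  have e : ∀ a b, ∑ l, inducedChristoffel F (fun _ => c) l i a x *
      fundForm F (fun _ => c) x b l = ∑ l, inducedChristoffel F (fun _ => c) l i a x *
      fundForm F (fun _ => c) x l b := fun a b => by simp only [hF.fundForm_symm hx b]
  rw [e k j] at h
  rw [e j k, hg.pd_symm hx i k j] at h'
  linarith

/-- The difference tensor of the induced and the Levi-Civita connection. -/
def differenceTensor (F : EuclideanSpace ℝ (Fin n) → (Fin (n + 1) → ℝ)) (c : Fin (n + 1) → ℝ)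
    (l i j : Fin n) (x : EuclideanSpace ℝ (Fin n)) : ℝ :=
  inducedChristoffel F (fun _ => c) l i j x - christoffel (fundForm F (fun _ => c)) l i j x

/-- The covariant derivative of the difference tensor. -/
def covDifference (F : EuclideanSpace ℝ (Fin n) → (Fin (n + 1) → ℝ)) (c : Fin (n + 1) → ℝ)
    (i l j k : Fin n) (x : EuclideanSpace ℝ (Fin n)) : ℝ :=
  pd i (differenceTensor F c l j k) x + ∑ m,
    (christoffel (fundForm F (fun _ => c)) l i m x * differenceTensor F c m j k x -
      christoffel (fundForm F (fun _ => c)) m i j x * differenceTensor F c l m k x -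
      christoffel (fundForm F (fun _ => c)) m i k x * differenceTensor F c l j m x)

/-- Lowering an index commutes with ∇^G because the metric is parallel. -/
theorem cov3_localCubic (hF : IsLocalSphere Ω F c)
    (hg : IsMetricOn Ω (fundForm F (fun _ => c))) (hx : x ∈ Ω) (i j k p : Fin n) :
    cov3 (fundForm F (fun _ => c)) (localCubic F (fun _ => c)) i j k p x =
      ∑ l, covDifference F c i l j k x * fundForm F (fun _ => c) x l p := by
  have hD : ∀ l, DifferentiableAt ℝ (differenceTensor F c l j k) x := fun l =>
    differentiableAt_of_contDiffOn ((hF.smooth_inducedChristoffel l j k).sub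
      (hg.smooth_christoffel l j k)) hF.isOpen hx
  have h1 : pd i (fun y => localCubic F (fun _ => c) y j k p) x =
      ∑ l, (differenceTensor F c l j k x * ∑ m,
        (christoffel (fundForm F (fun _ => c)) m i l x * fundForm F (fun _ => c) x m p +
        christoffel (fundForm F (fun _ => c)) m i p x * fundForm F (fun _ => c) x l m) +
        pd i (differenceTensor F c l j k) x * fundForm F (fun _ => c) x l p) := by
    calc _ = pd i (fun y => ∑ l, differenceTensor F c l j k y *
          fundForm F (fun _ => c) y l p) x := rfl
      _ = _ := by
        rw [pd_sum fun l _ => (hD l).fun_mul (hg.differentiableAt hx l p)]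
        exact Finset.sum_congr rfl fun l _ => by
          rw [pd_mul (hD l) (hg.differentiableAt hx l p), hg.pd_metric hx]
  have h2 : ∀ a b d, localCubic F (fun _ => c) x a b d =
      ∑ l, differenceTensor F c l a b x * fundForm F (fun _ => c) x l d := fun _ _ _ => rfl
  rw [cov3, h1]
  simp only [h2, covDifference, add_mul, Finset.sum_mul, Finset.mul_sum, Finset.sum_add_distrib,
    mul_add, sub_mul, Finset.sum_sub_distrib]
  have e1 : ∑ l, ∑ m, differenceTensor F c l j k x *
      (christoffel (fundForm F (fun _ => c)) m i l x * fundForm F (fun _ => c) x m p) =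
      ∑ l, ∑ m, christoffel (fundForm F (fun _ => c)) l i m x * differenceTensor F c m j k x *
        fundForm F (fun _ => c) x l p := by
    rw [Finset.sum_comm]
    exact Finset.sum_congr rfl fun l _ => Finset.sum_congr rfl fun m _ => by ring
  have e2 : ∑ l, ∑ m, differenceTensor F c l j k x *
      (christoffel (fundForm F (fun _ => c)) m i p x * fundForm F (fun _ => c) x l m) =
      ∑ m, ∑ l, christoffel (fundForm F (fun _ => c)) m i p x *
        (differenceTensor F c l j k x * fundForm F (fun _ => c) x l m) := by
    rw [Finset.sum_comm]
    exact Finset.sum_congr rfl fun l _ => Finset.sum_congr rfl fun m _ => by ring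
  have e3 : ∑ l, ∑ m, christoffel (fundForm F (fun _ => c)) m i j x *
      differenceTensor F c l m k x * fundForm F (fun _ => c) x l p =
      ∑ m, ∑ l, christoffel (fundForm F (fun _ => c)) m i j x *
        (differenceTensor F c l m k x * fundForm F (fun _ => c) x l p) := by
    rw [Finset.sum_comm]
    exact Finset.sum_congr rfl fun l _ => Finset.sum_congr rfl fun m _ => by ring
  have e4 : ∑ l, ∑ m, christoffel (fundForm F (fun _ => c)) m i k x *
      differenceTensor F c l j m x * fundForm F (fun _ => c) x l p =
      ∑ m, ∑ l, christoffel (fundForm F (fun _ => c)) m i k x *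
        (differenceTensor F c l j m x * fundForm F (fun _ => c) x l p) := by
    rw [Finset.sum_comm]
    exact Finset.sum_congr rfl fun l _ => Finset.sum_congr rfl fun m _ => by ring
  rw [e1, e2, e3, e4]
  ring

/-- For ∇ = ∇^G + Ĉ, the curvature of ∇ is R^G plus the exterior covariant derivative of Ĉ plus its
commutator, and ∇ is flat. -/
theorem curvature_add_covDifference (hF : IsLocalSphere Ω F c)
    (hg : IsMetricOn Ω (fundForm F (fun _ => c))) (hx : x ∈ Ω) (l i j k : Fin n) :
    curvature (fundForm F (fun _ => c)) l i j k x +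
      (covDifference F c i l j k x - covDifference F c j l i k x) +
      ∑ m, (differenceTensor F c l i m x * differenceTensor F c m j k x -
        differenceTensor F c l j m x * differenceTensor F c m i k x) = 0 := by
  have hL : ∀ l i j, DifferentiableAt ℝ (christoffel (fundForm F (fun _ => c)) l i j) x :=
    fun l i j => differentiableAt_of_contDiffOn (hg.smooth_christoffel l i j) hF.isOpen hx
  have hK : ∀ l i j, DifferentiableAt ℝ (inducedChristoffel F (fun _ => c) l i j) x :=
    fun l i j => differentiableAt_of_contDiffOn (hF.smooth_inducedChristoffel l i j) hF.isOpen hx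
  have hp : ∀ i l j k, pd i (differenceTensor F c l j k) x =
      pd i (inducedChristoffel F (fun _ => c) l j k) x -
      pd i (christoffel (fundForm F (fun _ => c)) l j k) x := fun i l j k =>
    pd_sub (hK l j k) (hL l j k) i
  have hflat := (hF.flatness_codazzi hx i j k).1 l
  rw [curvature, covDifference, covDifference, hp, hp]
  -- Multiplying out ΓΓ for Γ = Γ^G + Ĉ; the terms with Γ^G in both lower slots i, j drop out
  -- because ∇^G is torsion-free.
  have key : ∑ m, (christoffel (fundForm F (fun _ => c)) l i m x *
        christoffel (fundForm F (fun _ => c)) m j k x -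
        christoffel (fundForm F (fun _ => c)) l j m x *
        christoffel (fundForm F (fun _ => c)) m i k x) +
      (∑ m, (christoffel (fundForm F (fun _ => c)) l i m x * differenceTensor F c m j k x -
      christoffel (fundForm F (fun _ => c)) m i j x * differenceTensor F c l m k x -
      christoffel (fundForm F (fun _ => c)) m i k x * differenceTensor F c l j m x) -
      ∑ m, (christoffel (fundForm F (fun _ => c)) l j m x * differenceTensor F c m i k x -
      christoffel (fundForm F (fun _ => c)) m j i x * differenceTensor F c l m k x -
      christoffel (fundForm F (fun _ => c)) m j k x * differenceTensor F c l i m x)) +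
      ∑ m, (differenceTensor F c l i m x * differenceTensor F c m j k x -
        differenceTensor F c l j m x * differenceTensor F c m i k x) =
      ∑ m, inducedChristoffel F (fun _ => c) m j k x * inducedChristoffel F (fun _ => c) l i m x -
      ∑ m, inducedChristoffel F (fun _ => c) m i k x *
        inducedChristoffel F (fun _ => c) l j m x := by
    simp only [← Finset.sum_sub_distrib, ← Finset.sum_add_distrib]
    refine Finset.sum_congr rfl fun m _ => ?_
    rw [hg.christoffel_symm hx m j i]
    simp only [differenceTensor]
    ring
  linear_combination hflat + key

/-- Total symmetry of C makes Ĉ_X self-adjoint, turning the lowered composition into a scalar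
product. -/
theorem sum_differenceTensor_mul (hF : IsLocalSphere Ω F c)
    (hg : IsMetricOn Ω (fundForm F (fun _ => c))) (hx : x ∈ Ω) (i j k p : Fin n) :
    ∑ l, (∑ m, differenceTensor F c l i m x * differenceTensor F c m j k x) *
      fundForm F (fun _ => c) x l p =
    dualInner (fundForm F (fun _ => c) x) (localCubic F (fun _ => c) x j k)
      (localCubic F (fun _ => c) x i p) := by
  have h2 : ∀ a b d, localCubic F (fun _ => c) x a b d =
      ∑ l, differenceTensor F c l a b x * fundForm F (fun _ => c) x l d := fun _ _ _ => rfl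
  have hup : ∀ m, ∑ b, (fundForm F (fun _ => c) x)⁻¹ b m * localCubic F (fun _ => c) x j k b =
      differenceTensor F c m j k x := fun m => by
    simp only [h2, Finset.mul_sum]
    rw [Finset.sum_comm]
    have e : ∀ l b, (fundForm F (fun _ => c) x)⁻¹ b m * (differenceTensor F c l j k x *
        fundForm F (fun _ => c) x l b) = differenceTensor F c l j k x *
        (fundForm F (fun _ => c) x l b * (fundForm F (fun _ => c) x)⁻¹ b m) :=
      fun l b => by ring
    simp only [e, ← Finset.mul_sum, sum_mul_inv (hg.det_ne_zero x hx)]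
    simp
  calc _ = ∑ m, differenceTensor F c m j k x * localCubic F (fun _ => c) x i m p := by
        simp only [h2, Finset.sum_mul, Finset.mul_sum]
        rw [Finset.sum_comm]
        exact Finset.sum_congr rfl fun m _ => Finset.sum_congr rfl fun l _ => by ring
    _ = _ := by
        simp only [← hup, Finset.sum_mul, dualInner]
        rw [Finset.sum_comm]
        exact Finset.sum_congr rfl fun m _ => Finset.sum_congr rfl fun l _ => by
          rw [hF.localCubic_symm_right hg hx i l p]

theorem gauss_equation (hF : IsLocalSphere Ω F c)
    (hg : IsMetricOn Ω (fundForm F (fun _ => c))) (hx : x ∈ Ω) (i j k p : Fin n) :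
    ∑ l, curvature (fundForm F (fun _ => c)) l i j k x * fundForm F (fun _ => c) x l p +
      (cov3 (fundForm F (fun _ => c)) (localCubic F (fun _ => c)) i j k p x -
        cov3 (fundForm F (fun _ => c)) (localCubic F (fun _ => c)) j i k p x) +
      (dualInner (fundForm F (fun _ => c) x) (localCubic F (fun _ => c) x j k)
        (localCubic F (fun _ => c) x i p) -
      dualInner (fundForm F (fun _ => c) x) (localCubic F (fun _ => c) x i k)
        (localCubic F (fun _ => c) x j p)) = 0 := by
  rw [hF.cov3_localCubic hg hx, hF.cov3_localCubic hg hx, ← hF.sum_differenceTensor_mul hg hx,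
    ← hF.sum_differenceTensor_mul hg hx]
  simp only [← Finset.sum_sub_distrib, ← Finset.sum_add_distrib, ← add_mul, ← sub_mul,
    hF.curvature_add_covDifference hg hx, zero_mul, Finset.sum_const_zero]

section ConstantCurvature
variable {κ : ℝ}

/-- Compare the Gauss equation with itself after exchanging k and p. Curvature and quadratic terms
change sign, the derivative terms do not, so each group vanishes on its own. -/
theorem gauss_codazzi_of_constantCurvature (hF : IsLocalSphere Ω F c)
    (hg : IsMetricOn Ω (fundForm F (fun _ => c))) (hx : x ∈ Ω)
    (hκ : ∀ l i j k, curvature (fundForm F (fun _ => c)) l i j k x =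
      κ * (fundForm F (fun _ => c) x j k * (if l = i then 1 else 0) -
        fundForm F (fun _ => c) x i k * (if l = j then 1 else 0))) (i j k p : Fin n) :
    κ * (fundForm F (fun _ => c) x j k * fundForm F (fun _ => c) x i p -
        fundForm F (fun _ => c) x i k * fundForm F (fun _ => c) x j p) +
      (dualInner (fundForm F (fun _ => c) x) (localCubic F (fun _ => c) x j k)
        (localCubic F (fun _ => c) x i p) -
      dualInner (fundForm F (fun _ => c) x) (localCubic F (fun _ => c) x i k)
        (localCubic F (fun _ => c) x j p)) = 0 ∧
    cov3 (fundForm F (fun _ => c)) (localCubic F (fun _ => c)) i j k p x =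
      cov3 (fundForm F (fun _ => c)) (localCubic F (fun _ => c)) j i k p x := by
  have hR : ∀ k p, ∑ l, curvature (fundForm F (fun _ => c)) l i j k x *
      fundForm F (fun _ => c) x l p = κ * (fundForm F (fun _ => c) x j k *
      fundForm F (fun _ => c) x i p -
        fundForm F (fun _ => c) x i k * fundForm F (fun _ => c) x j p) := fun k p => by
    have e : ∀ l, curvature (fundForm F (fun _ => c)) l i j k x *
      fundForm F (fun _ => c) x l p = (if l = i then κ * fundForm F (fun _ => c) x j k *
        fundForm F (fun _ => c) x l p else 0) - (if l = j then κ * fundForm F (fun _ => c) x i k *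
        fundForm F (fun _ => c) x l p else 0) := fun l => by
      rw [hκ]; split_ifs <;> ring
    simp only [e, Finset.sum_sub_distrib, Finset.sum_ite_eq', Finset.mem_univ, if_true]
    ring
  have h1 := hF.gauss_equation hg hx i j k p
  have h2 := hF.gauss_equation hg hx i j p k
  rw [hR] at h1 h2
  rw [hg.cov3_symm_right hx (fun y hy => hF.localCubic_symm_right hg hy) i j p k,
    hg.cov3_symm_right hx (fun y hy => hF.localCubic_symm_right hg hy) j i p k,
    dualInner_comm (hg.symm x hx) (localCubic F (fun _ => c) x j p),
    dualInner_comm (hg.symm x hx) (localCubic F (fun _ => c) x i p)] at h2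
  constructor <;> linarith

end ConstantCurvature

end IsLocalSphere
end AbundantGeometry

namespace AbundantGeometry

/-! ### Schouten and Cotton tensors in constant curvature -/

namespace IsMetricOn
variable {n : ℕ} {Ω : Set (EuclideanSpace ℝ (Fin n))}
  {g : EuclideanSpace ℝ (Fin n) → Matrix (Fin n) (Fin n) ℝ} {x : EuclideanSpace ℝ (Fin n)} {κ : ℝ}

/-- The Ricci tensor is κ(n-1)g and the scalar curvature κn(n-1). -/
theorem schouten_of_constantCurvature (hg : IsMetricOn Ω g) (hn : 3 ≤ n) (hx : x ∈ Ω)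
    (hκ : ∀ l i j k, curvature g l i j k x =
      κ * (g x j k * (if l = i then 1 else 0) - g x i k * (if l = j then 1 else 0)))
    (i j : Fin n) : schouten g x i j = κ / 2 * g x i j := by
  have hn' : (3 : ℝ) ≤ n := by exact_mod_cast hn
  have n2 : (n : ℝ) - 2 ≠ 0 := by linarith
  have n1 : (n : ℝ) - 1 ≠ 0 := by linarith
  have hR : ∀ j k, ricci g j k x = (κ * ((n : ℝ) - 1)) * g x j k := fun j k => by
    have e : ∀ i, curvature g i i j k x = κ * g x j k - if i = j then κ * g x i k else 0 :=
      fun i => by rw [hκ, if_pos rfl]; split_ifs <;> ring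
    simp only [ricci, e, Finset.sum_sub_distrib, Finset.sum_ite_eq', Finset.mem_univ, if_true,
      Finset.sum_const, Finset.card_univ, Fintype.card_fin, nsmul_eq_mul]
    ring
  simp only [schouten, hR]
  rw [tr2_const_mul_metric (hg.symm x hx) (hg.det_ne_zero x hx)]
  field_simp
  ring

/-- A constant multiple of the metric is parallel; applied to the Schouten tensor, this makes the
Cotton tensor vanish. -/
theorem cov2_eq_zero_of_eq_metric (hg : IsMetricOn Ω g) (hx : x ∈ Ω)
    {B : EuclideanSpace ℝ (Fin n) → Fin n → Fin n → ℝ} {c : ℝ}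
    (hB : ∀ y ∈ Ω, ∀ i j, B y i j = c * g y i j) (i j k : Fin n) : cov2 g B i j k x = 0 := by
  rw [cov2, pd_congr hg.isOpen hx fun y hy => hB y hy j k,
    pd_const_mul c (hg.differentiableAt hx j k), hg.pd_metric hx, Finset.mul_sum,
    ← Finset.sum_sub_distrib]
  refine Finset.sum_eq_zero fun a _ => ?_
  rw [hB x hx, hB x hx]; ring

end IsMetricOn

/-! ### Splitting a cubic into trace and trace-free part -/

section TraceParts
variable {n : ℕ}

/-- The trace form of a cubic. -/
def cubicTrace (g : Matrix (Fin n) (Fin n) ℝ) (C : Fin n → Fin n → Fin n → ℝ) (i : Fin n) : ℝ :=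
  1 / ((n : ℝ) + 2) * tr2 g (C i)

/-- The trace-free part of a cubic. -/
def cubicTracefree (g : Matrix (Fin n) (Fin n) ℝ) (C : Fin n → Fin n → Fin n → ℝ)
    (i j k : Fin n) : ℝ :=
  C i j k - cubicTrace g C i * g j k - cubicTrace g C j * g i k - cubicTrace g C k * g i j

variable {g : Matrix (Fin n) (Fin n) ℝ} {C : Fin n → Fin n → Fin n → ℝ}

theorem cubicOf_tracefree : cubicOf g (cubicTracefree g C) (cubicTrace g C) = C := by
  funext i j k
  simp only [cubicOf, cubicTracefree]; ring

theorem cubicTracefree_symm_left (hs : ∀ i j, g i j = g j i)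
    (hC : ∀ i j k, C i j k = C j i k) (i j k : Fin n) :
    cubicTracefree g C i j k = cubicTracefree g C j i k := by
  rw [cubicTracefree, cubicTracefree, hC, hs i j]; ring

theorem cubicTracefree_symm_right (hs : ∀ i j, g i j = g j i)
    (hC : ∀ i j k, C i j k = C i k j) (i j k : Fin n) :
    cubicTracefree g C i j k = cubicTracefree g C i k j := by
  rw [cubicTracefree, cubicTracefree, hC, hs j k]; ring

/-- The three terms of u⊙g have traces u, u and nu, which is why u is normalised by n+2. -/
theorem tr2_cubicTracefree (hs : ∀ i j, g i j = g j i) (hd : g.det ≠ 0)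
    (hC : ∀ i j k, C i j k = C j i k) (hC' : ∀ i j k, C i j k = C i k j) (k : Fin n) :
    tr2 g (fun i j => cubicTracefree g C i j k) = 0 := by
  have hn : (n : ℝ) + 2 ≠ 0 := by positivity
  have e1 : tr2 g (fun i j => C i j k) = ((n : ℝ) + 2) * cubicTrace g C k := by
    have : (fun i j => C i j k) = C k := by funext i j; rw [hC' i j k, hC i k j]
    rw [this, cubicTrace]; field_simp
  have e2 : tr2 g (fun i j => cubicTrace g C i * g j k) = cubicTrace g C k := by
    simp only [hs _ k]
    rw [tr2_mul, dualInner_metric_right hs hd]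
  have e3 : tr2 g (fun i j => cubicTrace g C j * g i k) = cubicTrace g C k := by
    rw [← e2, ← tr2_swap hs]
  simp only [cubicTracefree, tr2_sub, e1, e2, e3, tr2_const_mul_metric hs hd]
  ring

end TraceParts

/-! ### The tensors u and U in coordinates and the derivative of U -/

namespace IsLocalSphere
variable {n : ℕ} {Ω : Set (EuclideanSpace ℝ (Fin n))}
  {F : EuclideanSpace ℝ (Fin n) → (Fin (n + 1) → ℝ)} {c : Fin (n + 1) → ℝ}
  {x : EuclideanSpace ℝ (Fin n)}

/-- The 1-form `u` in coordinates. -/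
def localTrace (F : EuclideanSpace ℝ (Fin n) → (Fin (n + 1) → ℝ)) (c : Fin (n + 1) → ℝ)
    (x : EuclideanSpace ℝ (Fin n)) : Fin n → ℝ :=
  cubicTrace (fundForm F (fun _ => c) x) (localCubic F (fun _ => c) x)

/-- The trace-free cubic `U` in coordinates. -/
def localTracefree (F : EuclideanSpace ℝ (Fin n) → (Fin (n + 1) → ℝ)) (c : Fin (n + 1) → ℝ)
    (x : EuclideanSpace ℝ (Fin n)) : Fin n → Fin n → Fin n → ℝ :=
  cubicTracefree (fundForm F (fun _ => c) x) (localCubic F (fun _ => c) x)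

theorem smooth_localTrace (hF : IsLocalSphere Ω F c)
    (hg : IsMetricOn Ω (fundForm F (fun _ => c))) (i : Fin n) :
    ContDiffOn ℝ ∞ (fun x => localTrace F c x i) Ω := by
  unfold localTrace cubicTrace tr2
  exact contDiffOn_const.mul (ContDiffOn.sum fun a _ => ContDiffOn.sum fun b _ =>
    (hg.smooth_inv a b).mul (hF.smooth_localCubic hg i a b))

theorem smooth_localTracefree (hF : IsLocalSphere Ω F c)
    (hg : IsMetricOn Ω (fundForm F (fun _ => c))) (i j k : Fin n) :
    ContDiffOn ℝ ∞ (fun x => localTracefree F c x i j k) Ω :=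
  (((hF.smooth_localCubic hg i j k).sub ((hF.smooth_localTrace hg i).mul (hg.smooth j k))).sub
    ((hF.smooth_localTrace hg j).mul (hg.smooth i k))).sub
    ((hF.smooth_localTrace hg k).mul (hg.smooth i j))

section ConstantCurvature
variable {κ : ℝ}

theorem gauss_cubicOf (hF : IsLocalSphere Ω F c)
    (hg : IsMetricOn Ω (fundForm F (fun _ => c))) (hx : x ∈ Ω)
    (hκ : ∀ l i j k, curvature (fundForm F (fun _ => c)) l i j k x =
      κ * (fundForm F (fun _ => c) x j k * (if l = i then 1 else 0) -
        fundForm F (fun _ => c) x i k * (if l = j then 1 else 0))) (i j k p : Fin n) :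
    κ * (fundForm F (fun _ => c) x j k * fundForm F (fun _ => c) x i p -
      fundForm F (fun _ => c) x i k * fundForm F (fun _ => c) x j p) +
      (dualInner (fundForm F (fun _ => c) x)
        (cubicOf (fundForm F (fun _ => c) x) (localTracefree F c x) (localTrace F c x) j k)
        (cubicOf (fundForm F (fun _ => c) x) (localTracefree F c x) (localTrace F c x) i p) -
      dualInner (fundForm F (fun _ => c) x)
        (cubicOf (fundForm F (fun _ => c) x) (localTracefree F c x) (localTrace F c x) i k)
        (cubicOf (fundForm F (fun _ => c) x) (localTracefree F c x) (localTrace F c x) j p)) =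
      0 := by
  simp only [localTracefree, localTrace, cubicOf_tracefree]
  exact (hF.gauss_codazzi_of_constantCurvature hg hx hκ i j k p).1

theorem localTracefree_symm_left (hF : IsLocalSphere Ω F c)
    (hg : IsMetricOn Ω (fundForm F (fun _ => c))) (hx : x ∈ Ω) (i j k : Fin n) :
    localTracefree F c x i j k = localTracefree F c x j i k :=
  cubicTracefree_symm_left (hg.symm x hx) (hF.localCubic_symm_left hg hx) i j k

theorem localTracefree_symm_right (hF : IsLocalSphere Ω F c)
    (hg : IsMetricOn Ω (fundForm F (fun _ => c))) (hx : x ∈ Ω) (i j k : Fin n) :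
    localTracefree F c x i j k = localTracefree F c x i k j :=
  cubicTracefree_symm_right (hg.symm x hx) (hF.localCubic_symm_right hg hx) i j k

theorem tr2_localTracefree (hF : IsLocalSphere Ω F c)
    (hg : IsMetricOn Ω (fundForm F (fun _ => c))) (hx : x ∈ Ω) (k : Fin n) :
    tr2 (fundForm F (fun _ => c) x) (fun i j => localTracefree F c x i j k) = 0 :=
  tr2_cubicTracefree (hg.symm x hx) (hg.det_ne_zero x hx) (hF.localCubic_symm_left hg hx)
    (hF.localCubic_symm_right hg hx) k

/-- The derivative of the trace-free cubic of an abundant improper relative sphere. -/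
theorem cov3_localTracefree (hF : IsLocalSphere Ω F c)
    (hg : IsMetricOn Ω (fundForm F (fun _ => c))) (hn : 3 ≤ n) (hx : x ∈ Ω)
    (hκ : ∀ l i j k, curvature (fundForm F (fun _ => c)) l i j k x =
      κ * (fundForm F (fun _ => c) x j k * (if l = i then 1 else 0) -
        fundForm F (fun _ => c) x i k * (if l = j then 1 else 0)))
    (hU : ∀ i j k l, projSymZeroFour (fundForm F (fun _ => c) x)
      (fun i j k l => cov3 (fundForm F (fun _ => c)) (localTracefree F c) i j k l x) i j k l =
      projSymZeroFour (fundForm F (fun _ => c) x)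
        (fun i j k l => compTwo (fundForm F (fun _ => c) x) (localTracefree F c x) i j l k +
          4 * (localTracefree F c x i j k * localTrace F c x l)) i j k l)
    {m : ℝ} (hu : ∀ i j, cov1 (fundForm F (fun _ => c)) (localTrace F c) i j x =
      localTrace F c x i * localTrace F c x j + 1 / ((n : ℝ) - 2) *
        traceSq (fundForm F (fun _ => c) x) (localTracefree F c x) i j +
      m * fundForm F (fun _ => c) x i j) (i j k l : Fin n) :
    cov3 (fundForm F (fun _ => c)) (localTracefree F c) l i j k x =
      1 / 9 * projSymZeroThree (fundForm F (fun _ => c) x) (sOne (fundForm F (fun _ => c) x)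
        (fun i j k => 3 * localTracefree F c x i j k) (fun i => 3 * localTrace F c x i))
        i j k l := by
  have hn' : (3 : ℝ) ≤ n := by exact_mod_cast hn
  have n2 : (n : ℝ) - 2 ≠ 0 := by linarith
  have n2' : (n : ℝ) + 2 ≠ 0 := by linarith
  have hs := hg.symm x hx
  have hd := hg.det_ne_zero x hx
  have hUl := hF.localTracefree_symm_left hg hx
  have hUr := hF.localTracefree_symm_right hg hx
  have htr := hF.tr2_localTracefree hg hx
  have hC := hF.gauss_cubicOf hg hx hκ
  have hT := traceSq_eq hs hd hUl hUr htr hC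
  have hDU : ∀ i j k l, cov3 (fundForm F (fun _ => c)) (localTracefree F c) i j k l x =
      cov3 (fundForm F (fun _ => c)) (localCubic F (fun _ => c)) i j k l x -
      cov1 (fundForm F (fun _ => c)) (localTrace F c) i j x * fundForm F (fun _ => c) x k l -
      cov1 (fundForm F (fun _ => c)) (localTrace F c) i k x * fundForm F (fun _ => c) x j l -
      cov1 (fundForm F (fun _ => c)) (localTrace F c) i l x * fundForm F (fun _ => c) x j k :=
    fun i j k l => hg.cov3_tracefree hx (hF.smooth_localCubic hg) (hF.smooth_localTrace hg) i j k l
  -- Substituting the contracted Gauss equation for 𝒰: the factor n-2 cancels, so ∇u = u⊗u + W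
  -- modulo G.
  have hu' : ∀ i j, cov1 (fundForm F (fun _ => c)) (localTrace F c) i j x =
      localTrace F c x i * localTrace F c x j + contractAddSq (fundForm F (fun _ => c) x)
        (localTracefree F c x) (localTrace F c x) i j +
      (m + 1 / ((n : ℝ) - 2) * (dualInner (fundForm F (fun _ => c) x) (localTrace F c x)
        (localTrace F c x) + (κ + dualInner (fundForm F (fun _ => c) x) (localTrace F c x)
        (localTrace F c x)) * ((n : ℝ) - 1))) * fundForm F (fun _ => c) x i j := fun i j => by
    rw [hu, hT]
    field_simp
    ring
  have hA : ∀ i j k l, cov3 (fundForm F (fun _ => c)) (localCubic F (fun _ => c)) i j k l x =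
      cov3 (fundForm F (fun _ => c)) (localCubic F (fun _ => c)) j i k l x := fun i j k l =>
    (hF.gauss_codazzi_of_constantCurvature hg hx hκ i j k l).2
  have hA' := hg.cov3_symm_left hx (fun y hy => hF.localCubic_symm_left hg hy)
  have hA'' := hg.cov3_symm_right hx (fun y hy => hF.localCubic_symm_right hg hy)
  -- Total symmetry of ∇C moves the contraction onto the last two slots, where it commutes with ∇
  -- and produces the trace form.
  have htrA : ∀ k l, tr2 (fundForm F (fun _ => c) x)
      (fun a b => cov3 (fundForm F (fun _ => c)) (localCubic F (fun _ => c)) a b k l x) =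
      ((n : ℝ) + 2) * cov1 (fundForm F (fun _ => c)) (localTrace F c) k l x := fun k l => by
    have e : (fun a b => cov3 (fundForm F (fun _ => c)) (localCubic F (fun _ => c)) a b k l x) =
        fun a b => cov3 (fundForm F (fun _ => c)) (localCubic F (fun _ => c)) k l a b x := by
      funext a b
      rw [hA' a b k l, hA a k b l, hA'' k a b l, hA' k a l b]
    rw [e, ← hg.cov1_trace hx (hF.smooth_localCubic hg) k l]
    have h1 : localTrace F c = fun y i => 1 / ((n : ℝ) + 2) *
        tr2 (fundForm F (fun _ => c) y) (localCubic F (fun _ => c) y i) := rfl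
    rw [h1, hg.cov1_const_mul hx _ (v := fun y i => tr2 (fundForm F (fun _ => c) y)
      (localCubic F (fun _ => c) y i)) (fun i => ?_)]
    · field_simp
    · unfold tr2
      exact ContDiffOn.sum fun a _ => ContDiffOn.sum fun b _ =>
        (hg.smooth_inv a b).mul (hF.smooth_localCubic hg i a b)
  rw [hDU]
  refine derivative_eq_projSymZeroThree hn hs hd hUl hUr htr hA hA' hA'' (fun i j => ?_) htrA
    (fun i j k l => ?_) hu' hT i j k l
  · rw [hu', hu', contractAddSq_symm hUl i j, hs i j]; ring
  · have := hU i j k l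
    simp only [hDU] at this
    exact this

end ConstantCurvature
end IsLocalSphere
end AbundantGeometry

namespace AbundantGeometry

/-! ### Transformation laws of the fundamental form and the cubic -/

section ChangeOfCoordinates
open Topology
variable {n : ℕ}

theorem sum_smul_single (v : EuclideanSpace ℝ (Fin n)) :
    v = ∑ a, v a • EuclideanSpace.single a (1 : ℝ) := by
  ext b
  simp [Pi.single_apply]

/-- The Jacobian matrix `∂_i θ^a` of a map between coordinate domains. -/
def jacobian (θ : EuclideanSpace ℝ (Fin n) → EuclideanSpace ℝ (Fin n)) (a i : Fin n)
    (x : EuclideanSpace ℝ (Fin n)) : ℝ :=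
  pd i (fun y => θ y a) x

theorem fderiv_apply_eq_jacobian {θ : EuclideanSpace ℝ (Fin n) → EuclideanSpace ℝ (Fin n)}
    {x : EuclideanSpace ℝ (Fin n)} (hθ : DifferentiableAt ℝ θ x) (a i : Fin n) :
    (fderiv ℝ θ x (EuclideanSpace.single i (1 : ℝ))) a = jacobian θ a i x := by
  have h := ((EuclideanSpace.proj a : EuclideanSpace ℝ (Fin n) →L[ℝ] ℝ).hasFDerivAt.comp x
    hθ.hasFDerivAt).fderiv
  have h2 : (EuclideanSpace.proj a : EuclideanSpace ℝ (Fin n) →L[ℝ] ℝ) ∘ θ = fun y => θ y a := rfl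
  rw [h2] at h
  rw [jacobian, pd, h]
  rfl

theorem pd_comp {V : Type*} [NormedAddCommGroup V] [NormedSpace ℝ V]
    {θ : EuclideanSpace ℝ (Fin n) → EuclideanSpace ℝ (Fin n)}
    {H : EuclideanSpace ℝ (Fin n) → V}
    {x : EuclideanSpace ℝ (Fin n)} (hθ : DifferentiableAt ℝ θ x)
    (hH : DifferentiableAt ℝ H (θ x)) (i : Fin n) :
    pd i (fun y => H (θ y)) x = ∑ a, jacobian θ a i x • pd a H (θ x) := by
  have h := fderiv_comp x hH hθ
  have h2 : pd i (fun y => H (θ y)) x =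
      fderiv ℝ H (θ x) (fderiv ℝ θ x (EuclideanSpace.single i (1 : ℝ))) := by
    rw [pd]; exact congrArg (fun L => L (EuclideanSpace.single i (1 : ℝ))) h
  rw [h2, sum_smul_single (fderiv ℝ θ x (EuclideanSpace.single i (1 : ℝ)))]
  simp only [map_sum, map_smul, fderiv_apply_eq_jacobian hθ]
  rfl

/-- `F` is the coordinate expression `F' ∘ θ` of the hypersurface `F'` after the smooth
change of coordinates `θ`. -/
structure IsChange (Ω Ω' : Set (EuclideanSpace ℝ (Fin n)))
    (θ : EuclideanSpace ℝ (Fin n) → EuclideanSpace ℝ (Fin n))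
    (F F' : EuclideanSpace ℝ (Fin n) → (Fin (n + 1) → ℝ)) (c : Fin (n + 1) → ℝ) : Prop where
  source : IsLocalSphere Ω F c
  target : IsLocalSphere Ω' F' c
  smooth : ContDiffOn ℝ ∞ θ Ω
  maps : ∀ x ∈ Ω, θ x ∈ Ω'
  comp : ∀ x ∈ Ω, F x = F' (θ x)

namespace IsChange
variable {Ω Ω' : Set (EuclideanSpace ℝ (Fin n))}
  {θ : EuclideanSpace ℝ (Fin n) → EuclideanSpace ℝ (Fin n)}
  {F F' : EuclideanSpace ℝ (Fin n) → (Fin (n + 1) → ℝ)} {c : Fin (n + 1) → ℝ}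
  {x : EuclideanSpace ℝ (Fin n)}

theorem differentiableAt (h : IsChange Ω Ω' θ F F' c) (hx : x ∈ Ω) : DifferentiableAt ℝ θ x :=
  differentiableAt_of_contDiffOn h.smooth h.source.isOpen hx

theorem smooth_jacobian (h : IsChange Ω Ω' θ F F' c) (a i : Fin n) :
    ContDiffOn ℝ ∞ (jacobian θ a i) Ω :=
  contDiffOn_pd ((EuclideanSpace.proj a : EuclideanSpace ℝ (Fin n) →L[ℝ] ℝ).contDiff.comp_contDiffOn
    h.smooth) h.source.isOpen i

theorem pd_eq (h : IsChange Ω Ω' θ F F' c) (hx : x ∈ Ω) (i : Fin n) :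
    pd i F x = ∑ a, jacobian θ a i x • pd a F' (θ x) := by
  rw [pd_congr h.source.isOpen hx h.comp]
  exact pd_comp (h.differentiableAt hx)
    (differentiableAt_of_contDiffOn h.target.smooth h.target.isOpen (h.maps x hx)) i

/-- Expand ∂_i∂_j(F'∘θ) by the chain rule and compare frame coefficients. The second derivatives of
θ multiply tangent vectors only, so G is tensorial while the induced Christoffel symbols acquire an
inhomogeneous term. -/
theorem transformation (h : IsChange Ω Ω' θ F F' c) (hx : x ∈ Ω) (i j : Fin n) :
    (∀ a, ∑ k, inducedChristoffel F (fun _ => c) k i j x * jacobian θ a k x =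
      pd i (jacobian θ a j) x + ∑ d, ∑ b, jacobian θ b i x * jacobian θ d j x *
        inducedChristoffel F' (fun _ => c) a b d (θ x)) ∧
    fundForm F (fun _ => c) x i j = ∑ d, ∑ b, jacobian θ b i x * jacobian θ d j x *
      fundForm F' (fun _ => c) (θ x) b d := by
  have hJ : ∀ a, DifferentiableAt ℝ (jacobian θ a j) x := fun a =>
    differentiableAt_of_contDiffOn (h.smooth_jacobian a j) h.source.isOpen hx
  have hP : ∀ a, DifferentiableAt ℝ (pd a F') (θ x) := fun a =>
    differentiableAt_of_contDiffOn (h.target.smooth_pd a) h.target.isOpen (h.maps x hx)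
  have hPc : ∀ a, DifferentiableAt ℝ (fun y => pd a F' (θ y)) x := fun a =>
    (hP a).comp x (h.differentiableAt hx)
  have h1 : pd i (pd j F) x = ∑ a, (jacobian θ a j x • ∑ b, jacobian θ b i x •
      pd b (pd a F') (θ x) + pd i (jacobian θ a j) x • pd a F' (θ x)) := by
    rw [pd_congr h.source.isOpen hx fun y hy => h.pd_eq hy j,
      pd_sum fun a _ => (hJ a).fun_smul (hPc a)]
    refine Finset.sum_congr rfl fun a _ => ?_
    rw [pd_smul (hJ a) (hPc a), pd_comp (h.differentiableAt hx) (hP a)]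
  rw [h.source.gauss_formula hx] at h1
  simp only [h.pd_eq hx, h.target.gauss_formula (h.maps x hx)] at h1
  have h2 : ∑ a, (∑ k, inducedChristoffel F (fun _ => c) k i j x * jacobian θ a k x) •
      pd a F' (θ x) + fundForm F (fun _ => c) x i j • c =
      ∑ a, (pd i (jacobian θ a j) x + ∑ d, ∑ b, jacobian θ b i x * jacobian θ d j x *
        inducedChristoffel F' (fun _ => c) a b d (θ x)) • pd a F' (θ x) +
      (∑ d, ∑ b, jacobian θ b i x * jacobian θ d j x *
        fundForm F' (fun _ => c) (θ x) b d) • c := by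
    have e1 : ∑ a, (∑ k, inducedChristoffel F (fun _ => c) k i j x * jacobian θ a k x) •
      pd a F' (θ x) = ∑ k, inducedChristoffel F (fun _ => c) k i j x •
        ∑ a, jacobian θ a k x • pd a F' (θ x) := by
      simp only [Finset.sum_smul, Finset.smul_sum, smul_smul]
      exact Finset.sum_comm
    rw [e1, h1]
    simp only [Finset.sum_add_distrib, smul_add, Finset.smul_sum, add_smul, Finset.sum_smul,
      smul_smul]
    have e2 : ∑ a, ∑ d, ∑ b, (jacobian θ b i x * jacobian θ d j x *
        inducedChristoffel F' (fun _ => c) a b d (θ x)) • pd a F' (θ x) =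
        ∑ d, ∑ b, ∑ a, (jacobian θ d j x * (jacobian θ b i x *
        inducedChristoffel F' (fun _ => c) a b d (θ x))) • pd a F' (θ x) := by
      rw [Finset.sum_comm]
      refine Finset.sum_congr rfl fun d _ => ?_
      rw [Finset.sum_comm]
      exact Finset.sum_congr rfl fun b _ => Finset.sum_congr rfl fun a _ => by
        congr 1; ring
    have e3 : ∑ d, ∑ b, (jacobian θ b i x * jacobian θ d j x *
        fundForm F' (fun _ => c) (θ x) b d) • c = ∑ d, ∑ b, (jacobian θ d j x *
        (jacobian θ b i x * fundForm F' (fun _ => c) (θ x) b d)) • c :=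
      Finset.sum_congr rfl fun d _ => Finset.sum_congr rfl fun b _ => by congr 1; ring
    rw [e2, e3]
    abel
  exact frame_unique (X := fun _ => c) (h.target.det_frame _ (h.maps x hx)) h2

theorem fundForm_eq (h : IsChange Ω Ω' θ F F' c) (hx : x ∈ Ω) (i j : Fin n) :
    fundForm F (fun _ => c) x i j = ∑ a, ∑ b, jacobian θ a i x * jacobian θ b j x *
      fundForm F' (fun _ => c) (θ x) a b := by
  rw [(h.transformation hx i j).2, Finset.sum_comm]

theorem sum_inducedChristoffel_mul (h : IsChange Ω Ω' θ F F' c) (hx : x ∈ Ω) (i j k : Fin n) :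
    ∑ l, inducedChristoffel F (fun _ => c) l i j x * fundForm F (fun _ => c) x l k =
      ∑ a, ∑ b, pd i (jacobian θ a j) x * jacobian θ b k x *
        fundForm F' (fun _ => c) (θ x) a b +
      ∑ e, ∑ a, ∑ b, jacobian θ e i x * jacobian θ a j x * jacobian θ b k x *
        ∑ d, inducedChristoffel F' (fun _ => c) d e a (θ x) *
          fundForm F' (fun _ => c) (θ x) d b := by
  have h1 : ∑ l, inducedChristoffel F (fun _ => c) l i j x * fundForm F (fun _ => c) x l k =
      ∑ a, ∑ b, (∑ l, inducedChristoffel F (fun _ => c) l i j x * jacobian θ a l x) *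
        (jacobian θ b k x * fundForm F' (fun _ => c) (θ x) a b) := by
    simp only [h.fundForm_eq hx, Finset.mul_sum, Finset.sum_mul]
    rw [Finset.sum_comm]
    refine Finset.sum_congr rfl fun a _ => ?_
    rw [Finset.sum_comm]
    exact Finset.sum_congr rfl fun b _ => Finset.sum_congr rfl fun l _ => by ring
  rw [h1]
  simp only [(h.transformation hx i j).1, add_mul, Finset.sum_add_distrib]
  congr 1
  · exact Finset.sum_congr rfl fun a _ => Finset.sum_congr rfl fun b _ => by ring
  · simp only [Finset.sum_mul, Finset.mul_sum]
    rw [sum_comm_four]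
    rw [Finset.sum_comm]
    refine Finset.sum_congr rfl fun e _ => Finset.sum_congr rfl fun a _ => ?_
    rw [Finset.sum_comm]
    exact Finset.sum_congr rfl fun b _ => Finset.sum_congr rfl fun d _ => by ring

theorem pd_fundForm (h : IsChange Ω Ω' θ F F' c) (hx : x ∈ Ω) (i j k : Fin n) :
    pd i (fun y => fundForm F (fun _ => c) y j k) x =
      ∑ a, ∑ b, pd i (jacobian θ a j) x * jacobian θ b k x *
        fundForm F' (fun _ => c) (θ x) a b +
      ∑ a, ∑ b, jacobian θ a j x * pd i (jacobian θ b k) x *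
        fundForm F' (fun _ => c) (θ x) a b +
      ∑ e, ∑ a, ∑ b, jacobian θ e i x * jacobian θ a j x * jacobian θ b k x *
        pd e (fun y => fundForm F' (fun _ => c) y a b) (θ x) := by
  have hJ : ∀ a j, DifferentiableAt ℝ (jacobian θ a j) x := fun a j =>
    differentiableAt_of_contDiffOn (h.smooth_jacobian a j) h.source.isOpen hx
  have hG : ∀ a b, DifferentiableAt ℝ (fun y => fundForm F' (fun _ => c) y a b) (θ x) :=
    fun a b => differentiableAt_of_contDiffOn (h.target.smooth_fundForm a b) h.target.isOpen
      (h.maps x hx)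
  have hGc : ∀ a b, DifferentiableAt ℝ (fun y => fundForm F' (fun _ => c) (θ y) a b) x :=
    fun a b => (hG a b).comp x (h.differentiableAt hx)
  have hterm : ∀ a b, pd i (fun y => jacobian θ a j y * jacobian θ b k y *
      fundForm F' (fun _ => c) (θ y) a b) x =
      pd i (jacobian θ a j) x * jacobian θ b k x * fundForm F' (fun _ => c) (θ x) a b +
      jacobian θ a j x * pd i (jacobian θ b k) x * fundForm F' (fun _ => c) (θ x) a b +
      ∑ e, jacobian θ e i x * jacobian θ a j x * jacobian θ b k x *
        pd e (fun y => fundForm F' (fun _ => c) y a b) (θ x) := fun a b => by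
    rw [pd_mul ((hJ a j).fun_mul (hJ b k)) (hGc a b), pd_mul (hJ a j) (hJ b k),
      pd_comp (h.differentiableAt hx) (hG a b), Finset.mul_sum]
    have : ∑ e, jacobian θ a j x * jacobian θ b k x * (jacobian θ e i x •
        pd e (fun y => fundForm F' (fun _ => c) y a b) (θ x)) =
        ∑ e, jacobian θ e i x * jacobian θ a j x * jacobian θ b k x *
        pd e (fun y => fundForm F' (fun _ => c) y a b) (θ x) :=
      Finset.sum_congr rfl fun e _ => by rw [smul_eq_mul]; ring
    rw [this]; ring
  rw [pd_congr h.source.isOpen hx fun y hy => h.fundForm_eq hy j k,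
    pd_sum fun a _ => DifferentiableAt.fun_sum fun b _ =>
      ((hJ a j).fun_mul (hJ b k)).fun_mul (hGc a b)]
  have : ∀ a, pd i (fun y => ∑ b, jacobian θ a j y * jacobian θ b k y *
      fundForm F' (fun _ => c) (θ y) a b) x = ∑ b, pd i (fun y => jacobian θ a j y *
      jacobian θ b k y * fundForm F' (fun _ => c) (θ y) a b) x := fun a =>
    pd_sum (fun b _ => ((hJ a j).fun_mul (hJ b k)).fun_mul (hGc a b)) i
  simp only [this, hterm, Finset.sum_add_distrib]
  congr 1
  calc _ = ∑ a, ∑ e, ∑ b, jacobian θ e i x * jacobian θ a j x * jacobian θ b k x *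
        pd e (fun y => fundForm F' (fun _ => c) y a b) (θ x) :=
        Finset.sum_congr rfl fun _ _ => Finset.sum_comm
    _ = _ := Finset.sum_comm

/-- The cubic is a tensor. -/
theorem localCubic_eq (h : IsChange Ω Ω' θ F F' c)
    (hg : IsMetricOn Ω (fundForm F (fun _ => c))) (hg' : IsMetricOn Ω' (fundForm F' (fun _ => c)))
    (hx : x ∈ Ω) (i j k : Fin n) :
    localCubic F (fun _ => c) x i j k = ∑ e, ∑ a, ∑ b,
      jacobian θ e i x * jacobian θ a j x * jacobian θ b k x *
        localCubic F' (fun _ => c) (θ x) e a b := by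
  -- Working with 2C = -∇G avoids the transformation law of the Levi-Civita symbols: second
  -- derivatives of θ enter only through the induced connection and ∂G.
  have h2 := h.source.two_mul_localCubic hg hx i j k
  have e1 : ∑ l, inducedChristoffel F (fun _ => c) l i k x * fundForm F (fun _ => c) x j l =
      ∑ l, inducedChristoffel F (fun _ => c) l i k x * fundForm F (fun _ => c) x l j := by
    simp only [h.source.fundForm_symm hx j]
  rw [e1, h.sum_inducedChristoffel_mul hx, h.sum_inducedChristoffel_mul hx,
    h.pd_fundForm hx] at h2
  -- By symmetry of G this inhomogeneous term is one of the two produced by ∂G, so they cancel.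
  have e2 : ∑ a, ∑ b, pd i (jacobian θ a k) x * jacobian θ b j x *
        fundForm F' (fun _ => c) (θ x) a b = ∑ a, ∑ b, jacobian θ a j x *
        pd i (jacobian θ b k) x * fundForm F' (fun _ => c) (θ x) a b := by
    rw [Finset.sum_comm]
    exact Finset.sum_congr rfl fun a _ => Finset.sum_congr rfl fun b _ => by
      rw [h.target.fundForm_symm (h.maps x hx)]; ring
  have e3 : ∑ e, ∑ a, ∑ b, jacobian θ e i x * jacobian θ a k x * jacobian θ b j x *
        ∑ d, inducedChristoffel F' (fun _ => c) d e a (θ x) *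
          fundForm F' (fun _ => c) (θ x) d b =
      ∑ e, ∑ a, ∑ b, jacobian θ e i x * jacobian θ a j x * jacobian θ b k x *
        ∑ d, inducedChristoffel F' (fun _ => c) d e b (θ x) *
          fundForm F' (fun _ => c) (θ x) a d := by
    refine Finset.sum_congr rfl fun e _ => ?_
    rw [Finset.sum_comm]
    exact Finset.sum_congr rfl fun a _ => Finset.sum_congr rfl fun b _ => by
      simp only [h.target.fundForm_symm (h.maps x hx) a]; ring
  rw [e2, e3] at h2
  have e4 : 2 * ∑ e, ∑ a, ∑ b, jacobian θ e i x * jacobian θ a j x * jacobian θ b k x *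
      localCubic F' (fun _ => c) (θ x) e a b = ∑ e, ∑ a, ∑ b,
      jacobian θ e i x * jacobian θ a j x * jacobian θ b k x *
        (∑ d, inducedChristoffel F' (fun _ => c) d e a (θ x) *
          fundForm F' (fun _ => c) (θ x) d b + ∑ d, inducedChristoffel F' (fun _ => c) d e b (θ x) *
          fundForm F' (fun _ => c) (θ x) a d - pd e (fun y => fundForm F' (fun _ => c) y a b)
            (θ x)) := by
    simp only [← h.target.two_mul_localCubic hg' (h.maps x hx)]
    simp only [Finset.mul_sum]
    exact Finset.sum_congr rfl fun e _ => Finset.sum_congr rfl fun a _ =>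
      Finset.sum_congr rfl fun b _ => by ring
  simp only [mul_add, mul_sub, Finset.sum_add_distrib, Finset.sum_sub_distrib] at e4
  linarith

end IsChange
end ChangeOfCoordinates
end AbundantGeometry

namespace AbundantGeometry

/-! ### Derivative of a determinant -/

section Jacobi
variable {n m : ℕ} {Ω : Set (EuclideanSpace ℝ (Fin n))} {x : EuclideanSpace ℝ (Fin n)}

/-- Jacobi's formula for the derivative of a determinant. -/
theorem pd_det {M : EuclideanSpace ℝ (Fin n) → Matrix (Fin m) (Fin m) ℝ}
    (hM : ∀ i j, DifferentiableAt ℝ (fun y => M y i j) x) (l : Fin n)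
    (B : Matrix (Fin m) (Fin m) ℝ)
    (hB : ∀ i j, pd l (fun y => M y i j) x = (B * M x) i j) :
    pd l (fun y => (M y).det) x = B.trace * (M x).det := by
  have hrow : ∀ i, DifferentiableAt ℝ (fun y => (M y i : Fin m → ℝ)) x := fun i =>
    differentiableAt_pi.mpr (hM i)
  let D : ContinuousMultilinearMap ℝ (fun _ : Fin m => (Fin m → ℝ)) ℝ :=
    ⟨(Matrix.detRowAlternating (n := Fin m) (R := ℝ)).toMultilinearMap, by
      have : Continuous fun A : Matrix (Fin m) (Fin m) ℝ => A.det := Continuous.matrix_det continuous_id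
      exact this⟩
  have hD : ∀ A : Fin m → Fin m → ℝ, D A = Matrix.det (Matrix.of A) := fun A => rfl
  have hfull : HasFDerivAt (fun y => (fun i => M y i : Fin m → Fin m → ℝ))
      (fderiv ℝ (fun y => (fun i => M y i : Fin m → Fin m → ℝ)) x) x :=
    (differentiableAt_pi.mpr hrow).hasFDerivAt
  have h := (D.hasFDerivAt (fun i => M x i)).comp x hfull
  have h2 : pd l (fun y => (M y).det) x = D.linearDeriv (fun i => M x i)
      (fderiv ℝ (fun y => (fun i => M y i : Fin m → Fin m → ℝ)) x
        (EuclideanSpace.single l (1 : ℝ))) := by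
    rw [pd]
    exact congrArg (fun L => L (EuclideanSpace.single l (1 : ℝ))) h.fderiv
  have h3 : ∀ i, (fderiv ℝ (fun y => (fun i => M y i : Fin m → Fin m → ℝ)) x
        (EuclideanSpace.single l (1 : ℝ))) i = ∑ k, B i k • (M x k : Fin m → ℝ) := fun i => by
    rw [fderiv_pi hrow]
    ext j
    simp only [ContinuousLinearMap.coe_pi', Finset.sum_apply, Pi.smul_apply, smul_eq_mul]
    rw [fderiv_pi (hM i)]
    have := hB i j
    rw [Matrix.mul_apply] at this
    exact this
  rw [h2, ContinuousMultilinearMap.linearDeriv_apply, Matrix.trace, Finset.sum_mul]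
  refine Finset.sum_congr rfl fun i _ => ?_
  rw [h3, hD]
  -- Replacing row i by a combination of rows multiplies the determinant by the coefficient of row i
  -- itself, so summing over i gives the trace.
  have h4 := Matrix.det_updateRow_sum (M x) i (fun k => B i k)
  rw [smul_eq_mul] at h4
  refine Eq.trans ?_ h4
  congr 1

end Jacobi
end AbundantGeometry

namespace AbundantGeometry
-- The volume ratio as a potential for 3u
section Potential
variable {n : ℕ}

/-- The potential of `3u`: the logarithm of the ratio of the parallel volume form and the volume
form of the metric. -/
def localPotential (F : EuclideanSpace ℝ (Fin n) → (Fin (n + 1) → ℝ)) (c : Fin (n + 1) → ℝ)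
    (x : EuclideanSpace ℝ (Fin n)) : ℝ :=
  3 / ((n : ℝ) + 2) * (Real.log (Matrix.of (frame F (fun _ => c) x)).det -
    1 / 2 * Real.log (fundForm F (fun _ => c) x).det)

variable {Ω Ω' : Set (EuclideanSpace ℝ (Fin n))}
  {F F' : EuclideanSpace ℝ (Fin n) → (Fin (n + 1) → ℝ)} {c : Fin (n + 1) → ℝ}
  {x : EuclideanSpace ℝ (Fin n)}

theorem pd_apply {m : ℕ} {H : EuclideanSpace ℝ (Fin n) → (Fin m → ℝ)}
    (hH : DifferentiableAt ℝ H x) (l : Fin n) (b : Fin m) :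
    pd l (fun y => H y b) x = pd l H x b := by
  have := (hasFDerivAt_pi'.mp hH.hasFDerivAt b).fderiv
  rw [pd, this]
  rfl

theorem pd_log {a : EuclideanSpace ℝ (Fin n) → ℝ} (ha : DifferentiableAt ℝ a x) (h0 : a x ≠ 0)
    {t : ℝ} (l : Fin n) (h : pd l a x = t * a x) : pd l (fun y => Real.log (a y)) x = t := by
  rw [pd, (ha.hasFDerivAt.log h0).fderiv]
  have h' : fderiv ℝ a x (EuclideanSpace.single l (1 : ℝ)) = t * a x := h
  rw [smul_apply, h', smul_eq_mul]
  field_simp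

theorem IsLocalSphere.pd_det_frame (hF : IsLocalSphere Ω F c) (hx : x ∈ Ω) (l : Fin n) :
    pd l (fun y => (Matrix.of (frame F (fun _ => c) y)).det) x =
      (∑ k, inducedChristoffel F (fun _ => c) k l k x) *
        (Matrix.of (frame F (fun _ => c) x)).det := by
  -- The connection matrix of the frame: its last row is zero because c is constant, so the trace
  -- consists of induced Christoffel symbols only.
  let B : Matrix (Fin (n + 1)) (Fin (n + 1)) ℝ := Matrix.of fun a =>
    Fin.lastCases (motive := fun _ => Fin (n + 1) → ℝ) 0
      (fun k => Fin.snoc (α := fun _ => ℝ) (fun m => inducedChristoffel F (fun _ => c) m l k x)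
        (fundForm F (fun _ => c) x l k)) a
  have hB : B.trace = ∑ k, inducedChristoffel F (fun _ => c) k l k x := by
    rw [Matrix.trace, Fin.sum_univ_castSucc]
    simp [B]
  have hrow : ∀ a, Matrix.vecMul (B a) (Matrix.of (frame F (fun _ => c) x)) =
      (B * Matrix.of (frame F (fun _ => c) x)) a := fun a => rfl
  rw [← hB]
  refine pd_det (fun i j => differentiableAt_of_contDiffOn (hF.smooth_frame i j) hF.isOpen hx) l B
    fun a b => ?_
  rw [← hrow, vecMul_frame]
  refine Fin.lastCases ?_ (fun k => ?_) a
  · have h1 : (fun y => (Matrix.of (frame F (fun _ => c) y)) (Fin.last n) b) = fun _ => c b := by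
      funext y; simp [frame]
    rw [h1, pd_const]
    simp [B]
  · have h1 : (fun y => (Matrix.of (frame F (fun _ => c) y)) k.castSucc b) =
        fun y => pd k F y b := by
      funext y; simp [frame]
    rw [h1, pd_apply (differentiableAt_of_contDiffOn (hF.smooth_pd k) hF.isOpen hx),
      hF.gauss_formula hx]
    simp [B]

theorem IsMetricOn.pd_det {g : EuclideanSpace ℝ (Fin n) → Matrix (Fin n) (Fin n) ℝ}
    (hg : IsMetricOn Ω g) (hx : x ∈ Ω) (l : Fin n) :
    pd l (fun y => (g y).det) x = (2 * ∑ k, christoffel g k l k x) * (g x).det := by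
  have hu : IsUnit (g x).det := isUnit_iff_ne_zero.mpr (hg.det_ne_zero x hx)
  let Λ : Matrix (Fin n) (Fin n) ℝ := Matrix.of fun c e => christoffel g e l c x
  -- Chosen so that B·g = Λg + gΛᵀ = ∂g; both summands have trace tr Λ, hence the factor 2.
  let B : Matrix (Fin n) (Fin n) ℝ := Λ + g x * Λ.transpose * (g x)⁻¹
  have hB : B.trace = 2 * ∑ k, christoffel g k l k x := by
    have h1 : Λ.trace = ∑ k, christoffel g k l k x := rfl
    rw [Matrix.trace_add, Matrix.trace_mul_comm, ← Matrix.mul_assoc, Matrix.nonsing_inv_mul _ hu,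
      Matrix.one_mul, Matrix.trace_transpose, h1]
    ring
  rw [← hB]
  refine AbundantGeometry.pd_det (fun i j => hg.differentiableAt hx i j) l B fun i j => ?_
  have h2 : B * g x = Λ * g x + g x * Λ.transpose := by
    rw [Matrix.add_mul, Matrix.nonsing_inv_mul_cancel_right _ _ hu]
  rw [h2, hg.pd_metric hx, Matrix.add_apply, Matrix.mul_apply, Matrix.mul_apply,
    ← Finset.sum_add_distrib]
  exact Finset.sum_congr rfl fun a _ => by
    simp only [Λ, Matrix.of_apply, Matrix.transpose_apply]; ring

/-- Raising the index of C undoes its lowering, so u is a normalised difference of traces of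
connection coefficients. -/
theorem IsLocalSphere.localTrace_eq (hg : IsMetricOn Ω (fundForm F (fun _ => c)))
    (hx : x ∈ Ω) (l : Fin n) :
    IsLocalSphere.localTrace F c x l = 1 / ((n : ℝ) + 2) *
      (∑ k, inducedChristoffel F (fun _ => c) k l k x -
        ∑ k, christoffel (fundForm F (fun _ => c)) k l k x) := by
  rw [IsLocalSphere.localTrace, cubicTrace, ← Finset.sum_sub_distrib]
  congr 1
  refine Finset.sum_congr rfl fun j _ => ?_
  have e : ∀ k, (fundForm F (fun _ => c) x)⁻¹ j k * localCubic F (fun _ => c) x l j k =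
      ∑ m, differenceTensor F c m l j x *
        ((fundForm F (fun _ => c) x)⁻¹ j k * fundForm F (fun _ => c) x k m) := fun k => by
    rw [localCubic, Finset.mul_sum]
    exact Finset.sum_congr rfl fun m _ => by
      rw [hg.symm x hx k m, differenceTensor]; ring
  simp only [e]
  rw [Finset.sum_comm]
  simp only [← Finset.mul_sum, sum_inv_mul (hg.det_ne_zero x hx)]
  simp [differenceTensor]

theorem IsLocalSphere.smooth_localPotential (hF : IsLocalSphere Ω F c)
    (hg : IsMetricOn Ω (fundForm F (fun _ => c))) : ContDiffOn ℝ ∞ (localPotential F c) Ω :=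
  contDiffOn_const.mul (((contDiffOn_det hF.smooth_frame).log hF.det_frame).sub
    (contDiffOn_const.mul ((contDiffOn_det hg.smooth).log hg.det_ne_zero)))

/-- The two logarithmic derivatives are the traces of the induced and, with factor 2, of the
Levi-Civita coefficients; the ½ in the potential removes that factor. -/
theorem IsLocalSphere.pd_localPotential (hF : IsLocalSphere Ω F c)
    (hg : IsMetricOn Ω (fundForm F (fun _ => c))) (hx : x ∈ Ω) (l : Fin n) :
    pd l (localPotential F c) x = 3 * IsLocalSphere.localTrace F c x l := by
  have h1 := differentiableAt_of_contDiffOn (contDiffOn_det hF.smooth_frame) hF.isOpen hx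
  have h2 := differentiableAt_of_contDiffOn (contDiffOn_det hg.smooth) hF.isOpen hx
  have h1' := pd_log h1 (hF.det_frame x hx) l (hF.pd_det_frame hx l)
  have h2' := pd_log h2 (hg.det_ne_zero x hx) l (hg.pd_det hx l)
  have d1 := h1.log (hF.det_frame x hx)
  have d2 := h2.log (hg.det_ne_zero x hx)
  have h3 : localPotential F c = fun x => 3 / ((n : ℝ) + 2) *
    (Real.log (Matrix.of (frame F (fun _ => c) x)).det -
    1 / 2 * Real.log (fundForm F (fun _ => c) x).det) := rfl
  rw [h3, pd_const_mul _ (d1.fun_sub (d2.const_mul _)), pd_sub d1 (d2.const_mul _),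
    pd_const_mul _ d2, h1', h2', IsLocalSphere.localTrace_eq hg hx]
  ring

namespace IsChange
variable {θ : EuclideanSpace ℝ (Fin n) → EuclideanSpace ℝ (Fin n)}

theorem det_frame (h : IsChange Ω Ω' θ F F' c) (hx : x ∈ Ω) :
    (Matrix.of (frame F (fun _ => c) x)).det =
      (Matrix.of fun i a => jacobian θ a i x).det *
        (Matrix.of (frame F' (fun _ => c) (θ x))).det := by
  -- Block matrix with blocks Jacobian and 1: the frame changes by the Jacobian on tangent vectors
  -- and fixes c.
  let B : Matrix (Fin (n + 1)) (Fin (n + 1)) ℝ := Matrix.of fun a =>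
    Fin.lastCases (motive := fun _ => Fin (n + 1) → ℝ) (Fin.snoc (α := fun _ => ℝ) 0 1)
      (fun k => Fin.snoc (α := fun _ => ℝ) (fun m => jacobian θ m k x) 0) a
  have hB : B.det = (Matrix.of fun i a => jacobian θ a i x).det := by
    rw [Matrix.det_succ_row B (Fin.last n), Fin.sum_univ_castSucc]
    have h0 : ∀ i : Fin n, B (Fin.last n) i.castSucc = 0 := fun i => by simp [B]
    have h1 : B (Fin.last n) (Fin.last n) = 1 := by simp [B]
    simp only [h0, h1, mul_zero, zero_mul, Finset.sum_const_zero, zero_add, mul_one,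
      Fin.succAbove_last]
    rw [← two_mul, pow_mul]
    have h2 : B.submatrix Fin.castSucc Fin.castSucc = Matrix.of fun i a => jacobian θ a i x := by
      ext i a; simp [B]
    rw [h2]; simp
  rw [← hB, ← Matrix.det_mul]
  congr 1
  ext a b
  have hrow : (B * Matrix.of (frame F' (fun _ => c) (θ x))) a =
      Matrix.vecMul (B a) (Matrix.of (frame F' (fun _ => c) (θ x))) := rfl
  rw [hrow, vecMul_frame]
  refine Fin.lastCases ?_ (fun k => ?_) a
  · simp [frame, B]
  · have := h.pd_eq hx k
    simp [frame, B, this]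

theorem det_jacobian_ne_zero (h : IsChange Ω Ω' θ F F' c) (hx : x ∈ Ω) :
    (Matrix.of fun i a => jacobian θ a i x).det ≠ 0 := fun h0 => by
  have := h.det_frame hx
  rw [h0, zero_mul] at this
  exact h.source.det_frame x hx this

theorem det_fundForm (h : IsChange Ω Ω' θ F F' c) (hx : x ∈ Ω) :
    (fundForm F (fun _ => c) x).det = (Matrix.of fun i a => jacobian θ a i x).det ^ 2 *
      (fundForm F' (fun _ => c) (θ x)).det := by
  set J : Matrix (Fin n) (Fin n) ℝ := Matrix.of fun i a => jacobian θ a i x with hJ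
  have : fundForm F (fun _ => c) x = J * fundForm F' (fun _ => c) (θ x) * J.transpose := by
    ext i j
    rw [h.fundForm_eq hx, Finset.sum_comm]
    simp only [Matrix.mul_apply, Matrix.transpose_apply, hJ, Matrix.of_apply, Finset.sum_mul]
    exact Finset.sum_congr rfl fun a _ => Finset.sum_congr rfl fun b _ => by ring
  rw [this, Matrix.det_mul, Matrix.det_mul, Matrix.det_transpose]
  ring

/-- The frame determinant scales by det J and det G by its square, so log|det J| cancels between the
two terms. As `Real.log` ignores signs, neither orientation nor signature matters. -/
theorem localPotential_eq (h : IsChange Ω Ω' θ F F' c)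
    (hg' : IsMetricOn Ω' (fundForm F' (fun _ => c))) (hx : x ∈ Ω) :
    localPotential F c x = localPotential F' c (θ x) := by
  have hJ := h.det_jacobian_ne_zero hx
  rw [localPotential, localPotential, h.det_frame hx, h.det_fundForm hx,
    Real.log_mul hJ (h.target.det_frame _ (h.maps x hx)),
    Real.log_mul (pow_ne_zero 2 hJ) (hg'.det_ne_zero _ (h.maps x hx)), Real.log_pow]
  push_cast
  ring

end IsChange
end Potential
end AbundantGeometry

/-! ### Charts and coordinate expressions of the immersion -/

namespace AbundantGeometry

/-- A linear relation among the frame vectors with nonzero coefficient at c would make c tangent;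
otherwise injectivity of L pulls it back to a relation among the V_k. -/
theorem det_frame_ne_zero {n : ℕ} {T : Type*} [AddCommGroup T] [Module ℝ T]
    {c : Fin (n + 1) → ℝ} {F : EuclideanSpace ℝ (Fin n) → (Fin (n + 1) → ℝ)}
    {x : EuclideanSpace ℝ (Fin n)} (L : T →ₗ[ℝ] (Fin (n + 1) → ℝ)) (hL : Function.Injective L)
    (hc : ∀ X, L X ≠ c) {V : Fin n → T} (hV : LinearIndependent ℝ V)
    (hF : ∀ k, pd k F x = L (V k)) : (Matrix.of (frame F (fun _ => c) x)).det ≠ 0 := by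
  intro h0
  obtain ⟨w, hw, hw0⟩ := Matrix.exists_vecMul_eq_zero_iff.mpr h0
  rw [vecMul_frame] at hw0
  simp only [hF, ← map_smul, ← map_sum] at hw0
  have hlast : w (Fin.last n) = 0 := by
    by_contra hl
    refine hc (-(w (Fin.last n))⁻¹ • ∑ k : Fin n, w k.castSucc • V k) ?_
    rw [map_smul, eq_neg_of_add_eq_zero_left hw0]
    simp [smul_smul, hl]
  rw [hlast, zero_smul, add_zero] at hw0
  have h3 : ∑ k : Fin n, w k.castSucc • V k = 0 := hL (by rw [hw0, map_zero])
  have h4 := Fintype.linearIndependent_iff.mp hV _ h3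
  exact hw (funext fun a => Fin.lastCases hlast h4 a)

theorem mem_transition_source {n : ℕ} {M : Type*} [TopologicalSpace M]
    [ChartedSpace (EuclideanSpace ℝ (Fin n)) M]
    {φ : OpenPartialHomeomorph M (EuclideanSpace ℝ (Fin n))} {x : EuclideanSpace ℝ (Fin n)}
    (hx : x ∈ φ.target) :
    x ∈ (φ.symm.trans (chartAt (EuclideanSpace ℝ (Fin n)) (φ.symm x))).source := by
  rw [OpenPartialHomeomorph.trans_source]
  exact ⟨hx, mem_chart_source _ _⟩

section Charts
variable {n : ℕ} {M : Type*} [TopologicalSpace M] [ChartedSpace (EuclideanSpace ℝ (Fin n)) M]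
  [IsManifold (𝓡 n) ∞ M] {f ξ : M → (Fin (n + 1) → ℝ)} {c : Fin (n + 1) → ℝ}
  {φ ψ : OpenPartialHomeomorph M (EuclideanSpace ℝ (Fin n))} {x : EuclideanSpace ℝ (Fin n)}

theorem IsLocalSphere.mono {Ω Ω' : Set (EuclideanSpace ℝ (Fin n))}
    {F : EuclideanSpace ℝ (Fin n) → (Fin (n + 1) → ℝ)} (h : IsLocalSphere Ω F c)
    (hs : Ω' ⊆ Ω) (ho : IsOpen Ω') : IsLocalSphere Ω' F c :=
  ⟨ho, h.smooth.mono hs, fun x hx => h.det_frame x (hs hx)⟩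

theorem contDiffOn_comp_chart_symm {V : Type*} [NormedAddCommGroup V] [NormedSpace ℝ V]
    {h : M → V} (hh : ContMDiff (𝓡 n) 𝓘(ℝ, V) ∞ h)
    (hφ : φ ∈ atlas (EuclideanSpace ℝ (Fin n)) M) : ContDiffOn ℝ ∞ (h ∘ φ.symm) φ.target :=
  contMDiffOn_iff_contDiffOn.mp (hh.comp_contMDiffOn
    (contMDiffOn_symm_of_mem_maximalAtlas (IsManifold.subset_maximalAtlas hφ)))

theorem contDiffOn_transition (hφ : φ ∈ atlas (EuclideanSpace ℝ (Fin n)) M)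
    (hψ : ψ ∈ atlas (EuclideanSpace ℝ (Fin n)) M) :
    ContDiffOn ℝ ∞ (ψ ∘ φ.symm) (φ.symm.trans ψ).source := by
  refine contMDiffOn_iff_contDiffOn.mp ?_
  refine (contMDiffOn_of_mem_maximalAtlas (IsManifold.subset_maximalAtlas hψ)).comp
    ((contMDiffOn_symm_of_mem_maximalAtlas (IsManifold.subset_maximalAtlas hφ)).mono ?_) ?_
  · intro y hy
    rw [OpenPartialHomeomorph.trans_source] at hy
    exact hy.1
  · intro y hy
    rw [OpenPartialHomeomorph.trans_source] at hy
    exact hy.2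

theorem mdifferentiableAt_chart_symm (hφ : φ ∈ atlas (EuclideanSpace ℝ (Fin n)) M)
    (hx : x ∈ φ.target) : MDifferentiableAt (𝓡 n) (𝓡 n) φ.symm x :=
  haveI : IsManifold (𝓡 n) 1 M := IsManifold.of_le (n := ∞) (by simp)
  mdifferentiableAt_atlas_symm hφ hx

theorem mfderiv_chart_symm_injective (hφ : φ ∈ atlas (EuclideanSpace ℝ (Fin n)) M)
    (hx : x ∈ φ.target) : Function.Injective (mfderiv (𝓡 n) (𝓡 n) φ.symm x) :=
  haveI : IsManifold (𝓡 n) 1 M := IsManifold.of_le (n := ∞) (by simp)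
  (mdifferentiable_of_mem_atlas hφ).symm.mfderiv_injective hx

theorem pd_comp_chart_symm {V : Type*} [NormedAddCommGroup V] [NormedSpace ℝ V]
    {h : M → V} (hφ : φ ∈ atlas (EuclideanSpace ℝ (Fin n)) M) (hx : x ∈ φ.target)
    (hh : MDifferentiableAt (𝓡 n) 𝓘(ℝ, V) h (φ.symm x)) (i : Fin n) :
    pd i (h ∘ φ.symm) x = mfderiv (𝓡 n) 𝓘(ℝ, V) h (φ.symm x) (coordVec φ x i) := by
  have h1 := mfderiv_comp x hh (mdifferentiableAt_chart_symm hφ hx)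
  rw [pd, ← mfderiv_eq_fderiv, h1]
  rfl

theorem coordVec_linearIndependent (hφ : φ ∈ atlas (EuclideanSpace ℝ (Fin n)) M)
    (hx : x ∈ φ.target) : LinearIndependent ℝ (coordVec φ x) := by
  have h1 : LinearIndependent ℝ (fun i : Fin n => (EuclideanSpace.single i (1 : ℝ) :
      EuclideanSpace ℝ (Fin n))) := by
    have h2 : ⇑(EuclideanSpace.basisFun (Fin n) ℝ) = fun i => EuclideanSpace.single i (1 : ℝ) :=
      funext fun i => EuclideanSpace.basisFun_apply (Fin n) ℝ i
    rw [← h2]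
    exact (EuclideanSpace.basisFun (Fin n) ℝ).orthonormal.linearIndependent
  exact h1.map' (mfderiv (𝓡 n) (𝓡 n) φ.symm x).toLinearMap
    (LinearMap.ker_eq_bot.mpr (mfderiv_chart_symm_injective hφ hx))

theorem isLocalSphere_chart (hN : IsAffineNormalisation f ξ) (hξ : ∀ p, ξ p = c)
    (hφ : φ ∈ atlas (EuclideanSpace ℝ (Fin n)) M) :
    IsLocalSphere φ.target (f ∘ φ.symm) c where
  isOpen := φ.open_target
  smooth := contDiffOn_comp_chart_symm hN.smooth_f hφ
  det_frame x hx h0 := by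
    have hf : MDifferentiableAt (𝓡 n) 𝓘(ℝ, Fin (n + 1) → ℝ) f (φ.symm x) :=
      hN.smooth_f.mdifferentiableAt (by simp)
    exact det_frame_ne_zero (T := TangentSpace (𝓡 n) (φ.symm x))
      (mfderiv (𝓡 n) 𝓘(ℝ, Fin (n + 1) → ℝ) f (φ.symm x)).toLinearMap (hN.immersion _)
      (fun X => (hξ (φ.symm x)) ▸ hN.transversal (φ.symm x) X)
      (coordVec_linearIndependent hφ hx) (fun k => pd_comp_chart_symm hφ hx hf k) h0

/-- Specialises the coordinate-change results to a pair of atlas charts, on the domain of their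
transition map. -/
theorem isChange_chart (hN : IsAffineNormalisation f ξ) (hξ : ∀ p, ξ p = c)
    (hφ : φ ∈ atlas (EuclideanSpace ℝ (Fin n)) M) (hψ : ψ ∈ atlas (EuclideanSpace ℝ (Fin n)) M) :
    IsChange (φ.symm.trans ψ).source ψ.target (ψ ∘ φ.symm) (f ∘ φ.symm) (f ∘ ψ.symm) c where
  source := (isLocalSphere_chart hN hξ hφ).mono
    (fun y hy => by rw [OpenPartialHomeomorph.trans_source] at hy; exact hy.1)
    (φ.symm.trans ψ).open_source
  target := isLocalSphere_chart hN hξ hψ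
  smooth := contDiffOn_transition hφ hψ
  maps y hy := by
    rw [OpenPartialHomeomorph.trans_source] at hy
    exact ψ.map_source hy.2
  comp y hy := by
    rw [OpenPartialHomeomorph.trans_source] at hy
    simp only [Function.comp_apply]
    rw [ψ.left_inv hy.2]

/-- The tensors on M are defined at each point by the preferred chart there. This identity converts
them to an arbitrary atlas chart through the Jacobian of the transition. -/
theorem coordForm_coordVec (hφ : φ ∈ atlas (EuclideanSpace ℝ (Fin n)) M) (hx : x ∈ φ.target)
    (a i : Fin n) : coordForm (φ.symm x) a (coordVec φ x i) =
      jacobian (chartAt (EuclideanSpace ℝ (Fin n)) (φ.symm x) ∘ φ.symm) a i x := by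
  have hd := differentiableAt_of_contDiffOn (contDiffOn_transition hφ
    (chart_mem_atlas (EuclideanSpace ℝ (Fin n)) (φ.symm x)))
    (φ.symm.trans _).open_source (mem_transition_source hx)
  have : IsManifold (𝓡 n) 1 M := IsManifold.of_le (n := ∞) (by simp)
  have h1 := mfderiv_comp x (mdifferentiableAt_atlas (I := 𝓡 n)
    (chart_mem_atlas (EuclideanSpace ℝ (Fin n)) (φ.symm x)) (mem_chart_source _ (φ.symm x)))
    (mdifferentiableAt_chart_symm hφ hx)
  rw [← fderiv_apply_eq_jacobian hd, ← mfderiv_eq_fderiv]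
  rw [h1]
  rfl

end Charts
end AbundantGeometry

namespace AbundantGeometry

/-! ### Gram matrices and basis independence of traces -/

section GramMatrices
variable {n : ℕ} {T : Type*} [AddCommGroup T] [Module ℝ T]

theorem det_gram_ne_zero (B : T →ₗ[ℝ] T →ₗ[ℝ] ℝ) (hB : ∀ X, (∀ Y, B X Y = 0) → X = 0) {V : Fin n → T}
    (hV : LinearIndependent ℝ V) (hV' : ∀ Y, ∃ w : Fin n → ℝ, Y = ∑ i, w i • V i) :
    (Matrix.of fun i j => B (V i) (V j)).det ≠ 0 := by
  intro h0
  obtain ⟨w, hw, hw0⟩ := Matrix.exists_vecMul_eq_zero_iff.mpr h0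
  have h1 : ∀ j, B (∑ i, w i • V i) (V j) = 0 := fun j => by
    have := congrFun hw0 j
    simpa [Matrix.vecMul, dotProduct] using this
  have h2 : ∀ Y, B (∑ i, w i • V i) Y = 0 := fun Y => by
    obtain ⟨v, rfl⟩ := hV' Y
    rw [map_sum]
    exact Finset.sum_eq_zero fun j _ => by rw [map_smul, h1, smul_zero]
  have h3 := Fintype.linearIndependent_iff.mp hV w (hB _ h2)
  exact hw (funext h3)

/-- The metric trace does not depend on the basis. -/
theorem tr2_gram_eq (B D : T →ₗ[ℝ] T →ₗ[ℝ] ℝ) {V V' : Fin n → T}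
    {P : Matrix (Fin n) (Fin n) ℝ} (hP : ∀ j, V' j = ∑ a, P a j • V a)
    (hB' : (Matrix.of fun i j => B (V' i) (V' j)).det ≠ 0) :
    tr2 (Matrix.of fun i j => B (V i) (V j)) (fun i j => D (V i) (V j)) =
      tr2 (Matrix.of fun i j => B (V' i) (V' j)) (fun i j => D (V' i) (V' j)) := by
  have htr : ∀ (g A : Matrix (Fin n) (Fin n) ℝ), tr2 g (fun i j => A i j) =
      (g⁻¹ * A.transpose).trace := fun g A => rfl
  have hgram : ∀ B : T →ₗ[ℝ] T →ₗ[ℝ] ℝ, (Matrix.of fun i j => B (V' i) (V' j)) =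
      P.transpose * (Matrix.of fun i j => B (V i) (V j)) * P := fun B => by
    ext i j
    simp only [hP, map_sum, map_smul, LinearMap.sum_apply, LinearMap.smul_apply, smul_eq_mul,
      Matrix.mul_apply, Matrix.transpose_apply, Matrix.of_apply, Finset.mul_sum, Finset.sum_mul]
    exact Finset.sum_congr rfl fun a _ => Finset.sum_congr rfl fun b _ => by ring
  -- The transformed Gram matrix is the old one multiplied by Pᵀ and P, so its non-degeneracy forces
  -- P to be invertible.
  have hPu : IsUnit P.det := by
    rw [hgram, Matrix.det_mul] at hB'
    exact isUnit_iff_ne_zero.mpr (right_ne_zero_of_mul hB')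
  have h1 := htr (Matrix.of fun i j => B (V i) (V j)) (Matrix.of fun i j => D (V i) (V j))
  have h2 := htr (Matrix.of fun i j => B (V' i) (V' j)) (Matrix.of fun i j => D (V' i) (V' j))
  refine h1.trans (Eq.trans ?_ h2.symm)
  have hPt : IsUnit P.transpose.det := by rwa [Matrix.det_transpose]
  set G := (Matrix.of fun i j => B (V i) (V j))
  set E := (Matrix.of fun i j => D (V i) (V j))
  rw [hgram B, hgram D, Matrix.mul_inv_rev, Matrix.mul_inv_rev, Matrix.transpose_mul,
    Matrix.transpose_mul, Matrix.transpose_transpose]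
  have h3 : P⁻¹ * (G⁻¹ * P.transpose⁻¹) * (P.transpose * (E.transpose * P)) =
      P⁻¹ * ((G⁻¹ * E.transpose) * P) := by
    simp only [Matrix.mul_assoc]
    rw [Matrix.nonsing_inv_mul_cancel_left _ _ hPt]
  rw [h3, Matrix.trace_mul_comm P⁻¹, Matrix.mul_assoc (G⁻¹ * E.transpose), Matrix.mul_nonsing_inv _ hPu, Matrix.mul_one]

end GramMatrices

/-! ### Components of the global tensors in an arbitrary chart -/

section Components
variable {n : ℕ} {M : Type*} [TopologicalSpace M] [ChartedSpace (EuclideanSpace ℝ (Fin n)) M]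
  [IsManifold (𝓡 n) ∞ M] {f ξ : M → (Fin (n + 1) → ℝ)} {c : Fin (n + 1) → ℝ}
  {φ ψ : OpenPartialHomeomorph M (EuclideanSpace ℝ (Fin n))} {x : EuclideanSpace ℝ (Fin n)}

/-- The coordinate expression in the preferred chart, pulled back by the transition Jacobian, is the
one of the given chart: the tensor law `fundForm_eq`. -/
theorem comp2_affineMetric (hN : IsAffineNormalisation f ξ) (hξ : ∀ p, ξ p = c)
    (hφ : φ ∈ atlas (EuclideanSpace ℝ (Fin n)) M) (hx : x ∈ φ.target) :
    comp2 (affineMetric f ξ) φ x = fundForm (f ∘ φ.symm) (fun _ => c) x := by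
  ext i j
  have hξ' : ∀ ψ : OpenPartialHomeomorph M (EuclideanSpace ℝ (Fin n)),
      ξ ∘ ψ.symm = fun _ => c := fun ψ => funext fun y => hξ _
  rw [(isChange_chart hN hξ hφ (chart_mem_atlas (EuclideanSpace ℝ (Fin n))
    (φ.symm x))).fundForm_eq (mem_transition_source hx)]
  simp only [comp2, Matrix.of_apply, affineMetric_apply, hξ', coordForm_coordVec hφ hx,
    Function.comp_apply]
  exact Finset.sum_congr rfl fun a _ => Finset.sum_congr rfl fun b _ => mul_comm _ _

theorem exists_eq_sum_coordVec (hφ : φ ∈ atlas (EuclideanSpace ℝ (Fin n)) M)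
    (hx : x ∈ φ.target) (Y : TangentSpace (𝓡 n) (φ.symm x)) :
    ∃ w : Fin n → ℝ, Y = ∑ i, w i • coordVec φ x i := by
  have : IsManifold (𝓡 n) 1 M := IsManifold.of_le (n := ∞) (by simp)
  obtain ⟨v, rfl⟩ := (mdifferentiable_of_mem_atlas (I := 𝓡 n) hφ).symm.mfderiv_surjective hx Y
  let v' : EuclideanSpace ℝ (Fin n) := v
  refine ⟨fun i => v' i, ?_⟩
  have h : v = ∑ a, v' a • (EuclideanSpace.single a (1 : ℝ) : EuclideanSpace ℝ (Fin n)) :=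
    sum_smul_single v'
  refine (congrArg _ h).trans ((map_sum _ _ _).trans ?_)
  exact Finset.sum_congr rfl fun a _ => map_smul _ _ _

theorem isMetricOn_chart (hN : IsAffineNormalisation f ξ) (hξ : ∀ p, ξ p = c)
    (hd : ∀ p X, (∀ Y, affineMetric f ξ p X Y = 0) → X = 0)
    (hφ : φ ∈ atlas (EuclideanSpace ℝ (Fin n)) M) :
    IsMetricOn φ.target (fundForm (f ∘ φ.symm) (fun _ => c)) := by
  refine (isLocalSphere_chart hN hξ hφ).isMetricOn fun x hx => ?_
  rw [← comp2_affineMetric hN hξ hφ hx]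
  exact det_gram_ne_zero (affineMetric f ξ (φ.symm x)) (hd _)
    (coordVec_linearIndependent hφ hx) (exists_eq_sum_coordVec hφ hx)

theorem comp3_affineCubic (hN : IsAffineNormalisation f ξ) (hξ : ∀ p, ξ p = c)
    (hd : ∀ p X, (∀ Y, affineMetric f ξ p X Y = 0) → X = 0)
    (hφ : φ ∈ atlas (EuclideanSpace ℝ (Fin n)) M) (hx : x ∈ φ.target) :
    comp3 (affineCubic f ξ) φ x = localCubic (f ∘ φ.symm) (fun _ => c) x := by
  funext i j k
  have hξ' : ∀ ψ : OpenPartialHomeomorph M (EuclideanSpace ℝ (Fin n)),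
      ξ ∘ ψ.symm = fun _ => c := fun ψ => funext fun y => hξ _
  have hψ := chart_mem_atlas (EuclideanSpace ℝ (Fin n)) (φ.symm x)
  have hch := isChange_chart hN hξ hφ hψ
  have hg := isMetricOn_chart hN hξ hd hφ
  rw [hch.localCubic_eq (hch.source.isMetricOn fun y hy => hg.det_ne_zero y (by
    rw [OpenPartialHomeomorph.trans_source] at hy; exact hy.1)) (isMetricOn_chart hN hξ hd hψ)
    (mem_transition_source hx)]
  simp only [comp3, affineCubic_apply, hξ', coordForm_coordVec hφ hx, Function.comp_apply]
  exact Finset.sum_congr rfl fun a _ => Finset.sum_congr rfl fun b _ =>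
    Finset.sum_congr rfl fun d _ => by ring

theorem comp1_affineU1 (hN : IsAffineNormalisation f ξ) (hξ : ∀ p, ξ p = c)
    (hd : ∀ p X, (∀ Y, affineMetric f ξ p X Y = 0) → X = 0)
    (hφ : φ ∈ atlas (EuclideanSpace ℝ (Fin n)) M) (hx : x ∈ φ.target) :
    comp1 (affineU1 f ξ) φ x = IsLocalSphere.localTrace (f ∘ φ.symm) c x := by
  funext i
  have hg := (isMetricOn_chart hN hξ hd hφ).det_ne_zero x hx
  rw [← comp2_affineMetric hN hξ hφ hx] at hg
  -- The tangent space is the model space itself, so the coordinates of a vector are its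
  -- coefficients in `tangentBasis`; they form the change-of-basis matrix below.
  let v : Fin n → EuclideanSpace ℝ (Fin n) := coordVec φ x
  have h := tr2_gram_eq (T := TangentSpace (𝓡 n) (φ.symm x)) (affineMetric f ξ (φ.symm x))
    (affineCubic f ξ (φ.symm x) (coordVec φ x i)) (V := tangentBasis (M := M) (φ.symm x))
    (V' := coordVec φ x) (P := Matrix.of fun a j => v j a)
    (fun j => sum_smul_single (v j)) hg
  rw [comp1, affineU1, traceForm_apply, IsLocalSphere.localTrace, cubicTrace,
    ← comp2_affineMetric hN hξ hφ hx, ← comp3_affineCubic hN hξ hd hφ hx]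
  exact congrArg (fun z => 1 / ((n : ℝ) + 2) * z) h

theorem comp3_affineU3 (hN : IsAffineNormalisation f ξ) (hξ : ∀ p, ξ p = c)
    (hd : ∀ p X, (∀ Y, affineMetric f ξ p X Y = 0) → X = 0)
    (hφ : φ ∈ atlas (EuclideanSpace ℝ (Fin n)) M) (hx : x ∈ φ.target) :
    comp3 (affineU3 f ξ) φ x = IsLocalSphere.localTracefree (f ∘ φ.symm) c x := by
  funext i j k
  have h1 : ∀ i, cubicTrace (fundForm (f ∘ φ.symm) (fun _ => c) x)
      (localCubic (f ∘ φ.symm) (fun _ => c) x) i = comp1 (affineU1 f ξ) φ x i := fun i => by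
    rw [comp1_affineU1 hN hξ hd hφ hx]; rfl
  rw [IsLocalSphere.localTracefree, cubicTracefree, h1, h1, h1,
    ← comp2_affineMetric hN hξ hφ hx, ← comp3_affineCubic hN hξ hd hφ hx, comp3, affineU3,
    tracefreePart_apply]
  rfl

end Components
end AbundantGeometry

namespace AbundantGeometry

/-! ### Locality of the differential operators in the metric -/

section Congruence
variable {n : ℕ} {Ω : Set (EuclideanSpace ℝ (Fin n))}
  {g g' : EuclideanSpace ℝ (Fin n) → Matrix (Fin n) (Fin n) ℝ} {x : EuclideanSpace ℝ (Fin n)}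

theorem christoffel_congr (hΩ : IsOpen Ω) (hx : x ∈ Ω) (h : ∀ y ∈ Ω, g y = g' y)
    (k i j : Fin n) : christoffel g k i j x = christoffel g' k i j x := by
  have h' : ∀ l i j, pd l (fun y => g y i j) x = pd l (fun y => g' y i j) x := fun l i j =>
    pd_congr hΩ hx (fun y hy => by rw [h y hy]) l
  simp only [christoffel, h', h x hx]

theorem curvature_congr (hΩ : IsOpen Ω) (hx : x ∈ Ω) (h : ∀ y ∈ Ω, g y = g' y)
    (l i j k : Fin n) : curvature g l i j k x = curvature g' l i j k x := by
  have h' : ∀ a l i j, pd a (christoffel g l i j) x = pd a (christoffel g' l i j) x :=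
    fun a l i j => pd_congr hΩ hx (fun y hy => christoffel_congr hΩ hy h l i j) a
  simp only [curvature, h', christoffel_congr hΩ hx h]

theorem cov1_congr_metric (hΩ : IsOpen Ω) (hx : x ∈ Ω) (h : ∀ y ∈ Ω, g y = g' y)
    {v v' : EuclideanSpace ℝ (Fin n) → Fin n → ℝ} (hv : ∀ y ∈ Ω, v y = v' y) (i j : Fin n) :
    cov1 g v i j x = cov1 g' v' i j x := by
  have h' : ∀ i j, pd i (fun y => v y j) x = pd i (fun y => v' y j) x := fun i j =>
    pd_congr hΩ hx (fun y hy => by rw [hv y hy]) i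
  simp only [cov1, h', christoffel_congr hΩ hx h, hv x hx]

theorem cov3_congr_metric (hΩ : IsOpen Ω) (hx : x ∈ Ω) (h : ∀ y ∈ Ω, g y = g' y)
    {T T' : EuclideanSpace ℝ (Fin n) → Fin n → Fin n → Fin n → ℝ}
    (hT : ∀ y ∈ Ω, T y = T' y) (i j k l : Fin n) :
    cov3 g T i j k l x = cov3 g' T' i j k l x := by
  have h' : ∀ i j k l, pd i (fun y => T y j k l) x = pd i (fun y => T' y j k l) x :=
    fun i j k l => pd_congr hΩ hx (fun y hy => by rw [hT y hy]) i
  simp only [cov3, h', christoffel_congr hΩ hx h, hT x hx]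

end Congruence

/-! ### Global verification of abundance and properness -/

section ImproperSpheres
variable {n : ℕ} {M : Type*} [TopologicalSpace M] [ChartedSpace (EuclideanSpace ℝ (Fin n)) M]
  [IsManifold (𝓡 n) ∞ M] {f ξ : M → (Fin (n + 1) → ℝ)} {c : Fin (n + 1) → ℝ}
  {φ : OpenPartialHomeomorph M (EuclideanSpace ℝ (Fin n))} {x : EuclideanSpace ℝ (Fin n)} {κ : ℝ}

theorem affineMetric_symm (hN : IsAffineNormalisation f ξ) (hξ : ∀ p, ξ p = c) (p : M)
    (X Y : TangentSpace (𝓡 n) p) : affineMetric f ξ p X Y = affineMetric f ξ p Y X := by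
  have hψ := chart_mem_atlas (EuclideanSpace ℝ (Fin n)) p
  have hF := isLocalSphere_chart hN hξ hψ
  have hp := mem_chart_target (EuclideanSpace ℝ (Fin n)) p
  have hξ' : ξ ∘ (chartAt (EuclideanSpace ℝ (Fin n)) p).symm = fun _ => c := funext fun y => hξ _
  simp only [affineMetric_apply, hξ']
  rw [Finset.sum_comm]
  exact Finset.sum_congr rfl fun i _ => Finset.sum_congr rfl fun j _ => by
    rw [hF.fundForm_symm hp]; ring

theorem affineCubic_symm (hN : IsAffineNormalisation f ξ) (hξ : ∀ p, ξ p = c)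
    (hd : ∀ p X, (∀ Y, affineMetric f ξ p X Y = 0) → X = 0) (p : M)
    (X Y Z : TangentSpace (𝓡 n) p) : affineCubic f ξ p X Y Z = affineCubic f ξ p Y X Z ∧
      affineCubic f ξ p X Y Z = affineCubic f ξ p X Z Y := by
  have hψ := chart_mem_atlas (EuclideanSpace ℝ (Fin n)) p
  have hF := isLocalSphere_chart hN hξ hψ
  have hg := isMetricOn_chart hN hξ hd hψ
  have hp := mem_chart_target (EuclideanSpace ℝ (Fin n)) p
  have hξ' : ξ ∘ (chartAt (EuclideanSpace ℝ (Fin n)) p).symm = fun _ => c := funext fun y => hξ _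
  simp only [affineCubic_apply, hξ']
  constructor
  · rw [Finset.sum_comm]
    exact Finset.sum_congr rfl fun i _ => Finset.sum_congr rfl fun j _ =>
      Finset.sum_congr rfl fun k _ => by rw [hF.localCubic_symm_left hg hp]; ring
  · refine Finset.sum_congr rfl fun i _ => ?_
    rw [Finset.sum_comm]
    exact Finset.sum_congr rfl fun j _ => Finset.sum_congr rfl fun k _ => by
      rw [hF.localCubic_symm_right hg hp]; ring

theorem affineU3_symm (hN : IsAffineNormalisation f ξ) (hξ : ∀ p, ξ p = c)
    (hd : ∀ p X, (∀ Y, affineMetric f ξ p X Y = 0) → X = 0) (p : M)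
    (X Y Z : TangentSpace (𝓡 n) p) : affineU3 f ξ p X Y Z = affineU3 f ξ p Y X Z ∧
      affineU3 f ξ p X Y Z = affineU3 f ξ p X Z Y := by
  have hG := affineMetric_symm hN hξ p
  have hC := affineCubic_symm hN hξ hd p
  simp only [affineU3, tracefreePart_apply]
  constructor
  · rw [(hC X Y Z).1, hG X Y]; ring
  · rw [(hC X Y Z).2, hG Y Z]; ring

theorem isPseudoMetric_affineMetric (hN : IsAffineNormalisation f ξ) (hξ : ∀ p, ξ p = c)
    (hd : ∀ p X, (∀ Y, affineMetric f ξ p X Y = 0) → X = 0) :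
    IsPseudoMetric (affineMetric f ξ) where
  symm := affineMetric_symm hN hξ
  nondegenerate := hd
  smooth φ hφ i j := ((isLocalSphere_chart hN hξ hφ).smooth_fundForm i j).congr fun x hx => by
    rw [comp2_affineMetric hN hξ hφ hx]

theorem isMetricOn_comp2 (hN : IsAffineNormalisation f ξ) (hξ : ∀ p, ξ p = c)
    (hd : ∀ p X, (∀ Y, affineMetric f ξ p X Y = 0) → X = 0)
    (hφ : φ ∈ atlas (EuclideanSpace ℝ (Fin n)) M) :
    IsMetricOn φ.target (comp2 (affineMetric f ξ) φ) where
  isOpen := φ.open_target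
  symm x _ i j := affineMetric_symm hN hξ _ _ _
  det_ne_zero x hx := by
    rw [comp2_affineMetric hN hξ hφ hx]
    exact (isMetricOn_chart hN hξ hd hφ).det_ne_zero x hx
  smooth := (isPseudoMetric_affineMetric hN hξ hd).smooth φ hφ

theorem smooth_comp1_affineU1 (hN : IsAffineNormalisation f ξ) (hξ : ∀ p, ξ p = c)
    (hd : ∀ p X, (∀ Y, affineMetric f ξ p X Y = 0) → X = 0)
    (hφ : φ ∈ atlas (EuclideanSpace ℝ (Fin n)) M) (i : Fin n) :
    ContDiffOn ℝ ∞ (fun x => comp1 (affineU1 f ξ) φ x i) φ.target :=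
  ((isLocalSphere_chart hN hξ hφ).smooth_localTrace (isMetricOn_chart hN hξ hd hφ) i).congr
    fun x hx => by rw [comp1_affineU1 hN hξ hd hφ hx]

theorem smooth_comp3_affineU3 (hN : IsAffineNormalisation f ξ) (hξ : ∀ p, ξ p = c)
    (hd : ∀ p X, (∀ Y, affineMetric f ξ p X Y = 0) → X = 0)
    (hφ : φ ∈ atlas (EuclideanSpace ℝ (Fin n)) M) (i j k : Fin n) :
    ContDiffOn ℝ ∞ (fun x => comp3 (affineU3 f ξ) φ x i j k) φ.target :=
  ((isLocalSphere_chart hN hξ hφ).smooth_localTracefree (isMetricOn_chart hN hξ hd hφ)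
    i j k).congr fun x hx => by rw [comp3_affineU3 hN hξ hd hφ hx]

theorem curvature_fundForm (hN : IsAffineNormalisation f ξ) (hξ : ∀ p, ξ p = c)
    (hκ : HasConstantCurvature (affineMetric f ξ) κ)
    (hφ : φ ∈ atlas (EuclideanSpace ℝ (Fin n)) M) (hx : x ∈ φ.target) (l i j k : Fin n) :
    curvature (fundForm (f ∘ φ.symm) (fun _ => c)) l i j k x =
      κ * (fundForm (f ∘ φ.symm) (fun _ => c) x j k * (if l = i then 1 else 0) -
        fundForm (f ∘ φ.symm) (fun _ => c) x i k * (if l = j then 1 else 0)) := by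
  rw [← comp2_affineMetric hN hξ hφ hx, ← hκ φ hφ x hx]
  exact (curvature_congr φ.open_target hx (fun y hy => comp2_affineMetric hN hξ hφ hy) l i j k).symm

theorem schouten_affineMetric (hn : 3 ≤ n) (hN : IsAffineNormalisation f ξ) (hξ : ∀ p, ξ p = c)
    (hd : ∀ p X, (∀ Y, affineMetric f ξ p X Y = 0) → X = 0)
    (hκ : HasConstantCurvature (affineMetric f ξ) κ)
    (hφ : φ ∈ atlas (EuclideanSpace ℝ (Fin n)) M) (hx : x ∈ φ.target) (i j : Fin n) :
    schouten (comp2 (affineMetric f ξ) φ) x i j = κ / 2 * comp2 (affineMetric f ξ) φ x i j :=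
  (isMetricOn_comp2 hN hξ hd hφ).schouten_of_constantCurvature hn hx (hκ φ hφ x hx) i j

/-- Transfers the local formula for ∇U to the components of the global tensors, feeding in both
abundance equations. -/
theorem cov3_affineU3 (hξ : ∀ p, ξ p = c) (hA : IsAbundantNormalisation f ξ)
    (hκ : HasConstantCurvature (affineMetric f ξ) κ)
    (hφ : φ ∈ atlas (EuclideanSpace ℝ (Fin n)) M) (hx : x ∈ φ.target) (i j k l : Fin n) :
    cov3 (comp2 (affineMetric f ξ) φ) (comp3 (affineU3 f ξ) φ) l i j k x =
      1 / 9 * projSymZeroThree (comp2 (affineMetric f ξ) φ x)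
        (sOne (comp2 (affineMetric f ξ) φ x) (fun i j k => 3 * comp3 (affineU3 f ξ) φ x i j k)
          (fun i => 3 * comp1 (affineU1 f ξ) φ x i)) i j k l := by
  have hN := hA.normalisation
  have hd := hA.nondegenerate
  have hn := hA.three_le
  have hG := fun y (hy : y ∈ φ.target) => comp2_affineMetric hN hξ hφ hy
  have hu := fun y (hy : y ∈ φ.target) => comp1_affineU1 hN hξ hd hφ hy
  have hU := fun y (hy : y ∈ φ.target) => comp3_affineU3 hN hξ hd hφ hy
  have h3 : ∀ i j k l, cov3 (comp2 (affineMetric f ξ) φ) (comp3 (affineU3 f ξ) φ) i j k l x =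
      cov3 (fundForm (f ∘ φ.symm) (fun _ => c)) (IsLocalSphere.localTracefree (f ∘ φ.symm) c)
        i j k l x := cov3_congr_metric φ.open_target hx hG hU
  have h1 : ∀ i j, cov1 (comp2 (affineMetric f ξ) φ) (comp1 (affineU1 f ξ) φ) i j x =
      cov1 (fundForm (f ∘ φ.symm) (fun _ => c)) (IsLocalSphere.localTrace (f ∘ φ.symm) c)
        i j x := cov1_congr_metric φ.open_target hx hG hu
  have hp := hA.deriv_U φ hφ x hx
  have hq := hA.deriv_u φ hφ x hx
  simp only [schouten_affineMetric hn hN hξ hd hκ hφ hx] at hq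
  simp only [h3, hG x hx, hU x hx, hu x hx] at hp
  simp only [h1, hG x hx, hU x hx, hu x hx] at hq
  rw [h3, hG x hx, hU x hx, hu x hx]
  -- The value of m gathers all multiples of G in the equation for ∇u: the Schouten tensor κG/2 and
  -- the terms in |u|² and |U|².
  refine (isLocalSphere_chart hN hξ hφ).cov3_localTracefree (isMetricOn_chart hN hξ hd hφ) hn hx
    (curvature_fundForm hN hξ hκ hφ hx) hp (m := κ / 2 - normSq1
      (fundForm (f ∘ φ.symm) (fun _ => c) x) (IsLocalSphere.localTrace (f ∘ φ.symm) c x) / 2 +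
      1 / ((n : ℝ) - 2) * (((n : ℝ) - 6) / (2 * ((n : ℝ) + 2) * ((n : ℝ) - 1)) * normSq3
      (fundForm (f ∘ φ.symm) (fun _ => c) x) (IsLocalSphere.localTracefree (f ∘ φ.symm) c x)))
    (fun i j => ?_) i j k l
  rw [hq]; ring

theorem dComp_eq {t : M → ℝ} (ht : ContMDiff (𝓡 n) 𝓘(ℝ, ℝ) ∞ t)
    (hp : ∀ (p : M) (X : TangentSpace (𝓡 n) p),
      (mfderiv (𝓡 n) 𝓘(ℝ, ℝ) t p X : ℝ) = 3 * affineU1 f ξ p X)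
    (hφ : φ ∈ atlas (EuclideanSpace ℝ (Fin n)) M) (hx : x ∈ φ.target) :
    dComp t φ x = fun i => 3 * comp1 (affineU1 f ξ) φ x i := by
  funext i
  rw [dComp, pd_comp_chart_symm hφ hx (ht.mdifferentiableAt (by simp))]
  exact hp _ _

/-- The Hessian equation is a rescaling of the equation for u; the remaining equations for S come
from the Gauss and Codazzi equations in constant curvature. -/
theorem isAbundantManifold_of_correspondsTo (hξ : ∀ p, ξ p = c)
    (hA : IsAbundantNormalisation f ξ) (hκ : HasConstantCurvature (affineMetric f ξ) κ)
    {S : Tensor3 n M} {t : M → ℝ} (h : CorrespondsTo f ξ (affineMetric f ξ) S t) :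
    IsAbundantManifold (affineMetric f ξ) S t := by
  have hN := hA.normalisation
  have hd := hA.nondegenerate
  have hn := hA.three_le
  have hn' : (3 : ℝ) ≤ n := by exact_mod_cast hn
  have hS : ∀ (φ : OpenPartialHomeomorph M (EuclideanSpace ℝ (Fin n))) x, comp3 S φ x =
      fun i j k => 3 * comp3 (affineU3 f ξ) φ x i j k := fun φ x => by
    funext i j k
    simp only [comp3, h.cubic]
    rfl
  have hu := fun φ hφ x hx => dComp_eq (φ := φ) (x := x) h.smooth_t h.potential hφ hx
  refine
    { three_le := hn
      metric := isPseudoMetric_affineMetric hN hξ hd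
      conformallyFlat := ⟨hA.weylFlat, fun _ φ hφ x hx i j k => ?_⟩
      smooth_t := h.smooth_t
      smooth_S := fun φ hφ i j k => ?_
      symm_S := fun p X Y Z => ?_
      tracefree_S := fun φ hφ x hx k => ?_
      hessian_t := fun φ hφ x hx i j => ?_
      deriv_S := fun φ hφ x hx i j k l => ?_
      weyl_S := fun φ hφ x hx i j k l => ?_ }
  · have hg := isMetricOn_comp2 hN hξ hd hφ
    have hP := fun y (hy : y ∈ φ.target) => schouten_affineMetric hn hN hξ hd hκ hφ hy
    rw [cotton, hg.cov2_eq_zero_of_eq_metric hx hP, hg.cov2_eq_zero_of_eq_metric hx hP, sub_self]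
  · simp only [hS]
    exact contDiffOn_const.mul (smooth_comp3_affineU3 hN hξ hd hφ i j k)
  · have hsym := affineU3_symm hN hξ hd p X Y Z
    rw [h.cubic]
    constructor
    · exact congrArg (fun z => (3 : ℝ) * z) hsym.1
    · exact congrArg (fun z => (3 : ℝ) * z) hsym.2
  · have hg := isMetricOn_chart hN hξ hd hφ
    simp only [hS, comp2_affineMetric hN hξ hφ hx, comp3_affineU3 hN hξ hd hφ hx]
    rw [tr2_const_mul, (isLocalSphere_chart hN hξ hφ).tr2_localTracefree hg hx, mul_zero]
  · have hg := isMetricOn_comp2 hN hξ hd hφ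
    -- Quadratic expressions in S and dt scale by 9, and 9·⅓ = 3 matches the factor in ∇dt = 3∇u.
    rw [cov1_congr_metric φ.open_target hx (fun _ _ => rfl) (hu φ hφ),
      hg.cov1_const_mul hx 3 (v := comp1 (affineU1 f ξ) φ)
        (smooth_comp1_affineU1 hN hξ hd hφ), hA.deriv_u φ hφ x hx, hu φ hφ x hx, hS,
      normSq1_scale, traceSq_scale, normSq3_scale]
    have n2 : (n : ℝ) - 2 ≠ 0 := by linarith
    have n1 : (n : ℝ) - 1 ≠ 0 := by linarith
    have n2' : (n : ℝ) + 2 ≠ 0 := by linarith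
    field_simp
    ring
  · have hg := isMetricOn_comp2 hN hξ hd hφ
    rw [cov3_congr_metric φ.open_target hx (fun _ _ => rfl) (fun y _ => hS φ y),
      hg.cov3_const_mul hx 3 (T := comp3 (affineU3 f ξ) φ)
        (smooth_comp3_affineU3 hN hξ hd hφ), cov3_affineU3 hξ hA hκ hφ hx, hu φ hφ x hx, hS]
    ring
  · have hg := isMetricOn_chart hN hξ hd hφ
    have hF := isLocalSphere_chart hN hξ hφ
    rw [hS, comp2_affineMetric hN hξ hφ hx, comp3_affineU3 hN hξ hd hφ hx]
    exact projWeyl_pairTwo_eq_zero hn (hg.symm x hx) (hg.det_ne_zero x hx)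
      (hF.localTracefree_symm_left hg hx) (hF.localTracefree_symm_right hg hx)
      (hF.gauss_cubicOf hg hx (curvature_fundForm hN hξ hκ hφ hx)) 3 i j k l

/-- By the contracted Gauss equation, 𝒮 and S(·,·,grad t) + dt⊗dt are multiples of the same W modulo
G; the Schouten tensor is pure trace. -/
theorem isProper_of_correspondsTo (hξ : ∀ p, ξ p = c)
    (hA : IsAbundantNormalisation f ξ) (hκ : HasConstantCurvature (affineMetric f ξ) κ)
    {S : Tensor3 n M} {t : M → ℝ} (h : CorrespondsTo f ξ (affineMetric f ξ) S t) :
    IsProper (affineMetric f ξ) S t := by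
  intro φ hφ x hx i j
  have hN := hA.normalisation
  have hd := hA.nondegenerate
  have hn := hA.three_le
  have hn' : (3 : ℝ) ≤ n := by exact_mod_cast hn
  have n2 : (n : ℝ) - 2 ≠ 0 := by linarith
  have hS : comp3 S φ x = fun i j k => 3 * comp3 (affineU3 f ξ) φ x i j k := by
    funext i j k
    simp only [comp3, h.cubic]
    rfl
  have hg := isMetricOn_chart hN hξ hd hφ
  have hF := isLocalSphere_chart hN hξ hφ
  have hs := hg.symm x hx
  have hdet := hg.det_ne_zero x hx
  have hP : tracefree2 (comp2 (affineMetric f ξ) φ x) (schouten (comp2 (affineMetric f ξ) φ) x)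
      i j = 0 := by
    have hg' := isMetricOn_comp2 hN hξ hd hφ
    exact tracefree2_eq_zero_of_eq (hg'.symm x hx) (hg'.det_ne_zero x hx) (by omega)
      (schouten_affineMetric hn hN hξ hd hκ hφ hx) i j
  rw [tau, hP, hS, dComp_eq h.smooth_t h.potential hφ hx, comp2_affineMetric hN hξ hφ hx,
    comp3_affineU3 hN hξ hd hφ hx, comp1_affineU1 hN hξ hd hφ hx]
  set G := fundForm (f ∘ φ.symm) (fun _ => c) x
  set U := IsLocalSphere.localTracefree (f ∘ φ.symm) c x
  set u := IsLocalSphere.localTrace (f ∘ φ.symm) c x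
  have hT := traceSq_eq hs hdet (hF.localTracefree_symm_left hg hx)
    (hF.localTracefree_symm_right hg hx) (hF.tr2_localTracefree hg hx)
    (hF.gauss_cubicOf hg hx (curvature_fundForm hN hξ hκ hφ hx))
  have e1 : traceSq G (fun i j k => 3 * U i j k) = fun i j =>
      (9 * ((n : ℝ) - 2)) * contractAddSq G U u i j +
      (9 * (dualInner G u u + (κ + dualInner G u u) * ((n : ℝ) - 1))) * G i j := by
    funext i j
    rw [traceSq_scale, hT]; ring
  have e2 : (fun a b => contract G (fun i j k => 3 * U i j k) (fun i => 3 * u i) a b +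
      3 * u a * (3 * u b)) = fun a b => 9 * contractAddSq G U u a b := by
    funext a b
    rw [contract_scale, contractAddSq]; ring
  -- The remaining coefficients of W₀ are 2/(3(n-2))·9(n-2) = 6 and ⅔·9 = 6, with opposite signs.
  rw [e1, e2, tracefree2_add, tracefree2_const_mul, tracefree2_const_mul,
    tracefree2_eq_zero_of_eq hs hdet (by omega) (fun _ _ => rfl)]
  field_simp
  ring

/-- The local potentials agree on overlaps exactly, not merely up to constants, so they glue to one
function and no topological assumption is needed. -/
theorem exists_correspondsTo (hξ : ∀ p, ξ p = c) (hN : IsAffineNormalisation f ξ)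
    (hd : ∀ p X, (∀ Y, affineMetric f ξ p X Y = 0) → X = 0) :
    ∃ (g : Tensor2 n M) (S : Tensor3 n M) (t : M → ℝ), CorrespondsTo f ξ g S t := by
  -- Each point uses its own preferred chart; chart independence, proved next, identifies t with the
  -- local potential throughout any atlas chart.
  let t : M → ℝ := fun p =>
    localPotential (f ∘ (chartAt (EuclideanSpace ℝ (Fin n)) p).symm) c
      (chartAt (EuclideanSpace ℝ (Fin n)) p p)
  have ht : ∀ φ ∈ atlas (EuclideanSpace ℝ (Fin n)) M, ∀ x ∈ φ.target,
      (t ∘ φ.symm) x = localPotential (f ∘ φ.symm) c x := fun φ hφ x hx => by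
    have hψ := chart_mem_atlas (EuclideanSpace ℝ (Fin n)) (φ.symm x)
    exact ((isChange_chart hN hξ hφ hψ).localPotential_eq (isMetricOn_chart hN hξ hd hψ)
      (mem_transition_source hx)).symm
  have hsmooth : ContMDiff (𝓡 n) 𝓘(ℝ, ℝ) ∞ t := by
    intro p
    have hφ := chart_mem_atlas (EuclideanSpace ℝ (Fin n)) p
    set φ := chartAt (EuclideanSpace ℝ (Fin n)) p with hφ_def
    have h1 : ContMDiffOn (𝓡 n) 𝓘(ℝ, ℝ) ∞ (localPotential (f ∘ φ.symm) c ∘ φ) φ.source :=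
      (contMDiffOn_iff_contDiffOn.mpr ((isLocalSphere_chart hN hξ hφ).smooth_localPotential
        (isMetricOn_chart hN hξ hd hφ))).comp
        (contMDiffOn_of_mem_maximalAtlas (IsManifold.subset_maximalAtlas hφ))
        (fun q hq => φ.map_source hq)
    have h2 : ContMDiffOn (𝓡 n) 𝓘(ℝ, ℝ) ∞ t φ.source := h1.congr fun q hq => by
      have := ht φ hφ (φ q) (φ.map_source hq)
      rwa [Function.comp_apply, φ.left_inv hq] at this
    exact h2.contMDiffAt (φ.open_source.mem_nhds (mem_chart_source _ p))
  have hpot : ∀ φ ∈ atlas (EuclideanSpace ℝ (Fin n)) M, ∀ x ∈ φ.target,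
      ∀ X : TangentSpace (𝓡 n) (φ.symm x),
      (mfderiv (𝓡 n) 𝓘(ℝ, ℝ) t (φ.symm x) X : ℝ) = 3 * affineU1 f ξ (φ.symm x) X := by
    intro φ hφ x hx X
    let L : TangentSpace (𝓡 n) (φ.symm x) →ₗ[ℝ] ℝ :=
      (mfderiv (𝓡 n) 𝓘(ℝ, ℝ) t (φ.symm x)).toLinearMap
    have hL : ∀ i, L (coordVec φ x i) = 3 * affineU1 f ξ (φ.symm x) (coordVec φ x i) := fun i => by
      have h1 := pd_comp_chart_symm hφ hx (hsmooth.mdifferentiableAt (by simp)) i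
      have h2 := pd_congr φ.open_target hx (ht φ hφ) i
      rw [(isLocalSphere_chart hN hξ hφ).pd_localPotential (isMetricOn_chart hN hξ hd hφ) hx,
        ← comp1_affineU1 hN hξ hd hφ hx] at h2
      exact h1.symm.trans h2
    -- Both sides are linear in X, so agreement on coordinate vectors suffices.
    obtain ⟨w, rfl⟩ := exists_eq_sum_coordVec hφ hx X
    change L _ = _
    simp only [map_sum, map_smul, hL, smul_eq_mul]
    refine Eq.trans ?_ (Finset.mul_sum _ _ _).symm
    exact Finset.sum_congr rfl fun i _ => mul_left_comm _ _ _
  refine ⟨affineMetric f ξ, fun p => (3 : ℝ) • affineU3 f ξ p, t, rfl, fun _ => rfl, hsmooth,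
    fun p X => ?_⟩
  have hφ := chart_mem_atlas (EuclideanSpace ℝ (Fin n)) p
  have hp := mem_chart_source (EuclideanSpace ℝ (Fin n)) p
  generalize chartAt (EuclideanSpace ℝ (Fin n)) p = φ at hφ hp
  obtain ⟨x, hx, rfl⟩ : ∃ x ∈ φ.target, φ.symm x = p := ⟨φ p, φ.map_source hp, φ.left_inv hp⟩
  exact hpot φ hφ x hx X

end ImproperSpheres
end AbundantGeometry

end

theorem mainTheorem7 {n : ℕ} (hn : 3 ≤ n) {M : Type*} [TopologicalSpace M]
    [ChartedSpace (EuclideanSpace ℝ (Fin n)) M] [IsManifold (𝓡 n) ∞ M]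
    (f ξ : M → (Fin (n + 1) → ℝ))
    (hsphere : IsImproperRelativeSphere f ξ)
    (habundant : IsAbundantNormalisation f ξ)
    (κ : ℝ) (hκ : HasConstantCurvature (affineMetric f ξ) κ) :
    (∃ (g : Tensor2 n M) (S : Tensor3 n M) (t : M → ℝ), CorrespondsTo f ξ g S t) ∧
    ∀ (g : Tensor2 n M) (S : Tensor3 n M) (t : M → ℝ), CorrespondsTo f ξ g S t →
      IsAbundantManifold g S t ∧ IsProper g S t := by
  obtain ⟨c, -, hξ⟩ := hsphere.constant
  refine ⟨exists_correspondsTo hξ hsphere.normalisation habundant.nondegenerate, ?_⟩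
  intro g S t h
  -- Only g is substituted; t remains an arbitrary function with dt = 3u, so the conclusion covers
  -- every choice of potential.
  obtain rfl := h.metric
  exact ⟨isAbundantManifold_of_correspondsTo hξ habundant hκ h,
    isProper_of_correspondsTo hξ habundant hκ h⟩
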